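/- Let $\mathfrak g$ be a finite-dimensional simple Lie algebra over $\mathbf C$ with a nondegenerate symmetric invariant bilinear form $(\cdot\mid\cdot)$, let $G$ be a connected algebraic group with Lie algebra $\mathfrak g$, and let $\Phi:\mathfrak g\to\mathfrak g^*$, $x\mapsto(x\mid\cdot)$. The symmetric algebra $\mathcal S(\mathfrak g)=\mathbf C[\mathfrak g^*]$ carries the Kirillov–Kostant Poisson bracket, which extends the Lie bracket of $\mathfrak g$. For $i=1,2$ let $f_i\in\mathfrak g$ be nilpotent, $\chi_i=\Phi(f_i)$, and let $\mathfrak g=\bigoplus_{j\in\mathbf Z}\mathfrak g^{(i)}_j$ be a Lie algebra grading that is good for $f_i$: $f_i\in\mathfrak g^{(i)}_{-2}$, and $\operatorname{ad}(f_i):\mathfrak g^{(i)}_j\to\mathfrak g^{(i)}_{j-2}$ is injective for $j\ge1$ and surjective for $j\le1$. Let $q_i$ be the semisimple element with $\mathfrak g^{(i)}_j=\{x:[q_i,x]=jx\}$, and assume that $q_1,q_2$ lie in a common Cartan subalgebra $\mathfrak h$. Let $\mathfrak m_i=\mathfrak l_i\oplus\bigoplus_{j\ge2}\mathfrak g^{(i)}_j$,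 where $\mathfrak l_i\subseteq\mathfrak g^{(i)}_1$ is Lagrangian for the form $\chi_i([\cdot,\cdot])$; let $M_i\subseteq G$ be the connected unipotent subgroup with Lie algebra $\mathfrak m_i$, acting on $\mathfrak g^*$ by the coadjoint action, and $\mu_i:\mathfrak g^*\to\mathfrak m_i^*$, $\xi\mapsto(\xi-\chi_i)|_{\mathfrak m_i}$. Let $I_i$ be the ideal of $\mathcal S(\mathfrak g)$ spanned by $y-\chi_i(y)$, $y\in\mathfrak m_i$, and let $\mathcal P(\mathfrak g,f_i)=(\mathcal S(\mathfrak g)/I_i)^{\operatorname{ad}\mathfrak m_i}$ be the classical finite W-algebra, with the Poisson bracket $\{X\bmod I_i,Y\bmod I_i\}=\{X,Y\}\bmod I_i$. Let $(e_2,h_2,f_2)$ be an $\mathfrak{sl}_2$-triple with $h_2\in\mathfrak g^{(2)}_0$, $e_2\in\mathfrak g^{(2)}_2$ (the zero triple if $f_2=0$), and let $S_{f_2}=\Phi(f_2+\operatorname{Ker}\operatorname{ad}e_2)$ be the Slodowy slice. Assume that: 1. $\mathfrak m_2=\mathfrak m_1\oplus\mathfrak m_0$, where $\mathfrak m_0$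 is an $\mathfrak h$-stable Lie subalgebra and $\mathfrak m_1$ is an ideal of $\mathfrak m_2$; 2. $f_2-f_1$ and $\mathfrak m_0$ are contained in $\mathfrak g^{(1)}_0$; 3. $q_2-q_1$ commutes with $f_1$. Let $M_0\subseteq G$ be the unipotent subgroup with Lie algebra $\mathfrak m_0$. Then $S_{f_2}\subseteq\mu_2^{-1}(0)\subseteq\mu_1^{-1}(0)$. For $i=1,2$ the geometric quotient $\mu_i^{-1}(0)/M_i$ exists as an affine variety, with coordinate ring $\mathcal P(\mathfrak g,f_i)$ (the class $X\bmod I_i$ being the function $[\xi]\mapsto X(\xi)$), and restriction of functions to $S_{f_2}$ is an isomorphism $\mathcal P(\mathfrak g,f_2)\cong\mathbf C[S_{f_2}]$; these varieties are given the corresponding Poisson structures. The group $M_0$ acts on $\mu_1^{-1}(0)/M_1$ by $g\cdot[\xi]=[\operatorname{Ad}^*(g)\xi]$, and the map $\mu_0:\mu_1^{-1}(0)/M_1\to\mathfrak m_0^*$, $[\xi]\mapsto(\xi-\chi_2)|_{\mathfrak m_0}$, is well defined. The elements $(y-\chi_2(y))\bmod I_1$, $y\in\mathfrak m_0$, lie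 in $\mathcal P(\mathfrak g,f_1)$; let $I_0$ be the ideal of $\mathcal P(\mathfrak g,f_1)$ that they span. Moreover: (a) $\mu_0^{-1}(0)$ is $M_0$-stable, the geometric quotient $\mu_0^{-1}(0)/M_0$ exists as an affine variety, its coordinate ring is $(\mathcal P(\mathfrak g,f_1)/I_0)^{\operatorname{ad}\mathfrak m_0}$, so that it is a Poisson variety for the bracket induced from $\mathcal P(\mathfrak g,f_1)$, and it is isomorphic to $S_{f_2}$ as a Poisson variety. (b) The inclusion $\mu_2^{-1}(0)\subseteq\mu_1^{-1}(0)$ induces an isomorphism of Poisson varieties $\mu_2^{-1}(0)/M_2\cong\mu_0^{-1}(0)/M_0$. (c) The comorphism of the isomorphism in (b) is $$\Psi:(\mathcal P(\mathfrak g,f_1)/I_0)^{\operatorname{ad}\mathfrak m_0}\to\mathcal P(\mathfrak g,f_2),\qquad (X\bmod I_1)\bmod I_0\mapsto X\bmod I_2,$$ and it is an isomorphism of Poisson algebras. -/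

import Mathlib

open Module

noncomputable section

/-! ### Poisson algebras and their Hamiltonian reductions -/

/-- A Poisson bracket on a commutative `ℂ`-algebra. -/
structure PoissonStructure (A : Type*) [CommRing A] [Algebra ℂ A] where
  bracket : A →ₗ[ℂ] A →ₗ[ℂ] A
  bracket_self : ∀ a, bracket a a = 0
  jacobi : ∀ a b c,
    bracket a (bracket b c) = bracket (bracket a b) c + bracket b (bracket a c)
  leibniz : ∀ a b c, bracket a (b * c) = b * bracket a c + c * bracket a b

namespace PoissonStructure

variable {A : Type*} [CommRing A] [Algebra ℂ A] (P : PoissonStructure A)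

theorem bracket_swap (a b : A) : P.bracket a b = -P.bracket b a := by
  have h := P.bracket_self (a + b)
  simp only [map_add, LinearMap.add_apply, P.bracket_self, zero_add, add_zero] at h
  exact eq_neg_of_add_eq_zero_right h

theorem bracket_one (a : A) : P.bracket a 1 = 0 := by
  have h := P.leibniz a 1 1
  simpa using h

/-- Transport of a Poisson bracket along an algebra isomorphism. -/
def transport {A' : Type*} [CommRing A'] [Algebra ℂ A'] (e : A ≃ₐ[ℂ] A') :
    PoissonStructure A' where
  bracket := (P.bracket.compl₁₂ e.symm.toLinearMap e.symm.toLinearMap).compr₂ e.toLinearMap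
  bracket_self a := by simp [P.bracket_self]
  jacobi a b c := by
    simp [P.jacobi (e.symm a) (e.symm b) (e.symm c)]
  leibniz a b c := by
    simp [P.leibniz]

variable (T : Set A)

/-- The elements `X` of `A` such that `{t, X}` lies in the ideal spanned by `T`,
for all `t ∈ T`. -/
def normalizer : Subalgebra ℂ A where
  carrier := {X | ∀ t ∈ T, P.bracket t X ∈ Ideal.span T}
  mul_mem' {X Y} hX hY t ht := by
    rw [P.leibniz]
    exact Ideal.add_mem _ (Ideal.mul_mem_left _ _ (hY t ht)) (Ideal.mul_mem_left _ _ (hX t ht))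
  add_mem' {X Y} hX hY t ht := by
    rw [map_add]
    exact Ideal.add_mem _ (hX t ht) (hY t ht)
  algebraMap_mem' r t ht := by
    rw [Algebra.algebraMap_eq_smul_one, map_smul, P.bracket_one, smul_zero]
    exact Ideal.zero_mem _

/-- The algebra `(A / I)^{ad T}`, where `I` is the ideal of `A` spanned by `T`: it consists of
all classes `X mod I` such that `{t, X} ∈ I` for all `t ∈ T`. -/
def reduction : Subalgebra ℂ (A ⧸ Ideal.span T) :=
  (P.normalizer T).map (Ideal.Quotient.mkₐ ℂ (Ideal.span T))

variable {P T}

theorem bracket_mem_of_mem_span {i X : A} (hi : i ∈ Ideal.span T) (hX : X ∈ P.normalizer T) :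
    P.bracket i X ∈ Ideal.span T := by
  induction hi using Submodule.span_induction with
  | mem t ht => exact hX t ht
  | zero => simp
  | add a b _ _ ha hb =>
    rw [map_add, LinearMap.add_apply]
    exact Ideal.add_mem _ ha hb
  | smul a b hb' hb =>
    rw [P.bracket_swap, smul_eq_mul, P.leibniz, neg_add]
    refine Ideal.add_mem _ ?_ ?_
    · rw [P.bracket_swap X b, mul_neg, neg_neg]
      exact Ideal.mul_mem_left _ _ hb
    · exact neg_mem (Ideal.mul_mem_right _ _ hb')

theorem bracket_mem_normalizer {X Y : A} (hX : X ∈ P.normalizer T) (hY : Y ∈ P.normalizer T) :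
    P.bracket X Y ∈ P.normalizer T := by
  intro t ht
  rw [P.jacobi]
  refine Ideal.add_mem _ (bracket_mem_of_mem_span (hX t ht) hY) ?_
  rw [P.bracket_swap]
  exact neg_mem (bracket_mem_of_mem_span (hY t ht) hX)

variable (P T)

/-- A representative in the normalizer of an element of the reduction. -/
def rep (p : P.reduction T) : A := p.2.choose

theorem rep_mem (p : P.reduction T) : P.rep T p ∈ P.normalizer T := p.2.choose_spec.1

theorem mk_rep (p : P.reduction T) :
    Ideal.Quotient.mk (Ideal.span T) (P.rep T p) = p.1 := p.2.choose_spec.2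

/-- The reduced bracket as a function. -/
def redBr (p q : P.reduction T) : P.reduction T :=
  ⟨Ideal.Quotient.mk _ (P.bracket (P.rep T p) (P.rep T q)),
    ⟨_, bracket_mem_normalizer (P.rep_mem T p) (P.rep_mem T q), rfl⟩⟩

theorem redBr_eq {X Y : A} (hX : X ∈ P.normalizer T)
    {p q : P.reduction T} (hp : Ideal.Quotient.mk (Ideal.span T) X = p.1)
    (hq : Ideal.Quotient.mk (Ideal.span T) Y = q.1) :
    (P.redBr T p q).1 = Ideal.Quotient.mk _ (P.bracket X Y) := by
  change Ideal.Quotient.mk _ (P.bracket (P.rep T p) (P.rep T q)) = _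
  rw [Ideal.Quotient.eq]
  have h1 : P.rep T p - X ∈ Ideal.span T := by
    rw [← Ideal.Quotient.eq, mk_rep, hp]
  have h2 : P.rep T q - Y ∈ Ideal.span T := by
    rw [← Ideal.Quotient.eq, mk_rep, hq]
  have h3 : P.bracket (P.rep T p) (P.rep T q) - P.bracket X Y =
      P.bracket (P.rep T p - X) (P.rep T q) + -P.bracket (P.rep T q - Y) X := by
    rw [← P.bracket_swap X]
    simp
  rw [h3]
  exact Ideal.add_mem _ (bracket_mem_of_mem_span h1 (P.rep_mem T q))
    (neg_mem (bracket_mem_of_mem_span h2 hX))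

/-- The Poisson bracket on `(A / I)^{ad T}`:
`{X mod I, Y mod I} = {X, Y} mod I`. -/
def reduced : PoissonStructure (P.reduction T) where
  bracket := LinearMap.mk₂ ℂ (P.redBr T)
    (fun p p' q => by
      apply Subtype.ext
      rw [P.redBr_eq T (add_mem (P.rep_mem T p) (P.rep_mem T p'))
        (by simp [mk_rep]) (P.mk_rep T q)]
      simp [redBr])
    (fun c p q => by
      apply Subtype.ext
      rw [P.redBr_eq T (Subalgebra.smul_mem _ (P.rep_mem T p) c)
        (by rw [← Ideal.Quotient.mkₐ_eq_mk ℂ, map_smul, Ideal.Quotient.mkₐ_eq_mk, mk_rep]; rfl)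
        (P.mk_rep T q)]
      rw [map_smul, LinearMap.smul_apply, ← Ideal.Quotient.mkₐ_eq_mk ℂ, map_smul]
      rfl)
    (fun p q q' => by
      apply Subtype.ext
      rw [P.redBr_eq T (Y := P.rep T q + P.rep T q') (P.rep_mem T p)
        (P.mk_rep T p) (by simp [mk_rep])]
      simp [redBr])
    (fun c p q => by
      apply Subtype.ext
      rw [P.redBr_eq T (Y := c • P.rep T q) (P.rep_mem T p)
        (P.mk_rep T p)
        (by rw [← Ideal.Quotient.mkₐ_eq_mk ℂ, map_smul, Ideal.Quotient.mkₐ_eq_mk, mk_rep]; rfl)]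
      rw [map_smul, ← Ideal.Quotient.mkₐ_eq_mk ℂ, map_smul]
      rfl)
  bracket_self p := by
    apply Subtype.ext
    simp [redBr, P.bracket_self]
  jacobi p q r := by
    apply Subtype.ext
    have hp := P.rep_mem T p
    have hq := P.rep_mem T q
    simp only [LinearMap.mk₂_apply, AddMemClass.coe_add]
    rw [P.redBr_eq T hp (P.mk_rep T p) rfl,
      P.redBr_eq T (bracket_mem_normalizer hp hq) rfl (P.mk_rep T r),
      P.redBr_eq T hq (P.mk_rep T q) rfl, P.jacobi, map_add]
  leibniz p q r := by
    apply Subtype.ext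
    have hp := P.rep_mem T p
    simp only [LinearMap.mk₂_apply, AddMemClass.coe_add, MulMemClass.coe_mul]
    rw [P.redBr_eq T (Y := P.rep T q * P.rep T r) hp (P.mk_rep T p) (by simp [mk_rep]), P.leibniz,
      map_add, map_mul, map_mul, mk_rep, mk_rep]
    rfl

theorem reduced_bracket_mk {X Y : A} (hX : X ∈ P.normalizer T)
    {p q : P.reduction T} (hp : Ideal.Quotient.mk (Ideal.span T) X = p.1)
    (hq : Ideal.Quotient.mk (Ideal.span T) Y = q.1) :
    ((P.reduced T).bracket p q).1 = Ideal.Quotient.mk _ (P.bracket X Y) :=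
  P.redBr_eq T hX hp hq

end PoissonStructure

/-! ### The Kirillov-Kostant Poisson bracket on the symmetric algebra of a Lie algebra -/

namespace KirillovKostant

open SymmetricAlgebra

section Der

variable {V : Type*} [AddCommGroup V] [Module ℂ V]

/-- Auxiliary algebra map `F ↦ F + δ(F) ε`. -/
def symDerAux (δ : V →ₗ[ℂ] SymmetricAlgebra ℂ V) :
    SymmetricAlgebra ℂ V →ₐ[ℂ]
      TrivSqZeroExt (SymmetricAlgebra ℂ V) (SymmetricAlgebra ℂ V) :=
  SymmetricAlgebra.lift
    ((TrivSqZeroExt.inlAlgHom ℂ (SymmetricAlgebra ℂ V) (SymmetricAlgebra ℂ V)).toLinearMap ∘ₗ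
        SymmetricAlgebra.ι ℂ V +
      (TrivSqZeroExt.inrHom (SymmetricAlgebra ℂ V) (SymmetricAlgebra ℂ V)).restrictScalars ℂ ∘ₗ δ)

theorem fst_symDerAux (δ : V →ₗ[ℂ] SymmetricAlgebra ℂ V) (a : SymmetricAlgebra ℂ V) :
    (symDerAux δ a).fst = a := by
  have h : (TrivSqZeroExt.fstHom ℂ (SymmetricAlgebra ℂ V) (SymmetricAlgebra ℂ V)).comp
      (symDerAux δ) = AlgHom.id ℂ _ := by
    apply SymmetricAlgebra.algHom_ext
    ext x
    simp [symDerAux]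
  exact DFunLike.congr_fun h a

/-- The derivation of the symmetric algebra extending a linear map on `V`. -/
def symDer (δ : V →ₗ[ℂ] SymmetricAlgebra ℂ V) :
    Derivation ℂ (SymmetricAlgebra ℂ V) (SymmetricAlgebra ℂ V) :=
  Derivation.mk'
    ((TrivSqZeroExt.sndHom (SymmetricAlgebra ℂ V) (SymmetricAlgebra ℂ V)).restrictScalars ℂ ∘ₗ
      (symDerAux δ).toLinearMap)
    (fun a b => by
      simp [fst_symDerAux, mul_comm])

theorem symDer_ι (δ : V →ₗ[ℂ] SymmetricAlgebra ℂ V) (x : V) :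
    symDer δ (SymmetricAlgebra.ι ℂ V x) = δ x := by
  simp [symDer, symDerAux]

theorem der_ext {D E : Derivation ℂ (SymmetricAlgebra ℂ V) (SymmetricAlgebra ℂ V)}
    (h : ∀ x, D (SymmetricAlgebra.ι ℂ V x) = E (SymmetricAlgebra.ι ℂ V x)) : D = E := by
  ext a
  induction a using SymmetricAlgebra.induction with
  | algebraMap r => simp
  | ι x => exact h x
  | mul a b ha hb => simp [ha, hb]
  | add a b ha hb => simp [ha, hb]

end Der

variable {L : Type*} [LieRing L] [LieAlgebra ℂ L]

/-- `{x, ·}` for `x` in the Lie algebra. -/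
def hamVec (x : L) : Derivation ℂ (SymmetricAlgebra ℂ L) (SymmetricAlgebra ℂ L) :=
  symDer (SymmetricAlgebra.ι ℂ L ∘ₗ (LieAlgebra.ad ℂ L x : L →ₗ[ℂ] L))

theorem hamVec_ι (x y : L) :
    hamVec x (SymmetricAlgebra.ι ℂ L y) = SymmetricAlgebra.ι ℂ L ⁅x, y⁆ := by
  simp [hamVec, symDer_ι]

theorem hamVec_add (x y : L) : hamVec (x + y) = hamVec x + hamVec y :=
  der_ext fun z => by simp [hamVec_ι]

theorem hamVec_smul (c : ℂ) (x : L) : hamVec (c • x) = c • hamVec x :=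
  der_ext fun z => by simp [hamVec_ι]

/-- `{·, b}`. -/
def rightBr (b : SymmetricAlgebra ℂ L) :
    Derivation ℂ (SymmetricAlgebra ℂ L) (SymmetricAlgebra ℂ L) :=
  symDer
    { toFun := fun x => hamVec x b
      map_add' := fun x y => by simp [hamVec_add]
      map_smul' := fun c x => by simp [hamVec_smul] }

theorem rightBr_ι (b : SymmetricAlgebra ℂ L) (x : L) :
    rightBr b (SymmetricAlgebra.ι ℂ L x) = hamVec x b := by
  simp [rightBr, symDer_ι]

theorem rightBr_add (a b : SymmetricAlgebra ℂ L) : rightBr (a + b) = rightBr a + rightBr b :=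
  der_ext fun z => by simp [rightBr_ι]

theorem rightBr_smul (c : ℂ) (b : SymmetricAlgebra ℂ L) : rightBr (c • b) = c • rightBr b :=
  der_ext fun z => by simp [rightBr_ι]

theorem rightBr_mul (a b : SymmetricAlgebra ℂ L) :
    rightBr (a * b) = a • rightBr b + b • rightBr a :=
  der_ext fun z => by simp [rightBr_ι]

/-- The bracket as a bilinear map. -/
def br : SymmetricAlgebra ℂ L →ₗ[ℂ] SymmetricAlgebra ℂ L →ₗ[ℂ] SymmetricAlgebra ℂ L :=
  LinearMap.mk₂ ℂ (fun a b => rightBr b a)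
    (fun a b c => by simp) (fun c a b => by simp)
    (fun a b c => by simp [rightBr_add]) (fun c a b => by simp [rightBr_smul])

theorem br_apply (a b : SymmetricAlgebra ℂ L) : br a b = rightBr b a := rfl

theorem br_ι_ι (x y : L) : br (SymmetricAlgebra.ι ℂ L x) (SymmetricAlgebra.ι ℂ L y) =
    SymmetricAlgebra.ι ℂ L ⁅x, y⁆ := by
  rw [br_apply, rightBr_ι, hamVec_ι]

theorem br_mul (a b c : SymmetricAlgebra ℂ L) : br a (b * c) = b * br a c + c * br a b := by
  simp [br_apply, rightBr_mul]

theorem br_swap (a b : SymmetricAlgebra ℂ L) : br a b = -br b a := by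
  have h2 : ∀ x : L, rightBr (SymmetricAlgebra.ι ℂ L x) = -hamVec x := fun x =>
    der_ext fun z => by
      rw [rightBr_ι, hamVec_ι, Derivation.neg_apply, hamVec_ι, ← map_neg, lie_skew]
  -- `{b, ·}` is a derivation
  let D : Derivation ℂ (SymmetricAlgebra ℂ L) (SymmetricAlgebra ℂ L) :=
    Derivation.mk' (br b) (fun a c => by simp [br_mul])
  have h3 : rightBr b = -D := der_ext fun z => by
    rw [rightBr_ι, Derivation.neg_apply]
    change _ = -rightBr (SymmetricAlgebra.ι ℂ L z) b
    rw [h2]; simp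
  rw [br_apply, h3]
  rfl

theorem br_jacobi (a b c : SymmetricAlgebra ℂ L) :
    br a (br b c) = br (br a b) c + br b (br a c) := by
  have hmul : ∀ a b c : SymmetricAlgebra ℂ L, br (a * b) c = a * br b c + b * br a c := by
    intro a b c
    rw [br_swap, br_mul, br_swap b c, br_swap a c]; ring
  have hC : ∀ (r : ℂ) (c : SymmetricAlgebra ℂ L), br (algebraMap ℂ _ r) c = 0 := fun r c => by
    simp [br_apply]
  have hC' : ∀ (r : ℂ) (c : SymmetricAlgebra ℂ L), br c (algebraMap ℂ _ r) = 0 := fun r c => by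
    rw [br_swap, hC, neg_zero]
  induction a using SymmetricAlgebra.induction with
  | algebraMap r => simp [hC]
  | add a a' ha ha' => simp only [map_add, LinearMap.add_apply, ha, ha']; ring
  | mul a a' ha ha' =>
    simp only [hmul, br_mul, map_add, LinearMap.add_apply, ha, ha', br_swap b a, br_swap b a']
    ring
  | ι x =>
    induction b using SymmetricAlgebra.induction with
    | algebraMap r => simp [hC, hC']
    | add b b' hb hb' => simp only [map_add, LinearMap.add_apply, hb, hb']; ring
    | mul b b' hb hb' => simp only [hmul, br_mul, map_add, LinearMap.add_apply, hb, hb']; ring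
    | ι y =>
      induction c using SymmetricAlgebra.induction with
      | algebraMap r => simp [hC']
      | add c c' hc hc' => simp only [map_add, hc, hc']; ring
      | mul c c' hc hc' => simp only [br_mul, map_add, hc, hc']; ring
      | ι z => simp only [br_ι_ι, ← map_add, leibniz_lie x y z]

end KirillovKostant

/-- The Kirillov-Kostant Poisson structure on `S(𝔤) = ℂ[𝔤*]`, the Poisson bracket that extends
the Lie bracket of `𝔤`. -/
def kirillovKostant (𝔤 : Type*) [LieRing 𝔤] [LieAlgebra ℂ 𝔤] :
    PoissonStructure (SymmetricAlgebra ℂ 𝔤) where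
  bracket := KirillovKostant.br
  bracket_self a := by
    have h := KirillovKostant.br_swap a a
    have h2 : (2 : ℂ) • KirillovKostant.br a a = 0 := by
      rw [two_smul]
      exact eq_neg_iff_add_eq_zero.mp h
    exact (smul_eq_zero.mp h2).resolve_left two_ne_zero
  jacobi := KirillovKostant.br_jacobi
  leibniz := KirillovKostant.br_mul

theorem kirillovKostant_ι_ι {𝔤 : Type*} [LieRing 𝔤] [LieAlgebra ℂ 𝔤] (x y : 𝔤) :
    (kirillovKostant 𝔤).bracket (SymmetricAlgebra.ι ℂ 𝔤 x) (SymmetricAlgebra.ι ℂ 𝔤 y) =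
      SymmetricAlgebra.ι ℂ 𝔤 ⁅x, y⁆ :=
  KirillovKostant.br_ι_ι x y

/-! ### Affine varieties as spaces with functions

An affine variety over `ℂ` is given by its set of points `X` and by its algebra
`R : Subalgebra ℂ (X → ℂ)` of regular functions. -/

/-- `X`, with the algebra `R` of functions, is an affine variety: `R` is finitely generated and
the points of `X` are exactly the `ℂ`-points of `R`. -/
def IsAffineVariety {X : Type*} (R : Subalgebra ℂ (X → ℂ)) : Prop :=
  R.FG ∧ Function.Bijective (fun x : X => (Pi.evalAlgHom ℂ (fun _ : X => ℂ) x).comp R.val)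

/-- Zariski open subsets. -/
def ZariskiOpen {X : Type*} (R : Subalgebra ℂ (X → ℂ)) (U : Set X) : Prop :=
  ∀ x ∈ U, ∃ b ∈ R, b x ≠ 0 ∧ ∀ y, b y ≠ 0 → y ∈ U

/-- `φ` is a regular function on the Zariski open subset `U`: locally a fraction of elements of
`R`. The values of `φ` outside `U` play no role. -/
def RegularOn {X : Type*} (R : Subalgebra ℂ (X → ℂ)) (U : Set X) (φ : X → ℂ) : Prop :=
  ∀ x ∈ U, ∃ a ∈ R, ∃ b ∈ R, b x ≠ 0 ∧ ∀ y ∈ U, b y ≠ 0 → φ y = a y / b y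

/-- Composition of functions with a map. -/
def pullback {X Y : Type*} (π : X → Y) : (Y → ℂ) →ₐ[ℂ] (X → ℂ) where
  toFun φ := φ ∘ π
  map_one' := rfl
  map_mul' _ _ := rfl
  map_zero' := rfl
  map_add' _ _ := rfl
  commutes' _ := rfl

/-- Regular functions on a closed subset `Z` of an affine variety: restrictions of regular
functions. -/
def restrictFunctions {X : Type*} (R : Subalgebra ℂ (X → ℂ)) (Z : Set X) :
    Subalgebra ℂ (Z → ℂ) :=
  R.map (pullback Subtype.val)

/-- The set `Z / G` of `G`-orbits in a subset `Z` of a `G`-set. -/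
def OrbitSpace (G : Type*) [Group G] {X : Type*} [MulAction G X] (Z : Set X) : Type _ :=
  Quotient (Setoid.comap (Subtype.val : Z → X) (MulAction.orbitRel G X))

/-- The class in `Z / G` of a point of `Z`. -/
def OrbitSpace.mk (G : Type*) [Group G] {X : Type*} [MulAction G X] {Z : Set X} (z : Z) :
    OrbitSpace G Z :=
  Quotient.mk _ z

/-- The functions on `Z / G` whose pull-back to `Z` is regular; equivalently, the `G`-invariant
regular functions on `Z`. -/
def quotientFunctions (G : Type*) [Group G] {X : Type*} [MulAction G X] {Z : Set X}
    (R : Subalgebra ℂ (Z → ℂ)) : Subalgebra ℂ (OrbitSpace G Z → ℂ) :=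
  R.comap (pullback (OrbitSpace.mk G))

/-- `Z` is `G`-stable and the orbit set `Z / G` is a well-defined affine variety, namely the
geometric quotient of `Z` by `G`: it carries the quotient topology, and its regular functions
on open subsets are the `G`-invariant regular functions on the preimages. -/
structure HasGeometricQuotient (G : Type*) [Group G] {X : Type*} [MulAction G X] (Z : Set X)
    (R : Subalgebra ℂ (Z → ℂ)) : Prop where
  stable : ∀ (g : G), ∀ z ∈ Z, g • z ∈ Z
  affine : IsAffineVariety (quotientFunctions G R)
  zariskiOpen_iff : ∀ U : Set (OrbitSpace G Z),
    ZariskiOpen (quotientFunctions G R) U ↔ ZariskiOpen R (OrbitSpace.mk G ⁻¹' U)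
  regularOn_iff : ∀ U : Set (OrbitSpace G Z), ZariskiOpen (quotientFunctions G R) U →
    ∀ φ : OrbitSpace G Z → ℂ,
      RegularOn (quotientFunctions G R) U φ ↔
        RegularOn R (OrbitSpace.mk G ⁻¹' U) (φ ∘ OrbitSpace.mk G)

/-- A bijection between two affine Poisson varieties is an isomorphism of Poisson varieties. -/
structure IsPoissonIso {X Y : Type*} {RX : Subalgebra ℂ (X → ℂ)} {RY : Subalgebra ℂ (Y → ℂ)}
    (PX : PoissonStructure RX) (PY : PoissonStructure RY) (σ : X ≃ Y) : Prop where
  regular_iff : ∀ φ : Y → ℂ, φ ∈ RY ↔ φ ∘ σ ∈ RX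
  bracket : ∀ (φ ψ : RY) (x : X),
    (PY.bracket φ ψ : Y → ℂ) (σ x) =
      (PX.bracket ⟨φ ∘ σ, (regular_iff φ).1 φ.2⟩ ⟨ψ ∘ σ, (regular_iff ψ).1 ψ.2⟩ : X → ℂ) x

/-! ### Good gradings, good algebras, Slodowy slices -/

section Lie

variable {𝔤 : Type*} [LieRing 𝔤] [LieAlgebra ℂ 𝔤]

/-- A `ℤ`-grading of the Lie algebra `𝔤` that is good for `f`. -/
structure IsGoodGrading (Γ : ℤ → Submodule ℂ 𝔤) (f : 𝔤) : Prop where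
  isInternal : DirectSum.IsInternal Γ
  lie_mem : ∀ i j : ℤ, ∀ x ∈ Γ i, ∀ y ∈ Γ j, ⁅x, y⁆ ∈ Γ (i + j)
  mem : f ∈ Γ (-2)
  injective : ∀ j : ℤ, 1 ≤ j → ∀ x ∈ Γ j, ⁅f, x⁆ = 0 → x = 0
  surjective : ∀ j : ℤ, j ≤ 1 → ∀ y ∈ Γ (j - 2), ∃ x ∈ Γ j, ⁅f, x⁆ = y

/-- The grading `Γ` is given by the eigenspaces of `ad q`, that is `q = q_Γ`. -/
def IsGradingElement (Γ : ℤ → Submodule ℂ 𝔤) (q : 𝔤) : Prop :=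
  ∀ (j : ℤ) (x : 𝔤), x ∈ Γ j ↔ ⁅q, x⁆ = (j : ℂ) • x

/-- `𝔪` is a good algebra for the linear form `χ` and the grading `Γ`:
`𝔪 = 𝔩 ⊕ ⨁_{i ≥ 2} 𝔤_i` for a Lagrangian subspace `𝔩` of `𝔤_1`, with respect to the
form `χ([·, ·])`. -/
def IsGoodAlgebra (χ : Dual ℂ 𝔤) (Γ : ℤ → Submodule ℂ 𝔤) (𝔪 : LieSubalgebra ℂ 𝔤) : Prop :=
  ∃ 𝔩 : Submodule ℂ 𝔤, 𝔩 ≤ Γ 1 ∧ (∀ x ∈ Γ 1, x ∈ 𝔩 ↔ ∀ y ∈ 𝔩, χ ⁅x, y⁆ = 0) ∧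
    𝔪.toSubmodule = 𝔩 ⊔ ⨆ i : ℤ, ⨆ _ : 2 ≤ i, Γ i

/-- `(e, h, f)` is an `sl₂`-triple with `h ∈ 𝔤_0` and `e ∈ 𝔤_2`; for `f = 0` it is
`(0, 0, 0)`. -/
structure IsGradedTriple (Γ : ℤ → Submodule ℂ 𝔤) (e h f : 𝔤) : Prop where
  lie_h_e : ⁅h, e⁆ = (2 : ℂ) • e
  lie_h_f : ⁅h, f⁆ = -((2 : ℂ) • f)
  lie_e_f : ⁅e, f⁆ = h
  h_mem : h ∈ Γ 0
  e_mem : e ∈ Γ 2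

/-- The Slodowy slice `Φ(f + Ker ad e)`, where `Φ(x) = (x | ·)`. -/
def slodowySlice (B : LinearMap.BilinForm ℂ 𝔤) (e f : 𝔤) : Set (Dual ℂ 𝔤) :=
  {ξ | ∃ x : 𝔤, ⁅e, x⁆ = 0 ∧ ξ = B (f + x)}

/-- The connected unipotent group with the `ad`-nilpotent Lie algebra `𝔪`, realized in the
adjoint group: it is generated by the `exp (ad y)`, `y ∈ 𝔪`. -/
def unipotentGroup (𝔪 : LieSubalgebra ℂ 𝔤) : Subgroup (𝔤 ≃ₗ[ℂ] 𝔤) :=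
  Subgroup.closure {g | ∃ y ∈ 𝔪, ∃ N : ℕ, (LieAlgebra.ad ℂ 𝔤 y) ^ N = 0 ∧
    (g : 𝔤 →ₗ[ℂ] 𝔤) =
      ∑ k ∈ Finset.range N, ((k.factorial : ℂ)⁻¹) • (LieAlgebra.ad ℂ 𝔤 y) ^ k}

/-- The coadjoint action `Ad*(g) ξ = ξ ∘ Ad(g)⁻¹`. -/
instance coadjointAction : MulAction (𝔤 ≃ₗ[ℂ] 𝔤) (Dual ℂ 𝔤) where
  smul g ξ := ξ ∘ₗ (g⁻¹ : 𝔤 ≃ₗ[ℂ] 𝔤).toLinearMap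
  one_smul ξ := by
    change ξ ∘ₗ ((1 : 𝔤 ≃ₗ[ℂ] 𝔤)⁻¹).toLinearMap = ξ
    rw [inv_one]; rfl
  mul_smul g g' ξ := by
    change ξ ∘ₗ ((g * g')⁻¹).toLinearMap =
      (ξ ∘ₗ (g'⁻¹).toLinearMap) ∘ₗ (g⁻¹).toLinearMap
    rw [mul_inv_rev]; rfl

/-- The moment map `𝔤* → 𝔪*`, `ξ ↦ (ξ - χ)|_𝔪`. -/
def momentMap (χ : Dual ℂ 𝔤) (𝔪 : LieSubalgebra ℂ 𝔤) (ξ : Dual ℂ 𝔤) : Dual ℂ 𝔪 :=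
  (ξ - χ) ∘ₗ 𝔪.toSubmodule.subtype

/-- The fibre `μ⁻¹(0)`. -/
def zeroFibre (χ : Dual ℂ 𝔤) (𝔪 : LieSubalgebra ℂ 𝔤) : Set (Dual ℂ 𝔤) :=
  momentMap χ 𝔪 ⁻¹' {0}

/-- The value at `ξ` of `X ∈ S(𝔤) = ℂ[𝔤*]`. -/
def evalAt (ξ : Dual ℂ 𝔤) : SymmetricAlgebra ℂ 𝔤 →ₐ[ℂ] ℂ :=
  SymmetricAlgebra.lift ξ

/-- Regular functions on a closed subvariety `Z` of `𝔤*`. -/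
def polyFunctions (Z : Set (Dual ℂ 𝔤)) : Subalgebra ℂ (Z → ℂ) :=
  (AlgHom.pi (fun ξ : Z => evalAt (ξ : Dual ℂ 𝔤))).range

/-- The quotient `μ⁻¹(0) / M`. -/
abbrev HamRed (χ : Dual ℂ 𝔤) (𝔪 : LieSubalgebra ℂ 𝔤) : Type _ :=
  OrbitSpace (unipotentGroup 𝔪) (zeroFibre χ 𝔪)

/-- The regular functions on `μ⁻¹(0) / M`. -/
abbrev hamRedFunctions (χ : Dual ℂ 𝔤) (𝔪 : LieSubalgebra ℂ 𝔤) :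
    Subalgebra ℂ (HamRed χ 𝔪 → ℂ) :=
  quotientFunctions (unipotentGroup 𝔪) (polyFunctions (zeroFibre χ 𝔪))

/-! ### Classical finite W-algebras -/

/-- The elements `y - χ(y)` of `S(𝔤)`, for `y ∈ 𝔪`. -/
def shiftedElements (χ : Dual ℂ 𝔤) (𝔪 : LieSubalgebra ℂ 𝔤) : Set (SymmetricAlgebra ℂ 𝔤) :=
  {X | ∃ y ∈ 𝔪, X = SymmetricAlgebra.ι ℂ 𝔤 y - algebraMap ℂ _ (χ y)}

/-- `X mod I`, where `I` is the ideal of `S(𝔤)` spanned by the `y - χ(y)`, `y ∈ 𝔪`. -/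
abbrev modI (χ : Dual ℂ 𝔤) (𝔪 : LieSubalgebra ℂ 𝔤) (X : SymmetricAlgebra ℂ 𝔤) :
    SymmetricAlgebra ℂ 𝔤 ⧸ Ideal.span (shiftedElements χ 𝔪) :=
  Ideal.Quotient.mk _ X

/-- The classical finite W-algebra `(S(𝔤) / I)^{ad 𝔪}`. -/
def classicalW (χ : Dual ℂ 𝔤) (𝔪 : LieSubalgebra ℂ 𝔤) :
    Subalgebra ℂ (SymmetricAlgebra ℂ 𝔤 ⧸ Ideal.span (shiftedElements χ 𝔪)) :=
  (kirillovKostant 𝔤).reduction (shiftedElements χ 𝔪)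

instance classicalW.instCommRing (χ : Dual ℂ 𝔤) (𝔪 : LieSubalgebra ℂ 𝔤) :
    CommRing (classicalW χ 𝔪) := Subalgebra.toCommRing _

instance classicalW.instAlgebra (χ : Dual ℂ 𝔤) (𝔪 : LieSubalgebra ℂ 𝔤) :
    Algebra ℂ (classicalW χ 𝔪) := Subalgebra.algebra _

/-- The Poisson bracket of the classical finite W-algebra. -/
def classicalWPoisson (χ : Dual ℂ 𝔤) (𝔪 : LieSubalgebra ℂ 𝔤) :
    PoissonStructure (classicalW χ 𝔪) :=
  (kirillovKostant 𝔤).reduced (shiftedElements χ 𝔪)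

/-- The elements `(y - χ₂(y)) mod I₁` of the W-algebra attached to `χ₁` and `𝔪₁`,
for `y ∈ 𝔪₀`. -/
def stageElements (χ₁ χ₂ : Dual ℂ 𝔤) (𝔪₁ 𝔪₀ : LieSubalgebra ℂ 𝔤) : Set (classicalW χ₁ 𝔪₁) :=
  {w | ∃ y ∈ 𝔪₀, (w : _ ⧸ Ideal.span (shiftedElements χ₁ 𝔪₁)) =
    modI χ₁ 𝔪₁ (SymmetricAlgebra.ι ℂ 𝔤 y - algebraMap ℂ _ (χ₂ y))}

/-- `w mod I₀`, where `I₀` is the ideal spanned by the `(y - χ₂(y)) mod I₁`, `y ∈ 𝔪₀`. -/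
abbrev modI₀ (χ₁ χ₂ : Dual ℂ 𝔤) (𝔪₁ 𝔪₀ : LieSubalgebra ℂ 𝔤) (w : classicalW χ₁ 𝔪₁) :
    classicalW χ₁ 𝔪₁ ⧸ Ideal.span (stageElements χ₁ χ₂ 𝔪₁ 𝔪₀) :=
  Ideal.Quotient.mk _ w

/-- The second stage `(P(𝔤, f₁) / I₀)^{ad 𝔪₀}` of the reduction. -/
def stageW (χ₁ χ₂ : Dual ℂ 𝔤) (𝔪₁ 𝔪₀ : LieSubalgebra ℂ 𝔤) :
    Subalgebra ℂ (classicalW χ₁ 𝔪₁ ⧸ Ideal.span (stageElements χ₁ χ₂ 𝔪₁ 𝔪₀)) :=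
  (classicalWPoisson χ₁ 𝔪₁).reduction (stageElements χ₁ χ₂ 𝔪₁ 𝔪₀)

instance stageW.instCommRing (χ₁ χ₂ : Dual ℂ 𝔤) (𝔪₁ 𝔪₀ : LieSubalgebra ℂ 𝔤) :
    CommRing (stageW χ₁ χ₂ 𝔪₁ 𝔪₀) := Subalgebra.toCommRing _

instance stageW.instAlgebra (χ₁ χ₂ : Dual ℂ 𝔤) (𝔪₁ 𝔪₀ : LieSubalgebra ℂ 𝔤) :
    Algebra ℂ (stageW χ₁ χ₂ 𝔪₁ 𝔪₀) := Subalgebra.algebra _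

/-- The Poisson bracket of the second stage. -/
def stageWPoisson (χ₁ χ₂ : Dual ℂ 𝔤) (𝔪₁ 𝔪₀ : LieSubalgebra ℂ 𝔤) :
    PoissonStructure (stageW χ₁ χ₂ 𝔪₁ 𝔪₀) :=
  (classicalWPoisson χ₁ 𝔪₁).reduced (stageElements χ₁ χ₂ 𝔪₁ 𝔪₀)

end Lie

end

/-!
Let elements `y i` span `𝔪`, ordered compatibly with the bracket, and let `x j` be linear functions
whose brackets with the `y i` form a unitriangular matrix on the zero fibre. The Hamiltonian
derivation of `y i` is locally nilpotent and `x i` is a slice function for it, so Dixmier's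
projection extends every function on the slice `x = 0` to an invariant one, while the exponentials
`exp (t • ad (y i))` move every point of the zero fibre into the slice. Since the invariants
separate the points of the slice, it meets every orbit exactly once, and both the reduced space and
the W-algebra are identified with the slice and its coordinate ring. For a good algebra,
`sl₂`-theory gives such functions whose slice is the Slodowy slice.

For the comparison, the `y i` of `𝔪₂` are taken in `𝔪₁` or in `𝔪₀`, so that products of elements of
`M₁` and `M₀` already move every point of `μ₂⁻¹(0)` into the slice; hence the bijection of orbit
spaces. On functions, Dixmier's projection for `𝔪₁` finds in every `𝔪₂`-invariant class modulo `I₂`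
a representative that is also `𝔪₁`-invariant modulo `I₁`, which makes `Ψ` surjective.
-/

/-! ### Affine subspaces, geometric quotients and Dixmier's projection -/

section AffineSubspaces

open SymmetricAlgebra

variable {𝔤 : Type*} [LieRing 𝔤] [LieAlgebra ℂ 𝔤]

@[simp]
theorem evalAt_ι (ξ : Dual ℂ 𝔤) (x : 𝔤) : evalAt ξ (ι ℂ 𝔤 x) = ξ x := by
  simp [evalAt]

theorem evalAt_comp_ι (θ : SymmetricAlgebra ℂ 𝔤 →ₐ[ℂ] ℂ) :
    evalAt (θ.toLinearMap ∘ₗ ι ℂ 𝔤) = θ := by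
  apply algHom_ext
  ext v
  simp

theorem eq_zero_of_forall_evalAt_eq_zero [FiniteDimensional ℂ 𝔤] {X : SymmetricAlgebra ℂ 𝔤}
    (h : ∀ ξ : Dual ℂ 𝔤, evalAt ξ X = 0) : X = 0 := by
  let b := finBasis ℂ 𝔤
  let E := equivMvPolynomial b
  have eval_E (v : Fin (finrank ℂ 𝔤) → ℂ) :
      (MvPolynomial.aeval v).comp E.toAlgHom = evalAt (b.constr ℂ v) :=
    algHom_ext (b.ext fun i => by simp [E])
  refine (map_eq_zero_iff E E.injective).1 (MvPolynomial.funext fun v => ?_)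
  simpa [h, MvPolynomial.aeval_eq_eval] using DFunLike.congr_fun (eval_E v) X

/-- The ideal of the affine subspace `{ξ | ξ = ξ₀ on W}` of `𝔤*`, given by its generators. For
`W = 𝔪` it is the ideal spanned by `shiftedElements ξ₀ 𝔪`. -/
def affineIdeal (W : Submodule ℂ 𝔤) (ξ₀ : Dual ℂ 𝔤) : Ideal (SymmetricAlgebra ℂ 𝔤) :=
  Ideal.span {X | ∃ w ∈ W, X = ι ℂ 𝔤 w - algebraMap ℂ _ (ξ₀ w)}

theorem ι_sub_mem_affineIdeal {W : Submodule ℂ 𝔤} (ξ₀ : Dual ℂ 𝔤) {w : 𝔤} (hw : w ∈ W) :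
    ι ℂ 𝔤 w - algebraMap ℂ _ (ξ₀ w) ∈ affineIdeal W ξ₀ :=
  Ideal.subset_span ⟨w, hw, rfl⟩

theorem evalAt_eq_zero_of_mem_affineIdeal {W : Submodule ℂ 𝔤} {ξ₀ ξ : Dual ℂ 𝔤}
    (hξ : ∀ w ∈ W, ξ w = ξ₀ w) {X : SymmetricAlgebra ℂ 𝔤} (hX : X ∈ affineIdeal W ξ₀) :
    evalAt ξ X = 0 := by
  suffices h : affineIdeal W ξ₀ ≤ RingHom.ker (evalAt ξ) from h hX
  refine Ideal.span_le.2 ?_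
  rintro _ ⟨w, hw, rfl⟩
  simp [RingHom.mem_ker, hξ w hw]

theorem exists_algHom_retraction (W : Submodule ℂ 𝔤) (ξ₀ : Dual ℂ 𝔤) :
    ∃ P : SymmetricAlgebra ℂ 𝔤 →ₐ[ℂ] SymmetricAlgebra ℂ 𝔤,
      (∀ X, X - P X ∈ affineIdeal W ξ₀) ∧
        ∀ ξ : Dual ℂ 𝔤, ∃ ξ' : Dual ℂ 𝔤, (∀ w ∈ W, ξ' w = ξ₀ w) ∧
          ∀ X, evalAt ξ (P X) = evalAt ξ' X := by
  obtain ⟨r, hr⟩ := W.subtype.exists_leftInverse_of_injective W.ker_subtype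
  let P : SymmetricAlgebra ℂ 𝔤 →ₐ[ℂ] SymmetricAlgebra ℂ 𝔤 :=
    lift (ι ℂ 𝔤 ∘ₗ (LinearMap.id - W.subtype ∘ₗ r) +
      Algebra.linearMap ℂ (SymmetricAlgebra ℂ 𝔤) ∘ₗ ξ₀ ∘ₗ W.subtype ∘ₗ r)
  have hP (v : 𝔤) : P (ι ℂ 𝔤 v) = ι ℂ 𝔤 v - ι ℂ 𝔤 (r v) + algebraMap ℂ _ (ξ₀ (r v)) := by
    simp [P]
  refine ⟨P, fun X => ?_, fun ξ => ?_⟩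
  · have mk_comp_P : (Ideal.Quotient.mkₐ ℂ (affineIdeal W ξ₀)).comp P =
        Ideal.Quotient.mkₐ ℂ (affineIdeal W ξ₀) := by
      refine algHom_ext (LinearMap.ext fun v => (Ideal.Quotient.eq.2 ?_).symm)
      convert ι_sub_mem_affineIdeal ξ₀ (r v).2 using 1
      change ι ℂ 𝔤 v - P (ι ℂ 𝔤 v) = _
      rw [hP]
      abel
    exact Ideal.Quotient.eq.1 (DFunLike.congr_fun mk_comp_P X).symm
  · refine ⟨((evalAt ξ).comp P).toLinearMap ∘ₗ ι ℂ 𝔤, fun w hw => ?_, fun X => ?_⟩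
    · have hrw : r w = ⟨w, hw⟩ := LinearMap.congr_fun hr ⟨w, hw⟩
      simp [hP, hrw]
    · rw [evalAt_comp_ι, AlgHom.comp_apply]

theorem mem_affineIdeal_iff [FiniteDimensional ℂ 𝔤] {W : Submodule ℂ 𝔤} {ξ₀ : Dual ℂ 𝔤}
    {X : SymmetricAlgebra ℂ 𝔤} :
    X ∈ affineIdeal W ξ₀ ↔ ∀ ξ : Dual ℂ 𝔤, (∀ w ∈ W, ξ w = ξ₀ w) → evalAt ξ X = 0 := by
  refine ⟨fun hX ξ hξ => evalAt_eq_zero_of_mem_affineIdeal hξ hX, fun hX => ?_⟩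
  obtain ⟨P, hP, hPξ⟩ := exists_algHom_retraction W ξ₀
  have hPX : P X = 0 := eq_zero_of_forall_evalAt_eq_zero fun ξ => by
    obtain ⟨ξ', hξ', h⟩ := hPξ ξ
    rw [h, hX ξ' hξ']
  simpa [hPX] using hP X

theorem mem_polyFunctions {Z : Set (Dual ℂ 𝔤)} {φ : Z → ℂ} :
    φ ∈ polyFunctions Z ↔ ∃ X, ∀ ξ : Z, φ ξ = evalAt (ξ : Dual ℂ 𝔤) X :=
  ⟨fun ⟨X, hX⟩ => ⟨X, fun ξ => (congrFun hX ξ).symm⟩,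
    fun ⟨X, hX⟩ => ⟨X, funext fun ξ => (hX ξ).symm⟩⟩

theorem polyFunctions_fg [FiniteDimensional ℂ 𝔤] (Z : Set (Dual ℂ 𝔤)) : (polyFunctions Z).FG := by
  have : Algebra.FiniteType ℂ (SymmetricAlgebra ℂ 𝔤) :=
    .equiv inferInstance (equivMvPolynomial (finBasis ℂ 𝔤)).symm
  rw [polyFunctions, ← Algebra.map_top]
  exact Algebra.FiniteType.out.map _

theorem isAffineVariety_polyFunctions [FiniteDimensional ℂ 𝔤] {Z : Set (Dual ℂ 𝔤)}
    (W : Submodule ℂ 𝔤) (ξ₀ : Dual ℂ 𝔤) (hZ : ∀ ξ, ξ ∈ Z ↔ ∀ w ∈ W, ξ w = ξ₀ w) :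
    IsAffineVariety (polyFunctions Z) := by
  let res : SymmetricAlgebra ℂ 𝔤 →ₐ[ℂ] polyFunctions Z := AlgHom.rangeRestrict _
  have evalAt_res (ξ : Z) (X : SymmetricAlgebra ℂ 𝔤) :
      (res X : Z → ℂ) ξ = evalAt (ξ : Dual ℂ 𝔤) X := rfl
  refine ⟨polyFunctions_fg Z, fun ξ ξ' h => Subtype.ext (LinearMap.ext fun v => ?_), fun θ => ?_⟩
  · simpa [evalAt_res] using DFunLike.congr_fun h (res (ι ℂ 𝔤 v))
  · let ξ : Dual ℂ 𝔤 := (θ.comp res).toLinearMap ∘ₗ ι ℂ 𝔤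
    have evalAt_ξ (X : SymmetricAlgebra ℂ 𝔤) : evalAt ξ X = θ (res X) :=
      DFunLike.congr_fun (evalAt_comp_ι (θ.comp res)) X
    have hξ : ξ ∈ Z := by
      refine (hZ ξ).2 fun w hw => ?_
      have hres : res (ι ℂ 𝔤 w - algebraMap ℂ _ (ξ₀ w)) = 0 :=
        Subtype.ext (funext fun η => by simp [evalAt_res, (hZ η).1 η.2 w hw])
      simpa [hres, sub_eq_zero] using evalAt_ξ (ι ℂ 𝔤 w - algebraMap ℂ _ (ξ₀ w))
    refine ⟨⟨ξ, hξ⟩, ?_⟩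
    ext ⟨_, X, rfl⟩
    exact evalAt_ξ X

end AffineSubspaces

section GeometricQuotient

/-- The isomorphism `φ ↦ φ ∘ σ⁻¹` of algebras of regular functions given by an isomorphism `σ`
of varieties. -/
def regularFunctionsEquiv {X Y : Type*} {RX : Subalgebra ℂ (X → ℂ)} {RY : Subalgebra ℂ (Y → ℂ)}
    (σ : X ≃ Y) (hσ : ∀ φ : Y → ℂ, φ ∈ RY ↔ φ ∘ σ ∈ RX) : RX ≃ₐ[ℂ] RY where
  toFun φ := ⟨(φ : X → ℂ) ∘ σ.symm, (hσ _).2 (by simp [Function.comp_assoc])⟩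
  invFun ψ := ⟨(ψ : Y → ℂ) ∘ σ, (hσ _).1 ψ.2⟩
  left_inv φ := Subtype.ext (by simp [Function.comp_assoc])
  right_inv ψ := Subtype.ext (by simp [Function.comp_assoc])
  map_mul' _ _ := rfl
  map_add' _ _ := rfl
  commutes' _ := rfl

theorem regularFunctionsEquiv_apply {X Y : Type*} {RX : Subalgebra ℂ (X → ℂ)}
    {RY : Subalgebra ℂ (Y → ℂ)} (σ : X ≃ Y) (hσ : ∀ φ : Y → ℂ, φ ∈ RY ↔ φ ∘ σ ∈ RX) (φ : RX)
    (x : X) : (regularFunctionsEquiv σ hσ φ : Y → ℂ) (σ x) = (φ : X → ℂ) x :=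
  congrArg (φ : X → ℂ) (σ.symm_apply_apply x)

theorem IsAffineVariety.of_equiv {X Y : Type*} {RX : Subalgebra ℂ (X → ℂ)}
    {RY : Subalgebra ℂ (Y → ℂ)} (hX : IsAffineVariety RX) (σ : X ≃ Y)
    (hσ : ∀ φ : Y → ℂ, φ ∈ RY ↔ φ ∘ σ ∈ RX) : IsAffineVariety RY := by
  let E := regularFunctionsEquiv σ hσ
  refine ⟨?_, ?_⟩
  · rw [Subalgebra.fg_iff_finiteType]
    exact .equiv (Subalgebra.fg_iff_finiteType _ |>.1 hX.1) E
  · convert (E.arrowCongr AlgEquiv.refl).bijective.comp (hX.2.comp σ.symm.bijective) using 1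
    ext y ψ
    exact (congrArg (ψ : Y → ℂ) (σ.apply_symm_apply y)).symm

variable {G : Type*} [Group G] {X : Type*} [MulAction G X] {Z : Set X}

theorem OrbitSpace.mk_eq_mk {z z' : Z} :
    OrbitSpace.mk G z = OrbitSpace.mk G z' ↔ ∃ g : G, g • (z' : X) = z :=
  Quotient.eq (r := Setoid.comap (Subtype.val : Z → X) (MulAction.orbitRel G X))

theorem OrbitSpace.mk_surjective : Function.Surjective (OrbitSpace.mk G : Z → OrbitSpace G Z) :=
  Quotient.mk_surjective

theorem hasGeometricQuotient_of_section {R : Subalgebra ℂ (Z → ℂ)}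
    (hstable : ∀ (g : G), ∀ z ∈ Z, g • z ∈ Z) (haffine : IsAffineVariety (quotientFunctions G R))
    (s : OrbitSpace G Z → Z) (hs : ∀ p, OrbitSpace.mk G (s p) = p)
    (hsR : ∀ a ∈ R, a ∘ s ∈ quotientFunctions G R) : HasGeometricQuotient G Z R where
  stable := hstable
  affine := haffine
  zariskiOpen_iff U := by
    refine ⟨fun hU z hz => ?_, fun hU p hp => ?_⟩
    · obtain ⟨b, hb, hbz, hbU⟩ := hU _ hz
      exact ⟨_, hb, hbz, fun z' hz' => hbU _ hz'⟩
    · obtain ⟨b, hb, hbp, hbU⟩ := hU (s p) (by rwa [Set.mem_preimage, hs])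
      exact ⟨_, hsR b hb, hbp, fun p' hp' => hs p' ▸ hbU (s p') hp'⟩
  regularOn_iff U _ φ := by
    refine ⟨fun hφ z hz => ?_, fun hφ p hp => ?_⟩
    · obtain ⟨a, ha, b, hb, hbz, h⟩ := hφ _ hz
      exact ⟨_, ha, _, hb, hbz, fun z' hz' => h _ hz'⟩
    · obtain ⟨a, ha, b, hb, hbp, h⟩ := hφ (s p) (by rwa [Set.mem_preimage, hs])
      refine ⟨_, hsR a ha, _, hsR b hb, hbp, fun p' hp' hbp' => ?_⟩
      simpa only [Function.comp_apply, hs] using h (s p') (by rwa [Set.mem_preimage, hs]) hbp'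

end GeometricQuotient

section Derivations

variable {K S : Type*} [Field K] [CommRing S] [Algebra K S]

theorem derivation_iterate_mul_eq_zero {R A : Type*} [CommSemiring R] [CommSemiring A]
    [Algebra R A] (D : Derivation R A A) {n m : ℕ} {a b : A} (ha : D^[n] a = 0)
    (hb : D^[m] b = 0) {s : ℕ} (hs : n + m ≤ s) : D^[s] (a * b) = 0 := by
  induction s generalizing n m a b with
  | zero =>
    obtain rfl : n = 0 := by omega
    obtain rfl : a = 0 := ha
    simp
  | succ s ih =>
    rcases n with _ | n
    · obtain rfl : a = 0 := ha
      rw [zero_mul, iterate_map_zero]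
    rcases m with _ | m
    · obtain rfl : b = 0 := hb
      rw [mul_zero, iterate_map_zero]
    rw [Function.iterate_succ_apply, D.leibniz, smul_eq_mul, smul_eq_mul, iterate_map_add,
      ih ha (b := D b) (m := m) hb (by omega), ih hb (b := D a) (m := n) ha (by omega), add_zero]

/-- Dixmier's projection `∑ₙ (-φ)ⁿ / n! · Dⁿ X`, truncated at `n = N`. If `D φ = 1` and
`D ^ (N + 1)` kills `X`, then `D` kills it, and it agrees with `X` where `φ` vanishes. -/
noncomputable def dixmierSum (D : Derivation K S S) (φ : S) (N : ℕ) (X : S) : S :=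
  ∑ n ∈ Finset.range (N + 1), ((n.factorial : K)⁻¹ • (-φ) ^ n) * D^[n] X

theorem sub_dixmierSum_mem (D : Derivation K S S) (φ : S) (N : ℕ) (X : S) :
    X - dixmierSum D φ N X ∈ Ideal.span {φ} := by
  have dvd_term (n : ℕ) :
      (((n + 1).factorial : K)⁻¹ • (-φ) ^ (n + 1)) * D^[n + 1] X ∈ Ideal.span {φ} := by
    rw [Ideal.mem_span_singleton, pow_succ, mul_neg, smul_neg, neg_mul, dvd_neg, smul_mul_assoc]
    exact dvd_smul_of_dvd _ ((dvd_mul_left φ _).mul_right _)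
  rw [dixmierSum, Finset.sum_range_succ', sub_add_eq_sub_sub_swap]
  simpa using Ideal.sum_mem _ fun n _ => dvd_term n

theorem apply_dixmierSum_mem_of_apply_mem {I : Ideal S} (D : Derivation K S S) {φ : S}
    (N : ℕ) {X : S} (E : Derivation K S S) (hφ : E φ ∈ I) (hX : ∀ n, E (D^[n] X) ∈ I) :
    E (dixmierSum D φ N X) ∈ I := by
  rw [dixmierSum, map_sum]
  refine I.sum_mem fun n _ => ?_
  rw [E.leibniz, E.map_smul, E.leibniz_pow, map_neg]
  refine I.add_mem (I.mul_mem_left _ (hX n)) (I.mul_mem_left _ ?_)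
  exact Submodule.smul_of_tower_mem I _ (I.nsmul_mem (I.mul_mem_left _ (I.neg_mem hφ)) n)

variable [CharZero K]

theorem derivation_dividedPower_neg (D : Derivation K S S) (φ : S) (n : ℕ) :
    D (((n + 1).factorial : K)⁻¹ • (-φ) ^ (n + 1)) =
      -((n.factorial : K)⁻¹ • (-φ) ^ n) * D φ := by
  have hfac : ((n + 1).factorial : K)⁻¹ * ((n + 1 : ℕ) : K) = (n.factorial : K)⁻¹ := by
    have : ((n + 1 : ℕ) : K) ≠ 0 := Nat.cast_ne_zero.2 n.succ_ne_zero
    rw [Nat.factorial_succ, Nat.cast_mul]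
    field_simp
  rw [D.map_smul, D.leibniz_pow, map_neg, Nat.add_sub_cancel, ← Nat.cast_smul_eq_nsmul K,
    smul_smul, hfac, smul_eq_mul, mul_neg, smul_neg, neg_mul, smul_mul_assoc]

theorem apply_dixmierSum_sub_mem {I : Ideal S} (D : Derivation K S S) {φ : S} (hφ : D φ - 1 ∈ I)
    (N : ℕ) (X : S) :
    D (dixmierSum D φ N X) - ((N.factorial : K)⁻¹ • (-φ) ^ N) * D^[N + 1] X ∈ I := by
  induction N with
  | zero => simp [dixmierSum]
  | succ N ih =>
    have hterm := I.mul_mem_right (D^[N + 1] X)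
      (I.mul_mem_left (-((N.factorial : K)⁻¹ • (-φ) ^ N)) hφ)
    convert I.add_mem ih hterm using 1
    rw [dixmierSum, Finset.sum_range_succ, map_add, D.leibniz _ (D^[N + 1] X),
      derivation_dividedPower_neg, ← Function.iterate_succ_apply' D (N + 1), dixmierSum]
    simp only [smul_eq_mul]
    ring

theorem exists_common_invariant {I : Ideal S} {d : ℕ} (D : Fin d → Derivation K S S)
    (φ : Fin d → S) (hself : ∀ i, D i (φ i) - 1 ∈ I) (hlt : ∀ i j, j < i → D i (φ j) ∈ I)
    (hcomm : ∀ i j, i < j → ∀ X, (∀ l, i < l → D l X ∈ I) → D j (D i X) ∈ I)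
    (hnil : ∀ i X, ∃ N, (D i)^[N] X = 0) (X : S) :
    ∃ Y, (∀ i, D i Y ∈ I) ∧ X - Y ∈ Ideal.span (Set.range φ) := by
  induction d with
  | zero => exact ⟨X, fun i => i.elim0, by simp⟩
  | succ d ih =>
    obtain ⟨Y, hY, hXY⟩ := ih (fun i => D i.succ) (fun i => φ i.succ) (fun i => hself i.succ)
      (fun i j hij => hlt i.succ j.succ (Fin.succ_lt_succ_iff.2 hij))
      (fun i j hij X hX => hcomm i.succ j.succ (Fin.succ_lt_succ_iff.2 hij) X fun l hl => by
        obtain ⟨l, rfl⟩ := Fin.exists_succ_eq.2 ((Fin.zero_le _).trans_lt hl).ne'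
        exact hX l (Fin.succ_lt_succ_iff.1 hl))
      (fun i => hnil i.succ)
    obtain ⟨N, hN⟩ := hnil 0 Y
    have hiter (n : ℕ) (l : Fin (d + 1)) (hl : 0 < l) : D l ((D 0)^[n] Y) ∈ I := by
      induction n generalizing l with
      | zero =>
        obtain ⟨l, rfl⟩ := Fin.exists_succ_eq.2 hl.ne'
        exact hY l
      | succ n ihn =>
        rw [Function.iterate_succ_apply']
        exact hcomm 0 l hl _ ihn
    refine ⟨dixmierSum (D 0) (φ 0) N Y, fun l => ?_, ?_⟩
    · rcases (Fin.zero_le l).eq_or_lt with rfl | hl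
      · have h := apply_dixmierSum_sub_mem (D 0) (hself 0) N Y
        rwa [Function.iterate_succ_apply', hN, map_zero, mul_zero, sub_zero] at h
      · exact apply_dixmierSum_mem_of_apply_mem _ _ _ (hlt l 0 hl) fun n => hiter n l hl
    · have hsucc := Ideal.span_mono (Set.range_comp_subset_range Fin.succ φ) hXY
      have hzero : Ideal.span {φ 0} ≤ Ideal.span (Set.range φ) :=
        Ideal.span_mono (Set.singleton_subset_iff.2 ⟨0, rfl⟩)
      rw [← sub_add_sub_cancel X Y]
      exact Ideal.add_mem _ hsucc (hzero (sub_dixmierSum_mem (D 0) (φ 0) N Y))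

end Derivations

/-! ### Exponentials of nilpotent adjoint maps -/

section Exponentials

open KirillovKostant LieAlgebra

variable {𝔤 : Type*} [LieRing 𝔤] [LieAlgebra ℂ 𝔤] {y : 𝔤} {N : ℕ}

/-- The exponential series of `ad y`, truncated after `N` terms; it is `exp (ad y)` when
`(ad y) ^ N = 0`. -/
noncomputable def expAdSum (y : 𝔤) (N : ℕ) : 𝔤 →ₗ[ℂ] 𝔤 :=
  ∑ k ∈ Finset.range N, ((k.factorial : ℂ)⁻¹) • ad ℂ 𝔤 y ^ k

theorem ad_smul_pow (c : ℂ) (y : 𝔤) (k : ℕ) : ad ℂ 𝔤 (c • y) ^ k = c ^ k • ad ℂ 𝔤 y ^ k := by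
  rw [map_smul, smul_pow]

theorem ad_smul_pow_eq_zero (h : ad ℂ 𝔤 y ^ N = 0) (c : ℂ) : ad ℂ 𝔤 (c • y) ^ N = 0 := by
  rw [ad_smul_pow, h, smul_zero]

theorem ad_neg_pow_eq_zero (h : ad ℂ 𝔤 y ^ N = 0) : ad ℂ 𝔤 (-y) ^ N = 0 := by
  rw [map_neg, neg_pow, h, mul_zero]

theorem ad_pow_mem {W : Submodule ℂ 𝔤} (hW : ∀ w ∈ W, ⁅y, w⁆ ∈ W) (k : ℕ) {w : 𝔤}
    (hw : w ∈ W) : (ad ℂ 𝔤 y ^ k) w ∈ W :=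
  Module.End.pow_apply_mem_of_forall_mem k hW w hw

theorem expAdSum_apply_eq_self (h : ad ℂ 𝔤 y ^ N = 0) {x : 𝔤} (hx : ⁅y, x⁆ = 0) :
    expAdSum y N x = x := by
  have had (k : ℕ) : (ad ℂ 𝔤 y ^ (k + 1)) x = 0 := by
    rw [pow_succ, Module.End.mul_apply, ad_apply, hx, map_zero]
  rcases N with _ | N
  · simpa [expAdSum] using (LinearMap.congr_fun h x).symm
  · simp [expAdSum, Finset.sum_range_succ', had]

theorem exists_lieEquiv_eq_expAdSum (h : ad ℂ 𝔤 y ^ N = 0) :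
    ∃ E : 𝔤 ≃ₗ⁅ℂ⁆ 𝔤, (∀ x, E x = expAdSum y N x) ∧ ∀ x, E.symm x = expAdSum (-y) N x := by
  -- `LieDerivation.exp` is stated over `ℚ`
  let _ : Module ℚ 𝔤 := Module.compHom 𝔤 (algebraMap ℚ ℂ)
  let _ : LieAlgebra ℚ 𝔤 := { lie_smul := fun q => lie_smul (algebraMap ℚ ℂ q) }
  have exp_apply {z : 𝔤} (hz : ad ℂ 𝔤 z ^ N = 0) (x : 𝔤) :
      IsNilpotent.exp (ad ℂ 𝔤 z) x = expAdSum z N x := by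
    have hsmul (n : ℕ) (v : 𝔤) : (n.factorial : ℚ)⁻¹ • v = (n.factorial : ℂ)⁻¹ • v := by
      change algebraMap ℚ ℂ (n.factorial : ℚ)⁻¹ • v = _
      rw [map_inv₀, map_natCast]
    simp only [IsNilpotent.exp_eq_sum hz, expAdSum, LinearMap.sum_apply, LinearMap.smul_apply,
      hsmul]
  let D : LieDerivation ℂ 𝔤 𝔤 := LieDerivation.inner ℂ 𝔤 𝔤 y
  have hD : D.toLinearMap = ad ℂ 𝔤 (-y) := by
    ext x
    simp [D]
  have hD' : -D.toLinearMap = ad ℂ 𝔤 y := by rw [hD, map_neg, neg_neg]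
  have hnil : IsNilpotent D.toLinearMap := ⟨N, by rw [hD, ad_neg_pow_eq_zero h]⟩
  refine ⟨(LieDerivation.exp D hnil).symm, fun x => ?_, fun x => ?_⟩
  · rw [← exp_apply h, ← hD']
    rfl
  · rw [← exp_apply (ad_neg_pow_eq_zero h), ← hD]
    rfl

theorem inv_coe_eq_expAdSum (h : ad ℂ 𝔤 y ^ N = 0) {g : 𝔤 ≃ₗ[ℂ] 𝔤}
    (hg : (g : 𝔤 →ₗ[ℂ] 𝔤) = expAdSum y N) :
    ((g⁻¹ : 𝔤 ≃ₗ[ℂ] 𝔤) : 𝔤 →ₗ[ℂ] 𝔤) = expAdSum (-y) N := by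
  obtain ⟨E, hE, hE'⟩ := exists_lieEquiv_eq_expAdSum h
  obtain rfl : g = E.toLinearEquiv :=
    LinearEquiv.ext fun x => (LinearMap.congr_fun hg x).trans (hE x).symm
  exact LinearMap.ext hE'

@[elab_as_elim]
theorem unipotentGroup_induction {𝔪 : LieSubalgebra ℂ 𝔤}
    {p : ∀ g : 𝔤 ≃ₗ[ℂ] 𝔤, g ∈ unipotentGroup 𝔪 → Prop}
    (exp : ∀ y (hy : y ∈ 𝔪) N (hN : ad ℂ 𝔤 y ^ N = 0) (g : 𝔤 ≃ₗ[ℂ] 𝔤)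
      (hg : (g : 𝔤 →ₗ[ℂ] 𝔤) = expAdSum y N), p g (Subgroup.subset_closure ⟨y, hy, N, hN, hg⟩))
    (one : p 1 (one_mem _))
    (mul : ∀ g g' hg hg', p g hg → p g' hg' → p (g * g') (mul_mem hg hg')) {g : 𝔤 ≃ₗ[ℂ] 𝔤}
    (hg : g ∈ unipotentGroup 𝔪) : p g hg := by
  refine Subgroup.closure_induction'' (p := p) ?_ ?_ one (fun g g' => mul g g') hg
  · rintro g ⟨y, hy, N, hN, h⟩
    exact exp y hy N hN g h
  · rintro g ⟨y, hy, N, hN, h⟩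
    exact exp (-y) (neg_mem hy) N (ad_neg_pow_eq_zero hN) _ (inv_coe_eq_expAdSum hN h)

theorem unipotentGroup_mono {𝔪 𝔪' : LieSubalgebra ℂ 𝔤} (h : 𝔪 ≤ 𝔪') :
    unipotentGroup 𝔪 ≤ unipotentGroup 𝔪' :=
  Subgroup.closure_mono fun _ ⟨y, hy, hN⟩ => ⟨y, h hy, hN⟩

theorem unipotentGroup_map_lie {𝔪 : LieSubalgebra ℂ 𝔤} {g : 𝔤 ≃ₗ[ℂ] 𝔤}
    (hg : g ∈ unipotentGroup 𝔪) (a b : 𝔤) : g ⁅a, b⁆ = ⁅g a, g b⁆ := by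
  induction hg using unipotentGroup_induction generalizing a b with
  | exp y _ N hN g hg =>
    obtain ⟨E, hE, -⟩ := exists_lieEquiv_eq_expAdSum hN
    have hgE (x : 𝔤) : g x = E x := (LinearMap.congr_fun hg x).trans (hE x).symm
    rw [hgE, hgE, hgE, LieEquiv.map_lie]
  | one => rfl
  | mul g g' _ _ h h' => simp only [LinearEquiv.mul_apply, h', h]

theorem unipotentGroup_apply_mem {𝔪 : LieSubalgebra ℂ 𝔤} {W : Submodule ℂ 𝔤}
    (hW : ∀ y ∈ 𝔪, ∀ w ∈ W, ⁅y, w⁆ ∈ W) {g : 𝔤 ≃ₗ[ℂ] 𝔤} (hg : g ∈ unipotentGroup 𝔪) {w : 𝔤}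
    (hw : w ∈ W) : g w ∈ W := by
  induction hg using unipotentGroup_induction generalizing w with
  | exp y hy N _ g hg =>
    change (g : 𝔤 →ₗ[ℂ] 𝔤) w ∈ W
    rw [hg, expAdSum, LinearMap.sum_apply]
    exact W.sum_mem fun k _ => W.smul_mem _ (ad_pow_mem (hW y hy) k hw)
  | one => exact hw
  | mul _ _ _ _ h h' => exact h (h' hw)

theorem unipotentGroup_sub_apply_mem {𝔪 : LieSubalgebra ℂ 𝔤} {W W' : Submodule ℂ 𝔤}
    (hW : ∀ y ∈ 𝔪, ∀ w ∈ W, ⁅y, w⁆ ∈ W) (hW' : ∀ y ∈ 𝔪, ∀ w ∈ W, ⁅y, w⁆ ∈ W') {g : 𝔤 ≃ₗ[ℂ] 𝔤}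
    (hg : g ∈ unipotentGroup 𝔪) {w : 𝔤} (hw : w ∈ W) : g w - w ∈ W' := by
  induction hg using unipotentGroup_induction generalizing w with
  | exp y hy N hN g hg =>
    change (g : 𝔤 →ₗ[ℂ] 𝔤) w - w ∈ W'
    rw [hg]
    rcases N with _ | N
    · obtain rfl : w = 0 := LinearMap.congr_fun hN w
      simp
    · simp only [expAdSum, Finset.sum_range_succ', LinearMap.add_apply, LinearMap.sum_apply,
        LinearMap.smul_apply, Nat.factorial_zero, Nat.cast_one, inv_one, pow_zero, one_smul,
        Module.End.one_apply, add_sub_cancel_right, pow_succ', Module.End.mul_apply, ad_apply]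
      exact W'.sum_mem fun k _ => W'.smul_mem _ (hW' y hy _ (ad_pow_mem (hW y hy) k hw))
  | one => simp
  | mul g g' _ hg' h h' =>
    simpa using add_mem (h (unipotentGroup_apply_mem hW hg' hw)) (h' hw)

theorem ad_apply_pow_of_mem_unipotentGroup {𝔪 : LieSubalgebra ℂ 𝔤} {g : 𝔤 ≃ₗ[ℂ] 𝔤}
    (hg : g ∈ unipotentGroup 𝔪) (y : 𝔤) (k : ℕ) :
    ad ℂ 𝔤 (g y) ^ k =
      (g : 𝔤 →ₗ[ℂ] 𝔤) ∘ₗ (ad ℂ 𝔤 y ^ k) ∘ₗ ((g⁻¹ : 𝔤 ≃ₗ[ℂ] 𝔤) : 𝔤 →ₗ[ℂ] 𝔤) := by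
  have had : ad ℂ 𝔤 (g y) = g.conj (ad ℂ 𝔤 y) := by
    ext x
    rw [LinearEquiv.conj_apply_apply, ad_apply, ad_apply, unipotentGroup_map_lie hg,
      g.apply_symm_apply]
  rw [had]
  exact (map_pow (g.conjAlgEquiv ℂ) _ k).symm

theorem unipotentGroup_conj_mem {𝔪₀ 𝔪₁ : LieSubalgebra ℂ 𝔤}
    (h : ∀ y ∈ 𝔪₀, ∀ w ∈ 𝔪₁, ⁅y, w⁆ ∈ 𝔪₁) {g u : 𝔤 ≃ₗ[ℂ] 𝔤}
    (hg : g ∈ unipotentGroup 𝔪₀) (hu : u ∈ unipotentGroup 𝔪₁) :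
    g * u * g⁻¹ ∈ unipotentGroup 𝔪₁ := by
  induction hu using unipotentGroup_induction with
  | exp y hy N hN u hu =>
    have hgy : g y ∈ 𝔪₁ := unipotentGroup_apply_mem (W := 𝔪₁.toSubmodule) h hg hy
    refine Subgroup.subset_closure ⟨g y, hgy, N, ?_, ?_⟩
    · rw [ad_apply_pow_of_mem_unipotentGroup hg, hN, LinearMap.zero_comp, LinearMap.comp_zero]
    · change (g : 𝔤 →ₗ[ℂ] 𝔤) ∘ₗ (u : 𝔤 →ₗ[ℂ] 𝔤) ∘ₗ ((g⁻¹ : 𝔤 ≃ₗ[ℂ] 𝔤) : 𝔤 →ₗ[ℂ] 𝔤) = _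
      ext x
      simp only [hu, expAdSum, ad_apply_pow_of_mem_unipotentGroup hg, LinearMap.comp_apply,
        LinearMap.sum_apply, map_sum, LinearMap.smul_apply]
      exact Finset.sum_congr rfl fun k _ => map_smul _ _ _
  | one => simp
  | mul u u' _ _ hu hu' => simpa [mul_assoc] using mul_mem hu hu'

theorem coadjoint_smul_apply (g : 𝔤 ≃ₗ[ℂ] 𝔤) (ξ : Dual ℂ 𝔤) (x : 𝔤) :
    (g • ξ) x = ξ (g⁻¹ x) := rfl

theorem exists_smul_eq_comp_expAdSum (hN : ad ℂ 𝔤 y ^ N = 0) :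
    ∃ g : 𝔤 ≃ₗ[ℂ] 𝔤, (∀ 𝔪 : LieSubalgebra ℂ 𝔤, y ∈ 𝔪 → g ∈ unipotentGroup 𝔪) ∧
      ∀ ξ : Dual ℂ 𝔤, g • ξ = ξ ∘ₗ expAdSum y N := by
  obtain ⟨E, hE, hE'⟩ := exists_lieEquiv_eq_expAdSum hN
  refine ⟨E.symm.toLinearEquiv, fun 𝔪 hy => Subgroup.subset_closure
    ⟨-y, neg_mem hy, N, ad_neg_pow_eq_zero hN, LinearMap.ext hE'⟩, fun ξ => ?_⟩
  ext x
  rw [LinearMap.comp_apply, ← hE]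
  rfl

theorem hasDerivAt_sum_dividedPower {𝕜 : Type*} [NontriviallyNormedField 𝕜] [CharZero 𝕜]
    (c : ℕ → 𝕜) {N : ℕ} (hc : c N = 0) (t : 𝕜) :
    HasDerivAt (fun t => ∑ k ∈ Finset.range N, (k.factorial : 𝕜)⁻¹ * (t ^ k * c k))
      (∑ k ∈ Finset.range N, (k.factorial : 𝕜)⁻¹ * (t ^ k * c (k + 1))) t := by
  have hsum := HasDerivAt.fun_sum (u := Finset.range N) fun k _ =>
    ((hasDerivAt_pow k t).mul_const (c k)).const_mul (k.factorial : 𝕜)⁻¹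
  refine hsum.congr_deriv ?_
  rcases N with _ | N
  · rfl
  rw [Finset.sum_range_succ', Finset.sum_range_succ _ N, hc]
  simp only [Nat.cast_zero, zero_mul, mul_zero, add_zero, Nat.add_sub_cancel]
  refine Finset.sum_congr rfl fun k _ => ?_
  have hk : ((k + 1 : ℕ) : 𝕜) ≠ 0 := Nat.cast_ne_zero.2 k.succ_ne_zero
  rw [Nat.factorial_succ, Nat.cast_mul]
  field_simp

theorem hasDerivAt_evalAt_expAdSum (hN : ad ℂ 𝔤 y ^ N = 0) (ξ : Dual ℂ 𝔤)
    (X : SymmetricAlgebra ℂ 𝔤) (t : ℂ) :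
    HasDerivAt (fun t : ℂ => evalAt (ξ ∘ₗ expAdSum (t • y) N) X)
      (evalAt (ξ ∘ₗ expAdSum (t • y) N) (hamVec y X)) t := by
  induction X using SymmetricAlgebra.induction with
  | algebraMap r => simpa using hasDerivAt_const t r
  | ι x =>
    have hexp (x : 𝔤) (t : ℂ) : ξ (expAdSum (t • y) N x) = ∑ k ∈ Finset.range N,
        (k.factorial : ℂ)⁻¹ * (t ^ k * ξ ((ad ℂ 𝔤 y ^ k) x)) := by
      simp only [expAdSum, ad_smul_pow, LinearMap.sum_apply, map_sum, LinearMap.smul_apply]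
      simp only [map_smul, smul_eq_mul]
    have hderiv := hasDerivAt_sum_dividedPower (fun k => ξ ((ad ℂ 𝔤 y ^ k) x))
      (N := N) (by simp [hN]) t
    rw [hamVec_ι]
    simp only [evalAt_ι, LinearMap.comp_apply, hexp]
    simpa only [pow_succ, Module.End.mul_apply, ad_apply] using hderiv
  | mul a b ha hb =>
    simp only [map_mul, Derivation.leibniz, map_add, smul_eq_mul]
    exact (ha.mul hb).congr_deriv (by ring)
  | add a b ha hb =>
    simp only [map_add]
    exact ha.add hb

theorem comp_expAdSum_zero_smul (hN : ad ℂ 𝔤 y ^ N = 0) (ξ : Dual ℂ 𝔤) :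
    ξ ∘ₗ expAdSum ((0 : ℂ) • y) N = ξ := by
  ext x
  rw [LinearMap.comp_apply, expAdSum_apply_eq_self (ad_smul_pow_eq_zero hN 0) (by simp)]

theorem evalAt_expAdSum_eq (hN : ad ℂ 𝔤 y ^ N = 0) {ξ : Dual ℂ 𝔤} {X : SymmetricAlgebra ℂ 𝔤}
    {c : ℂ} (h : ∀ t : ℂ, evalAt (ξ ∘ₗ expAdSum (t • y) N) (hamVec y X) = c) (t : ℂ) :
    evalAt (ξ ∘ₗ expAdSum (t • y) N) X = evalAt ξ X + c * t := by
  have hderiv (t : ℂ) :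
      HasDerivAt (fun t : ℂ => evalAt (ξ ∘ₗ expAdSum (t • y) N) X - c * t) 0 t := by
    refine ((hasDerivAt_evalAt_expAdSum hN ξ X t).sub
      ((hasDerivAt_id t).const_mul c)).congr_deriv ?_
    rw [h t, mul_one, sub_self]
  have hconst := is_const_of_deriv_eq_zero (fun t => (hderiv t).differentiableAt)
    (fun t => (hderiv t).deriv) t 0
  simp only [comp_expAdSum_zero_smul hN] at hconst
  linear_combination hconst

theorem hamVec_iterate_ι (y x : 𝔤) (k : ℕ) :
    (hamVec y)^[k] (SymmetricAlgebra.ι ℂ 𝔤 x) = SymmetricAlgebra.ι ℂ 𝔤 ((ad ℂ 𝔤 y ^ k) x) := by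
  induction k with
  | zero => rfl
  | succ k ih =>
    rw [Function.iterate_succ_apply', ih, hamVec_ι, pow_succ', Module.End.mul_apply, ad_apply]

theorem hamVec_locally_nilpotent (hy : IsNilpotent (ad ℂ 𝔤 y)) (X : SymmetricAlgebra ℂ 𝔤) :
    ∃ N, (hamVec y)^[N] X = 0 := by
  obtain ⟨n, hn⟩ := hy
  induction X using SymmetricAlgebra.induction with
  | algebraMap r => exact ⟨1, by simp⟩
  | ι x => exact ⟨n, by simp [hamVec_iterate_ι, hn]⟩
  | mul a b ha hb =>
    obtain ⟨k, hk⟩ := ha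
    obtain ⟨l, hl⟩ := hb
    exact ⟨k + l, derivation_iterate_mul_eq_zero _ hk hl le_rfl⟩
  | add a b ha hb =>
    obtain ⟨k, hk⟩ := ha
    obtain ⟨l, hl⟩ := hb
    refine ⟨k + l, ?_⟩
    rw [iterate_map_add, Function.iterate_add_apply _ k l b, hl, add_comm k l,
      Function.iterate_add_apply _ l k a, hk, iterate_map_zero, iterate_map_zero, add_zero]

end Exponentials

/-! ### Hamiltonian reductions with a slice -/

section SliceFamily

open KirillovKostant SymmetricAlgebra

variable {𝔤 : Type*} [LieRing 𝔤] [LieAlgebra ℂ 𝔤]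

theorem hamVec_lie (a b : 𝔤) (X : SymmetricAlgebra ℂ 𝔤) :
    hamVec a (hamVec b X) = hamVec ⁅a, b⁆ X + hamVec b (hamVec a X) := by
  have h := br_jacobi (ι ℂ 𝔤 a) (ι ℂ 𝔤 b) X
  rw [br_ι_ι] at h
  simpa only [br_apply, rightBr_ι] using h

theorem hamVec_mem_of_mem_span {I : Ideal (SymmetricAlgebra ℂ 𝔤)} {X : SymmetricAlgebra ℂ 𝔤}
    {s : Set 𝔤} (h : ∀ a ∈ s, hamVec a X ∈ I) {a : 𝔤} (ha : a ∈ Submodule.span ℂ s) :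
    hamVec a X ∈ I := by
  have hzero : hamVec (0 : 𝔤) X = 0 := by
    simpa only [zero_smul, Derivation.zero_apply] using
      congrArg (fun D => D X) (hamVec_smul (0 : ℂ) (0 : 𝔤))
  induction ha using Submodule.span_induction with
  | mem a ha => exact h a ha
  | zero => exact hzero ▸ I.zero_mem
  | add a b _ _ ha hb => exact hamVec_add a b ▸ I.add_mem ha hb
  | smul c a _ ha =>
    rw [hamVec_smul, Derivation.smul_apply, Algebra.smul_def]
    exact I.mul_mem_left _ ha

theorem bracket_ι_sub (y : 𝔤) (c : ℂ) (X : SymmetricAlgebra ℂ 𝔤) :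
    (kirillovKostant 𝔤).bracket (ι ℂ 𝔤 y - algebraMap ℂ _ c) X = hamVec y X := by
  change rightBr X (ι ℂ 𝔤 y - algebraMap ℂ _ c) = _
  rw [map_sub, rightBr_ι, Derivation.map_algebraMap, sub_zero]

variable {χ : Dual ℂ 𝔤} {𝔪 : LieSubalgebra ℂ 𝔤}

theorem mem_zeroFibre {ξ : Dual ℂ 𝔤} : ξ ∈ zeroFibre χ 𝔪 ↔ ∀ y ∈ 𝔪, ξ y = χ y := by
  change momentMap χ 𝔪 ξ = 0 ↔ _
  simp only [LinearMap.ext_iff, Subtype.forall]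
  exact forall₂_congr fun y _ => sub_eq_zero

theorem self_mem_zeroFibre : χ ∈ zeroFibre χ 𝔪 :=
  mem_zeroFibre.2 fun _ _ => rfl

theorem evalAt_eq_zero_of_mem_span {ξ : Dual ℂ 𝔤} (hξ : ξ ∈ zeroFibre χ 𝔪)
    {X : SymmetricAlgebra ℂ 𝔤} (hX : X ∈ Ideal.span (shiftedElements χ 𝔪)) : evalAt ξ X = 0 :=
  evalAt_eq_zero_of_mem_affineIdeal (W := 𝔪.toSubmodule) (mem_zeroFibre.1 hξ) hX

theorem mem_span_shiftedElements [FiniteDimensional ℂ 𝔤] {X : SymmetricAlgebra ℂ 𝔤} :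
    X ∈ Ideal.span (shiftedElements χ 𝔪) ↔ ∀ ξ ∈ zeroFibre χ 𝔪, evalAt ξ X = 0 := by
  simp only [mem_zeroFibre]
  exact mem_affineIdeal_iff (W := 𝔪.toSubmodule)

theorem mem_normalizer_shiftedElements {X : SymmetricAlgebra ℂ 𝔤} :
    X ∈ (kirillovKostant 𝔤).normalizer (shiftedElements χ 𝔪) ↔
      ∀ y ∈ 𝔪, hamVec y X ∈ Ideal.span (shiftedElements χ 𝔪) := by
  constructor
  · intro h y hy
    rw [← bracket_ι_sub y (χ y)]
    exact h _ ⟨y, hy, rfl⟩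
  · rintro h _ ⟨y, hy, rfl⟩
    rw [bracket_ι_sub]
    exact h y hy

theorem hamVec_mem_span {y : 𝔤} (hy : ∀ w ∈ 𝔪, ⁅y, w⁆ ∈ 𝔪) (hχ : ∀ w ∈ 𝔪, χ ⁅y, w⁆ = 0)
    {X : SymmetricAlgebra ℂ 𝔤} (hX : X ∈ Ideal.span (shiftedElements χ 𝔪)) :
    hamVec y X ∈ Ideal.span (shiftedElements χ 𝔪) := by
  induction hX using Submodule.span_induction with
  | mem t ht =>
    obtain ⟨w, hw, rfl⟩ := ht
    rw [map_sub, hamVec_ι, Derivation.map_algebraMap, sub_zero]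
    refine Ideal.subset_span ⟨⁅y, w⁆, hy w hw, ?_⟩
    rw [hχ w hw, map_zero, sub_zero]
  | zero => simp
  | add a b _ _ ha hb => simpa using Ideal.add_mem _ ha hb
  | smul a b hb hb' =>
    rw [smul_eq_mul, Derivation.leibniz]
    exact Ideal.add_mem _ (Ideal.mul_mem_left _ _ hb') (Ideal.mul_mem_right _ _ hb)

theorem smul_mem_zeroFibre {𝔨 : LieSubalgebra ℂ 𝔤} (hlie : ∀ y ∈ 𝔨, ∀ w ∈ 𝔪, ⁅y, w⁆ ∈ 𝔪)
    (hχ : ∀ y ∈ 𝔨, ∀ w ∈ 𝔪, χ ⁅y, w⁆ = 0) {g : 𝔤 ≃ₗ[ℂ] 𝔤} (hg : g ∈ unipotentGroup 𝔨)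
    {ξ : Dual ℂ 𝔤} (hξ : ξ ∈ zeroFibre χ 𝔪) : g • ξ ∈ zeroFibre χ 𝔪 := by
  rw [mem_zeroFibre] at hξ ⊢
  intro w hw
  have h : g⁻¹ w - w ∈ LinearMap.ker ξ :=
    unipotentGroup_sub_apply_mem (W := 𝔪.toSubmodule) hlie
      (fun y hy w hw => (hξ _ (hlie y hy w hw)).trans (hχ y hy w hw)) (inv_mem hg) hw
  rw [LinearMap.mem_ker, map_sub, sub_eq_zero] at h
  rw [coadjoint_smul_apply, h, hξ w hw]

section Character

variable (hχ : ∀ a ∈ 𝔪, ∀ b ∈ 𝔪, χ ⁅a, b⁆ = 0)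
include hχ

theorem span_le_normalizer {X : SymmetricAlgebra ℂ 𝔤}
    (hX : X ∈ Ideal.span (shiftedElements χ 𝔪)) :
    X ∈ (kirillovKostant 𝔤).normalizer (shiftedElements χ 𝔪) :=
  mem_normalizer_shiftedElements.2 fun y hy =>
    hamVec_mem_span (fun _ hw => 𝔪.lie_mem hy hw) (hχ y hy) hX

theorem modI_mem_classicalW {X : SymmetricAlgebra ℂ 𝔤} :
    modI χ 𝔪 X ∈ classicalW χ 𝔪 ↔
      X ∈ (kirillovKostant 𝔤).normalizer (shiftedElements χ 𝔪) := by
  refine ⟨?_, fun h => ⟨X, h, rfl⟩⟩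
  rintro ⟨X', hX', h⟩
  have hsub := span_le_normalizer hχ (Ideal.Quotient.eq.1 h)
  exact sub_sub_cancel X' X ▸ sub_mem (show X' ∈ PoissonStructure.normalizer _ _ from hX') hsub

theorem comp_expAdSum_mem_zeroFibre {y : 𝔤} (hy : y ∈ 𝔪) {N : ℕ}
    (hN : LieAlgebra.ad ℂ 𝔤 y ^ N = 0) {ξ : Dual ℂ 𝔤} (hξ : ξ ∈ zeroFibre χ 𝔪) (t : ℂ) :
    ξ ∘ₗ expAdSum (t • y) N ∈ zeroFibre χ 𝔪 := by
  obtain ⟨g, hg, hgξ⟩ := exists_smul_eq_comp_expAdSum (ad_smul_pow_eq_zero hN t)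
  rw [← hgξ]
  exact smul_mem_zeroFibre (fun _ hy _ hw => 𝔪.lie_mem hy hw) hχ (hg 𝔪 (𝔪.smul_mem t hy)) hξ

theorem evalAt_smul_of_mem_normalizer {X : SymmetricAlgebra ℂ 𝔤}
    (hX : X ∈ (kirillovKostant 𝔤).normalizer (shiftedElements χ 𝔪)) {g : 𝔤 ≃ₗ[ℂ] 𝔤}
    (hg : g ∈ unipotentGroup 𝔪) {ξ : Dual ℂ 𝔤} (hξ : ξ ∈ zeroFibre χ 𝔪) :
    evalAt (g • ξ) X = evalAt ξ X := by
  induction hg using unipotentGroup_induction generalizing ξ with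
  | exp y hy N hN g hg =>
    have hN' := ad_neg_pow_eq_zero hN
    have hy' := 𝔪.neg_mem hy
    have hgξ : g • ξ = ξ ∘ₗ expAdSum ((1 : ℂ) • (-y)) N := by
      rw [one_smul, ← inv_coe_eq_expAdSum hN hg]
      rfl
    rw [hgξ, evalAt_expAdSum_eq hN' (c := 0), zero_mul, add_zero]
    exact fun t => evalAt_eq_zero_of_mem_span (comp_expAdSum_mem_zeroFibre hχ hy' hN' hξ t)
      (mem_normalizer_shiftedElements.1 hX _ hy')
  | one => rw [one_smul]
  | mul g g' _ hg' h h' =>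
    rw [mul_smul, h (smul_mem_zeroFibre (fun _ hy _ hw => 𝔪.lie_mem hy hw) hχ hg' hξ), h' hξ]

end Character

/-- Elements `y i` spanning `𝔪`, ordered compatibly with the bracket, together with linear
functions `x j` on the zero fibre that are triangularly conjugate to them. The common zero locus of
the `x j` is then a slice for the unipotent group of `𝔪`. -/
structure SliceFamily (χ : Dual ℂ 𝔤) (𝔪 : LieSubalgebra ℂ 𝔤) {d : ℕ} (y x : Fin d → 𝔤) :
    Prop where
  span_eq : Submodule.span ℂ (Set.range y) = 𝔪.toSubmodule
  nilpotent : ∀ i, IsNilpotent (LieAlgebra.ad ℂ 𝔤 (y i))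
  lie_mem : ∀ i j, j ≤ i → ⁅y i, x j⁆ ∈ 𝔪
  apply_self : ∀ i, χ ⁅y i, x i⁆ = 1
  apply_lt : ∀ i j, j < i → χ ⁅y i, x j⁆ = 0
  triangular : ∀ i j, i < j → ⁅y j, y i⁆ ∈ Submodule.span ℂ (y '' Set.Ioi i)
  character : ∀ a ∈ 𝔪, ∀ b ∈ 𝔪, χ ⁅a, b⁆ = 0

/-- The slice cut out in the zero fibre by the linear functions `x j`. -/
def sliceSet (χ : Dual ℂ 𝔤) (𝔪 : LieSubalgebra ℂ 𝔤) {d : ℕ} (x : Fin d → 𝔤) :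
    Set (Dual ℂ 𝔤) :=
  {ξ | ξ ∈ zeroFibre χ 𝔪 ∧ ∀ j, ξ (x j) = 0}

theorem evalAt_eq_of_sub_mem_span_ι {d : ℕ} {x : Fin d → 𝔤} {ξ : Dual ℂ 𝔤}
    (hξ : ∀ j, ξ (x j) = 0) {X Y : SymmetricAlgebra ℂ 𝔤}
    (h : X - Y ∈ Ideal.span (Set.range fun j => ι ℂ 𝔤 (x j))) : evalAt ξ X = evalAt ξ Y := by
  have hle : Ideal.span (Set.range fun j => ι ℂ 𝔤 (x j)) ≤ RingHom.ker (evalAt ξ) := by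
    rw [Ideal.span_le]
    rintro _ ⟨j, rfl⟩
    exact (evalAt_ι ξ (x j)).trans (hξ j)
  have := hle h
  rwa [RingHom.mem_ker, map_sub, sub_eq_zero] at this

/-- Evaluation of classes modulo the ideal of the zero fibre at the points of the slice. -/
noncomputable def evalSlice {d : ℕ} (x : Fin d → 𝔤) :
    (SymmetricAlgebra ℂ 𝔤 ⧸ Ideal.span (shiftedElements χ 𝔪)) →ₐ[ℂ] (sliceSet χ 𝔪 x → ℂ) :=
  AlgHom.pi fun ξ => Ideal.Quotient.liftₐ _ (evalAt (ξ : Dual ℂ 𝔤))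
    fun _ hX => evalAt_eq_zero_of_mem_span ξ.2.1 hX

theorem evalSlice_modI {d : ℕ} (x : Fin d → 𝔤) (X : SymmetricAlgebra ℂ 𝔤) (ξ : sliceSet χ 𝔪 x) :
    evalSlice x (modI χ 𝔪 X) ξ = evalAt (ξ : Dual ℂ 𝔤) X :=
  rfl

theorem evalSlice_mem {d : ℕ} (x : Fin d → 𝔤)
    (w : SymmetricAlgebra ℂ 𝔤 ⧸ Ideal.span (shiftedElements χ 𝔪)) :
    evalSlice x w ∈ polyFunctions (sliceSet χ 𝔪 x) := by
  obtain ⟨X, rfl⟩ := Ideal.Quotient.mk_surjective w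
  exact mem_polyFunctions.2 ⟨X, evalSlice_modI x X⟩

namespace SliceFamily

variable {d : ℕ} {y x : Fin d → 𝔤} (F : SliceFamily χ 𝔪 y x)
include F

theorem y_mem (i : Fin d) : y i ∈ 𝔪 := by
  rw [← LieSubalgebra.mem_toSubmodule, ← F.span_eq]
  exact Submodule.subset_span ⟨i, rfl⟩

theorem smul_mem {g : 𝔤 ≃ₗ[ℂ] 𝔤} (hg : g ∈ unipotentGroup 𝔪) {ξ : Dual ℂ 𝔤}
    (hξ : ξ ∈ zeroFibre χ 𝔪) : g • ξ ∈ zeroFibre χ 𝔪 :=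
  smul_mem_zeroFibre (fun _ hy _ hw => 𝔪.lie_mem hy hw) F.character hg hξ

theorem mem_normalizer_iff {X : SymmetricAlgebra ℂ 𝔤} :
    X ∈ (kirillovKostant 𝔤).normalizer (shiftedElements χ 𝔪) ↔
      ∀ i, hamVec (y i) X ∈ Ideal.span (shiftedElements χ 𝔪) := by
  rw [mem_normalizer_shiftedElements]
  refine ⟨fun h i => h _ (F.y_mem i), fun h a ha => ?_⟩
  exact hamVec_mem_of_mem_span (Set.forall_mem_range.2 h) (F.span_eq.symm ▸ ha)

theorem exists_smul_apply_eq_zero {ξ : Dual ℂ 𝔤} (hξ : ξ ∈ zeroFibre χ 𝔪) (i : Fin d) :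
    ∃ u : 𝔤 ≃ₗ[ℂ] 𝔤, (∀ 𝔨 : LieSubalgebra ℂ 𝔤, y i ∈ 𝔨 → u ∈ unipotentGroup 𝔨) ∧
      (u • ξ) (x i) = 0 ∧ ∀ j < i, (u • ξ) (x j) = ξ (x j) := by
  obtain ⟨N, hN⟩ := F.nilpotent i
  obtain ⟨u, hu, huξ⟩ := exists_smul_eq_comp_expAdSum (ad_smul_pow_eq_zero hN (-ξ (x i)))
  have hval (j : Fin d) (hj : j ≤ i) : (u • ξ) (x j) = ξ (x j) + χ ⁅y i, x j⁆ * -ξ (x i) := by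
    have h := evalAt_expAdSum_eq hN (ξ := ξ) (X := ι ℂ 𝔤 (x j)) (c := χ ⁅y i, x j⁆)
      (fun t => by
        rw [hamVec_ι, evalAt_ι]
        exact mem_zeroFibre.1 (comp_expAdSum_mem_zeroFibre F.character (F.y_mem i) hN hξ t) _
          (F.lie_mem i j hj))
      (-ξ (x i))
    rwa [evalAt_ι, evalAt_ι, ← huξ] at h
  refine ⟨u, fun 𝔨 h𝔨 => hu 𝔨 (𝔨.smul_mem _ h𝔨), ?_, fun j hj => ?_⟩
  · rw [hval i le_rfl, F.apply_self, one_mul, add_neg_cancel]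
  · rw [hval j hj.le, F.apply_lt i j hj, zero_mul, add_zero]

theorem exists_smul_mem_sliceSet {G : Subgroup (𝔤 ≃ₗ[ℂ] 𝔤)} (hG : G ≤ unipotentGroup 𝔪)
    (hyG : ∀ i, ∃ 𝔨 : LieSubalgebra ℂ 𝔤, y i ∈ 𝔨 ∧ unipotentGroup 𝔨 ≤ G) {ξ : Dual ℂ 𝔤}
    (hξ : ξ ∈ zeroFibre χ 𝔪) : ∃ g ∈ G, g • ξ ∈ sliceSet χ 𝔪 x := by
  suffices H : ∀ k ≤ d, ∃ g ∈ G, ∀ j : Fin d, (j : ℕ) < k → (g • ξ) (x j) = 0 by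
    obtain ⟨g, hg, h⟩ := H d le_rfl
    exact ⟨g, hg, F.smul_mem (hG hg) hξ, fun j => h j j.2⟩
  intro k hk
  induction k with
  | zero => exact ⟨1, one_mem G, fun j hj => absurd hj j.1.not_lt_zero⟩
  | succ k ih =>
    obtain ⟨g, hg, h⟩ := ih (Nat.le_of_succ_le hk)
    obtain ⟨u, hu, hself, hlt⟩ := F.exists_smul_apply_eq_zero (F.smul_mem (hG hg) hξ) ⟨k, hk⟩
    obtain ⟨𝔨, h𝔨, h𝔨G⟩ := hyG ⟨k, hk⟩
    refine ⟨u * g, mul_mem (h𝔨G (hu 𝔨 h𝔨)) hg, fun j hj => ?_⟩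
    rw [mul_smul]
    rcases (show j ≤ ⟨k, hk⟩ from Nat.lt_succ_iff.1 hj).eq_or_lt with rfl | hjk
    · exact hself
    · rw [hlt j hjk, h j hjk]

theorem exists_unipotent_smul_mem_sliceSet {ξ : Dual ℂ 𝔤} (hξ : ξ ∈ zeroFibre χ 𝔪) :
    ∃ g ∈ unipotentGroup 𝔪, g • ξ ∈ sliceSet χ 𝔪 x :=
  F.exists_smul_mem_sliceSet le_rfl (fun i => ⟨𝔪, F.y_mem i, le_rfl⟩) hξ

theorem exists_projection (X : SymmetricAlgebra ℂ 𝔤) :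
    ∃ Y ∈ (kirillovKostant 𝔤).normalizer (shiftedElements χ 𝔪),
      X - Y ∈ Ideal.span (Set.range fun j => ι ℂ 𝔤 (x j)) := by
  have hι (i j : Fin d) (hji : j ≤ i) :
      hamVec (y i) (ι ℂ 𝔤 (x j)) - algebraMap ℂ _ (χ ⁅y i, x j⁆) ∈
        Ideal.span (shiftedElements χ 𝔪) :=
    Ideal.subset_span ⟨⁅y i, x j⁆, F.lie_mem i j hji, by rw [hamVec_ι]⟩
  obtain ⟨Y, hY, hXY⟩ := exists_common_invariant (fun i => hamVec (y i))
    (fun j => ι ℂ 𝔤 (x j)) (I := Ideal.span (shiftedElements χ 𝔪))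
    (fun i => by simpa only [F.apply_self, map_one] using hι i i le_rfl)
    (fun i j hji => by simpa only [F.apply_lt i j hji, map_zero, sub_zero] using hι i j hji.le)
    (fun i j hij X hX => by
      rw [hamVec_lie]
      refine Ideal.add_mem _ (hamVec_mem_of_mem_span ?_ (F.triangular i j hij))
        (hamVec_mem_span (fun w hw => 𝔪.lie_mem (F.y_mem i) hw)
          (F.character _ (F.y_mem i)) (hX j hij))
      rintro _ ⟨l, hl, rfl⟩
      exact hX l hl)
    (fun i X => hamVec_locally_nilpotent (F.nilpotent i) X) X
  exact ⟨Y, F.mem_normalizer_iff.2 hY, hXY⟩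

theorem eq_of_smul_eq {ξ ξ' : Dual ℂ 𝔤} (hξ : ξ ∈ sliceSet χ 𝔪 x) (hξ' : ξ' ∈ sliceSet χ 𝔪 x)
    {g : 𝔤 ≃ₗ[ℂ] 𝔤} (hg : g ∈ unipotentGroup 𝔪) (h : g • ξ = ξ') : ξ = ξ' := by
  ext v
  obtain ⟨Y, hY, hvY⟩ := F.exists_projection (ι ℂ 𝔤 v)
  calc ξ v = evalAt ξ Y := by rw [← evalAt_ι, evalAt_eq_of_sub_mem_span_ι hξ.2 hvY]
    _ = evalAt ξ' Y := by rw [← h, evalAt_smul_of_mem_normalizer F.character hY hg hξ.1]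
    _ = ξ' v := by rw [← evalAt_ι, evalAt_eq_of_sub_mem_span_ι hξ'.2 hvY]

theorem mem_span_of_forall_sliceSet [FiniteDimensional ℂ 𝔤] {X : SymmetricAlgebra ℂ 𝔤}
    (hX : X ∈ (kirillovKostant 𝔤).normalizer (shiftedElements χ 𝔪))
    (h : ∀ ξ ∈ sliceSet χ 𝔪 x, evalAt ξ X = 0) : X ∈ Ideal.span (shiftedElements χ 𝔪) := by
  rw [mem_span_shiftedElements]
  intro ξ hξ
  obtain ⟨g, hg, hgξ⟩ := F.exists_unipotent_smul_mem_sliceSet hξ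
  rw [← evalAt_smul_of_mem_normalizer F.character hX hg hξ, h _ hgξ]

theorem isAffineVariety [FiniteDimensional ℂ 𝔤] :
    IsAffineVariety (polyFunctions (sliceSet χ 𝔪 x)) := by
  obtain ⟨g, -, h₀⟩ := F.exists_unipotent_smul_mem_sliceSet self_mem_zeroFibre
  refine isAffineVariety_polyFunctions (𝔪.toSubmodule ⊔ Submodule.span ℂ (Set.range x)) (g • χ)
    fun ξ => ⟨fun hξ w hw => ?_, fun h => ⟨mem_zeroFibre.2 fun w hw => ?_, fun j => ?_⟩⟩
  · have hle : 𝔪.toSubmodule ⊔ Submodule.span ℂ (Set.range x) ≤ LinearMap.eqLocus ξ (g • χ) := by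
      refine sup_le (fun w hw => ?_) (Submodule.span_le.2 ?_)
      · exact (mem_zeroFibre.1 hξ.1 w hw).trans (mem_zeroFibre.1 h₀.1 w hw).symm
      · rintro _ ⟨j, rfl⟩
        exact (hξ.2 j).trans (h₀.2 j).symm
    exact hle hw
  · rw [h w (Submodule.mem_sup_left hw), mem_zeroFibre.1 h₀.1 w hw]
  · rw [h _ (Submodule.mem_sup_right (Submodule.subset_span ⟨j, rfl⟩)), h₀.2 j]

theorem bijective_mk : Function.Bijective fun ξ : sliceSet χ 𝔪 x =>
    OrbitSpace.mk (unipotentGroup 𝔪) (⟨ξ, ξ.2.1⟩ : zeroFibre χ 𝔪) := by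
  constructor
  · intro ξ ξ' h
    obtain ⟨g, hg⟩ := OrbitSpace.mk_eq_mk.1 h
    exact (Subtype.ext (F.eq_of_smul_eq ξ'.2 ξ.2 g.2 hg)).symm
  · intro p
    obtain ⟨ξ, rfl⟩ := OrbitSpace.mk_surjective p
    obtain ⟨g, hg, hgξ⟩ := F.exists_unipotent_smul_mem_sliceSet ξ.2
    exact ⟨⟨_, hgξ⟩, OrbitSpace.mk_eq_mk.2 ⟨⟨g, hg⟩, rfl⟩⟩

/-- The identification of the slice with the reduced space `μ⁻¹(0) / M`. -/
noncomputable def sliceEquiv : sliceSet χ 𝔪 x ≃ HamRed χ 𝔪 :=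
  Equiv.ofBijective _ F.bijective_mk

theorem mem_hamRedFunctions_iff {φ : HamRed χ 𝔪 → ℂ} :
    φ ∈ hamRedFunctions χ 𝔪 ↔ φ ∘ F.sliceEquiv ∈ polyFunctions (sliceSet χ 𝔪 x) := by
  constructor
  · intro hφ
    obtain ⟨X, hX⟩ := mem_polyFunctions.1 hφ
    exact mem_polyFunctions.2 ⟨X, fun ξ => hX ⟨ξ, ξ.2.1⟩⟩
  · intro hφ
    obtain ⟨X, hX⟩ := mem_polyFunctions.1 hφ
    obtain ⟨Y, hY, hXY⟩ := F.exists_projection X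
    refine mem_polyFunctions.2 ⟨Y, fun ξ => ?_⟩
    obtain ⟨g, hg, hgξ⟩ := F.exists_unipotent_smul_mem_sliceSet ξ.2
    calc φ (OrbitSpace.mk (unipotentGroup 𝔪) ξ) = φ (F.sliceEquiv ⟨g • ξ, hgξ⟩) :=
        congrArg φ (OrbitSpace.mk_eq_mk.2 ⟨⟨g⁻¹, inv_mem hg⟩, inv_smul_smul g (ξ : Dual ℂ 𝔤)⟩)
      _ = evalAt (g • (ξ : Dual ℂ 𝔤)) Y :=
        (hX _).trans (evalAt_eq_of_sub_mem_span_ι hgξ.2 hXY)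
      _ = evalAt (ξ : Dual ℂ 𝔤) Y := evalAt_smul_of_mem_normalizer F.character hY hg ξ.2

theorem exists_evalSlice_eq {φ : sliceSet χ 𝔪 x → ℂ} (hφ : φ ∈ polyFunctions (sliceSet χ 𝔪 x)) :
    ∃ w ∈ classicalW χ 𝔪, evalSlice x w = φ := by
  obtain ⟨X, hX⟩ := mem_polyFunctions.1 hφ
  obtain ⟨Y, hY, hXY⟩ := F.exists_projection X
  refine ⟨modI χ 𝔪 Y, (modI_mem_classicalW F.character).2 hY, funext fun ξ => ?_⟩
  rw [evalSlice_modI, hX, evalAt_eq_of_sub_mem_span_ι ξ.2.2 hXY]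

section CoordinateRing

variable [FiniteDimensional ℂ 𝔤]

theorem eq_zero_of_evalSlice_eq_zero {w : SymmetricAlgebra ℂ 𝔤 ⧸ Ideal.span (shiftedElements χ 𝔪)}
    (hw : w ∈ classicalW χ 𝔪) (h : evalSlice x w = 0) : w = 0 := by
  obtain ⟨X, rfl⟩ := Ideal.Quotient.mk_surjective w
  exact Ideal.Quotient.eq_zero_iff_mem.2 (F.mem_span_of_forall_sliceSet
    ((modI_mem_classicalW F.character).1 hw) fun ξ hξ => congrFun h ⟨ξ, hξ⟩)

/-- The identification of the classical W-algebra with the coordinate ring of the slice. -/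
noncomputable def sliceAlgEquiv : classicalW χ 𝔪 ≃ₐ[ℂ] polyFunctions (sliceSet χ 𝔪 x) :=
  AlgEquiv.ofBijective
    (((evalSlice x).comp (classicalW χ 𝔪).val).codRestrict _ fun w => evalSlice_mem x w.1) <| by
    refine ⟨(injective_iff_map_eq_zero _).2 fun w hw => ?_, fun φ => ?_⟩
    · exact Subtype.ext (F.eq_zero_of_evalSlice_eq_zero w.2 (congrArg Subtype.val hw))
    · obtain ⟨w, hw, hφ⟩ := F.exists_evalSlice_eq φ.2
      exact ⟨⟨w, hw⟩, Subtype.ext hφ⟩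

theorem sliceAlgEquiv_apply (X : SymmetricAlgebra ℂ 𝔤) (hX : modI χ 𝔪 X ∈ classicalW χ 𝔪)
    (ξ : sliceSet χ 𝔪 x) :
    (F.sliceAlgEquiv ⟨modI χ 𝔪 X, hX⟩ : _ → ℂ) ξ = evalAt (ξ : Dual ℂ 𝔤) X :=
  rfl

/-- The identification of the classical W-algebra with the coordinate ring of the reduced space
`μ⁻¹(0) / M`. -/
noncomputable def hamRedAlgEquiv : classicalW χ 𝔪 ≃ₐ[ℂ] hamRedFunctions χ 𝔪 :=
  F.sliceAlgEquiv.trans (regularFunctionsEquiv F.sliceEquiv fun _ => F.mem_hamRedFunctions_iff)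

theorem hamRedAlgEquiv_sliceEquiv (w : classicalW χ 𝔪) (ξ : sliceSet χ 𝔪 x) :
    (F.hamRedAlgEquiv w : _ → ℂ) (F.sliceEquiv ξ) = (F.sliceAlgEquiv w : _ → ℂ) ξ :=
  regularFunctionsEquiv_apply F.sliceEquiv (fun _ => F.mem_hamRedFunctions_iff) _ ξ

theorem hamRedAlgEquiv_apply (X : SymmetricAlgebra ℂ 𝔤) (hX : modI χ 𝔪 X ∈ classicalW χ 𝔪)
    (ξ : zeroFibre χ 𝔪) :
    (F.hamRedAlgEquiv ⟨modI χ 𝔪 X, hX⟩ : _ → ℂ) (OrbitSpace.mk (unipotentGroup 𝔪) ξ) =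
      evalAt (ξ : Dual ℂ 𝔤) X := by
  obtain ⟨ζ, hζ⟩ := F.sliceEquiv.surjective (OrbitSpace.mk (unipotentGroup 𝔪) ξ)
  obtain ⟨g, hg⟩ := OrbitSpace.mk_eq_mk.1 hζ.symm
  rw [← hζ, hamRedAlgEquiv_sliceEquiv, sliceAlgEquiv_apply, ← evalAt_smul_of_mem_normalizer
    F.character ((modI_mem_classicalW F.character).1 hX) g.2 ζ.2.1]
  exact congrArg (evalAt · X) hg

theorem hasGeometricQuotient :
    HasGeometricQuotient (unipotentGroup 𝔪) (zeroFibre χ 𝔪) (polyFunctions (zeroFibre χ 𝔪)) := by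
  let s (p : HamRed χ 𝔪) : zeroFibre χ 𝔪 := ⟨F.sliceEquiv.symm p, (F.sliceEquiv.symm p).2.1⟩
  refine hasGeometricQuotient_of_section (fun g ξ hξ => F.smul_mem g.2 hξ)
    (F.isAffineVariety.of_equiv F.sliceEquiv fun _ => F.mem_hamRedFunctions_iff) s
    (fun p => F.sliceEquiv.apply_symm_apply p) fun a ha => ?_
  obtain ⟨X, hX⟩ := mem_polyFunctions.1 ha
  refine F.mem_hamRedFunctions_iff.2 (mem_polyFunctions.2 ⟨X, fun ξ => ?_⟩)
  rw [Function.comp_apply, Function.comp_apply, hX]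
  exact congrArg (fun ζ : sliceSet χ 𝔪 x => evalAt (ζ : Dual ℂ 𝔤) X)
    (F.sliceEquiv.symm_apply_apply ξ)

end CoordinateRing

end SliceFamily

end SliceFamily

/-! ### Reduction in two stages: algebra -/

section Intertwining

variable {A A' X Y : Type*} [CommRing A] [Algebra ℂ A] [CommRing A'] [Algebra ℂ A']
  {RX : Subalgebra ℂ (X → ℂ)} {RY : Subalgebra ℂ (Y → ℂ)} {Ψ : A' ≃ₐ[ℂ] A}
  {Θ : A ≃ₐ[ℂ] RX} {Θ' : A' ≃ₐ[ℂ] RY} {σ : X ≃ Y}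

theorem mem_iff_comp_mem_of_intertwining (h : ∀ a p, (Θ' a : Y → ℂ) (σ p) = (Θ (Ψ a) : X → ℂ) p)
    (φ : Y → ℂ) : φ ∈ RY ↔ φ ∘ σ ∈ RX := by
  have hcomp (a : A') : (Θ' a : Y → ℂ) ∘ σ = Θ (Ψ a) := funext (h a)
  constructor
  · intro hφ
    obtain ⟨a, ha⟩ := Θ'.surjective ⟨φ, hφ⟩
    have haφ : (Θ' a : Y → ℂ) = φ := congrArg Subtype.val ha
    rw [← haφ, hcomp]
    exact (Θ (Ψ a)).2
  · intro hφ
    obtain ⟨a, ha⟩ := (Ψ.trans Θ).surjective ⟨φ ∘ σ, hφ⟩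
    have haφ : (Θ' a : Y → ℂ) ∘ σ = φ ∘ σ := (hcomp a).trans (congrArg Subtype.val ha)
    rw [← σ.surjective.injective_comp_right haφ]
    exact (Θ' a).2

theorem isPoissonIso_transport {P : PoissonStructure A} {P' : PoissonStructure A'}
    (hΨ : ∀ a b, Ψ (P'.bracket a b) = P.bracket (Ψ a) (Ψ b))
    (h : ∀ a p, (Θ' a : Y → ℂ) (σ p) = (Θ (Ψ a) : X → ℂ) p) :
    IsPoissonIso (P.transport Θ) (P'.transport Θ') σ := by
  refine ⟨mem_iff_comp_mem_of_intertwining h, fun φ ψ p => ?_⟩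
  obtain ⟨a, rfl⟩ := Θ'.surjective φ
  obtain ⟨b, rfl⟩ := Θ'.surjective ψ
  have hcomp (a : A') (ha) : (⟨(Θ' a : Y → ℂ) ∘ σ, ha⟩ : RX) = Θ (Ψ a) :=
    Subtype.ext (funext (h a))
  rw [hcomp, hcomp]
  change (Θ' (P'.bracket (Θ'.symm (Θ' a)) (Θ'.symm (Θ' b))) : Y → ℂ) (σ p) =
    (Θ (P.bracket (Θ.symm (Θ (Ψ a))) (Θ.symm (Θ (Ψ b)))) : X → ℂ) p
  rw [h, hΨ]
  simp only [AlgEquiv.symm_apply_apply]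

end Intertwining

noncomputable section

open KirillovKostant SymmetricAlgebra

variable {𝔤 : Type*} [LieRing 𝔤] [LieAlgebra ℂ 𝔤]

/-- Compatible slice families for a Hamiltonian reduction by `𝔪₂` carried out in two stages, first
by the ideal `𝔪₁` and then by a subalgebra `𝔪₀` with `𝔪₁ + 𝔪₀ = 𝔪₂`. -/
structure TwoStage (χ₁ χ₂ : Dual ℂ 𝔤) (𝔪₁ 𝔪₂ 𝔪₀ : LieSubalgebra ℂ 𝔤) {d₁ d₂ : ℕ}
    (y₁ x₁ : Fin d₁ → 𝔤) (y₂ x₂ : Fin d₂ → 𝔤) : Prop where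
  first : SliceFamily χ₁ 𝔪₁ y₁ x₁
  total : SliceFamily χ₂ 𝔪₂ y₂ x₂
  sup_eq : 𝔪₁.toSubmodule ⊔ 𝔪₀.toSubmodule = 𝔪₂.toSubmodule
  ideal : ∀ a ∈ 𝔪₂, ∀ b ∈ 𝔪₁, ⁅a, b⁆ ∈ 𝔪₁
  agree : ∀ a ∈ 𝔪₁, χ₁ a = χ₂ a
  adapted : ∀ i, y₂ i ∈ 𝔪₁ ∨ y₂ i ∈ 𝔪₀

namespace TwoStage

variable {χ₁ χ₂ : Dual ℂ 𝔤} {𝔪₁ 𝔪₂ 𝔪₀ : LieSubalgebra ℂ 𝔤} {d₁ d₂ : ℕ}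
  {y₁ x₁ : Fin d₁ → 𝔤} {y₂ x₂ : Fin d₂ → 𝔤} (H : TwoStage χ₁ χ₂ 𝔪₁ 𝔪₂ 𝔪₀ y₁ x₁ y₂ x₂)

include H

theorem first_le : 𝔪₁.toSubmodule ≤ 𝔪₂.toSubmodule := H.sup_eq ▸ le_sup_left

theorem second_le : 𝔪₀.toSubmodule ≤ 𝔪₂.toSubmodule := H.sup_eq ▸ le_sup_right

theorem exists_add {a : 𝔤} (ha : a ∈ 𝔪₂) : ∃ b ∈ 𝔪₁, ∃ c ∈ 𝔪₀, b + c = a := by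
  have ha' : a ∈ 𝔪₁.toSubmodule ⊔ 𝔪₀.toSubmodule := H.sup_eq ▸ ha
  exact Submodule.mem_sup.1 ha'

theorem apply_lie {a b : 𝔤} (ha : a ∈ 𝔪₂) (hb : b ∈ 𝔪₁) : χ₁ ⁅a, b⁆ = 0 := by
  rw [H.agree _ (H.ideal a ha b hb), H.total.character a ha b (H.first_le hb)]

theorem mem_zeroFibre_iff {ξ : Dual ℂ 𝔤} :
    ξ ∈ zeroFibre χ₂ 𝔪₂ ↔ ξ ∈ zeroFibre χ₁ 𝔪₁ ∧ ∀ a ∈ 𝔪₀, ξ a = χ₂ a := by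
  simp only [mem_zeroFibre]
  constructor
  · exact fun h => ⟨fun a ha => (h a (H.first_le ha)).trans (H.agree a ha).symm,
      fun a ha => h a (H.second_le ha)⟩
  · rintro ⟨h₁, h₀⟩ a ha
    obtain ⟨b, hb, c, hc, rfl⟩ := H.exists_add ha
    rw [map_add, map_add, h₁ b hb, h₀ c hc, H.agree b hb]

theorem zeroFibre_subset : zeroFibre χ₂ 𝔪₂ ⊆ zeroFibre χ₁ 𝔪₁ :=
  fun _ h => (H.mem_zeroFibre_iff.1 h).1

theorem span_le : Ideal.span (shiftedElements χ₁ 𝔪₁) ≤ Ideal.span (shiftedElements χ₂ 𝔪₂) := by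
  refine Ideal.span_mono ?_
  rintro _ ⟨a, ha, rfl⟩
  exact ⟨a, H.first_le ha, by rw [H.agree a ha]⟩

theorem generator_mem {a : 𝔤} (ha : a ∈ 𝔪₀) (c : ℂ) :
    ι ℂ 𝔤 a - algebraMap ℂ _ c ∈ (kirillovKostant 𝔤).normalizer (shiftedElements χ₁ 𝔪₁) := by
  rw [mem_normalizer_shiftedElements]
  intro b hb
  have hab : ⁅b, a⁆ ∈ 𝔪₁ := lie_skew b a ▸ 𝔪₁.neg_mem (H.ideal a (H.second_le ha) b hb)
  have hχ : χ₁ ⁅b, a⁆ = 0 := by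
    rw [← lie_skew, map_neg, H.apply_lie (H.second_le ha) hb, neg_zero]
  rw [map_sub, hamVec_ι, Derivation.map_algebraMap, sub_zero]
  exact Ideal.subset_span ⟨⁅b, a⁆, hab, by rw [hχ, map_zero, sub_zero]⟩

/-- The class in the first W-algebra of an element of the normalizer. -/
def cls (X : SymmetricAlgebra ℂ 𝔤)
    (hX : X ∈ (kirillovKostant 𝔤).normalizer (shiftedElements χ₁ 𝔪₁)) : classicalW χ₁ 𝔪₁ :=
  ⟨modI χ₁ 𝔪₁ X, (modI_mem_classicalW H.first.character).2 hX⟩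

/-- The restriction of functions from the first W-algebra to the total zero fibre. -/
def toTotal :
    classicalW χ₁ 𝔪₁ →ₐ[ℂ] SymmetricAlgebra ℂ 𝔤 ⧸ Ideal.span (shiftedElements χ₂ 𝔪₂) :=
  (Ideal.Quotient.factorₐ ℂ H.span_le).comp (classicalW χ₁ 𝔪₁).val

theorem toTotal_mk (X : SymmetricAlgebra ℂ 𝔤) (hX : modI χ₁ 𝔪₁ X ∈ classicalW χ₁ 𝔪₁) :
    H.toTotal ⟨modI χ₁ 𝔪₁ X, hX⟩ = modI χ₂ 𝔪₂ X :=
  rfl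

theorem toTotal_eq_zero {w : classicalW χ₁ 𝔪₁}
    (hw : w ∈ Ideal.span (stageElements χ₁ χ₂ 𝔪₁ 𝔪₀)) : H.toTotal w = 0 := by
  suffices Ideal.span (stageElements χ₁ χ₂ 𝔪₁ 𝔪₀) ≤ RingHom.ker H.toTotal from this hw
  refine Ideal.span_le.2 ?_
  rintro ⟨w, hw⟩ ⟨a, ha, rfl⟩
  rw [SetLike.mem_coe, RingHom.mem_ker, toTotal_mk]
  exact Ideal.Quotient.eq_zero_iff_mem.2 (Ideal.subset_span ⟨a, H.second_le ha, rfl⟩)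

theorem exists_stage_approximation {X : SymmetricAlgebra ℂ 𝔤}
    (hX : X ∈ Ideal.span (shiftedElements χ₂ 𝔪₂)) :
    ∃ (Y : SymmetricAlgebra ℂ 𝔤)
      (hY : Y ∈ (kirillovKostant 𝔤).normalizer (shiftedElements χ₁ 𝔪₁)),
      H.cls Y hY ∈ Ideal.span (stageElements χ₁ χ₂ 𝔪₁ 𝔪₀) ∧
      X - Y ∈ Ideal.span (shiftedElements χ₁ 𝔪₁) ⊔
        Ideal.span (Set.range fun j => ι ℂ 𝔤 (x₁ j)) := by
  induction hX using Submodule.span_induction with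
  | mem t ht =>
    obtain ⟨a, ha, rfl⟩ := ht
    obtain ⟨b, hb, c, hc, rfl⟩ := H.exists_add ha
    refine ⟨_, H.generator_mem hc (χ₂ c), Ideal.subset_span ⟨c, hc, rfl⟩,
      Ideal.mem_sup_left (Ideal.subset_span ⟨b, hb, ?_⟩)⟩
    rw [H.agree b hb, map_add, map_add χ₂, map_add (algebraMap ℂ _)]
    ring
  | zero => exact ⟨0, zero_mem _, Ideal.zero_mem _, by rw [sub_zero]; exact Ideal.zero_mem _⟩
  | add X X' _ _ ih ih' =>
    obtain ⟨Y, hY, hYI, hXY⟩ := ih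
    obtain ⟨Y', hY', hYI', hXY'⟩ := ih'
    refine ⟨Y + Y', add_mem hY hY', Ideal.add_mem _ hYI hYI', ?_⟩
    rw [add_sub_add_comm]
    exact Ideal.add_mem _ hXY hXY'
  | smul Z X _ ih =>
    obtain ⟨Y, hY, hYI, hXY⟩ := ih
    obtain ⟨Z', hZ', hZZ'⟩ := H.first.exists_projection Z
    refine ⟨Z' * Y, mul_mem hZ' hY, Ideal.mul_mem_left _ (H.cls Z' hZ') hYI, ?_⟩
    have hsplit : Z • X - Z' * Y = Z * (X - Y) + Y * (Z - Z') := by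
      rw [smul_eq_mul]
      ring
    rw [hsplit]
    exact Ideal.add_mem _ (Ideal.mul_mem_left _ _ hXY)
      (Ideal.mul_mem_left _ _ (Ideal.mem_sup_right hZZ'))

theorem bracket_cls {X Y : SymmetricAlgebra ℂ 𝔤}
    (hX : X ∈ (kirillovKostant 𝔤).normalizer (shiftedElements χ₁ 𝔪₁))
    (hY : Y ∈ (kirillovKostant 𝔤).normalizer (shiftedElements χ₁ 𝔪₁)) :
    (classicalWPoisson χ₁ 𝔪₁).bracket (H.cls X hX) (H.cls Y hY) =
      H.cls ((kirillovKostant 𝔤).bracket X Y)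
        (PoissonStructure.bracket_mem_normalizer hX hY) :=
  Subtype.ext ((kirillovKostant 𝔤).reduced_bracket_mk (shiftedElements χ₁ 𝔪₁) hX rfl rfl)

/-- The map induced by restriction of functions on the quotient of the first W-algebra. -/
def stageToTotal :
    (classicalW χ₁ 𝔪₁ ⧸ Ideal.span (stageElements χ₁ χ₂ 𝔪₁ 𝔪₀)) →ₐ[ℂ]
      SymmetricAlgebra ℂ 𝔤 ⧸ Ideal.span (shiftedElements χ₂ 𝔪₂) :=
  Ideal.Quotient.liftₐ _ H.toTotal fun _ hw => H.toTotal_eq_zero hw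

theorem stageToTotal_mk (X : SymmetricAlgebra ℂ 𝔤) (hX : modI χ₁ 𝔪₁ X ∈ classicalW χ₁ 𝔪₁) :
    H.stageToTotal (modI₀ χ₁ χ₂ 𝔪₁ 𝔪₀ ⟨modI χ₁ 𝔪₁ X, hX⟩) = modI χ₂ 𝔪₂ X :=
  Ideal.Quotient.liftₐ_apply _ _ _ _

theorem stageToTotal_cls {X : SymmetricAlgebra ℂ 𝔤}
    (hX : X ∈ (kirillovKostant 𝔤).normalizer (shiftedElements χ₁ 𝔪₁)) :
    H.stageToTotal (modI₀ χ₁ χ₂ 𝔪₁ 𝔪₀ (H.cls X hX)) = modI χ₂ 𝔪₂ X :=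
  H.stageToTotal_mk X _

variable [FiniteDimensional ℂ 𝔤]

theorem cls_mem_span {X : SymmetricAlgebra ℂ 𝔤}
    (hX : X ∈ (kirillovKostant 𝔤).normalizer (shiftedElements χ₁ 𝔪₁))
    (hX₂ : X ∈ Ideal.span (shiftedElements χ₂ 𝔪₂)) :
    H.cls X hX ∈ Ideal.span (stageElements χ₁ χ₂ 𝔪₁ 𝔪₀) := by
  obtain ⟨Y, hY, hYI, hXY⟩ := H.exists_stage_approximation hX₂
  suffices hdiff : X - Y ∈ Ideal.span (shiftedElements χ₁ 𝔪₁) by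
    have hcls : H.cls X hX = H.cls Y hY := Subtype.ext (Ideal.Quotient.eq.2 hdiff)
    exact hcls ▸ hYI
  refine H.first.mem_span_of_forall_sliceSet (sub_mem hX hY) fun ξ hξ => ?_
  obtain ⟨a, ha, b, hb, hab⟩ := Submodule.mem_sup.1 hXY
  have hb₀ : evalAt ξ b = evalAt ξ 0 := evalAt_eq_of_sub_mem_span_ι hξ.2 (by rwa [sub_zero])
  rw [← hab, map_add, evalAt_eq_zero_of_mem_span hξ.1 ha, hb₀, map_zero, add_zero]

theorem exists_lift {X : SymmetricAlgebra ℂ 𝔤}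
    (hX : X ∈ (kirillovKostant 𝔤).normalizer (shiftedElements χ₂ 𝔪₂)) :
    ∃ Y ∈ (kirillovKostant 𝔤).normalizer (shiftedElements χ₁ 𝔪₁),
      X - Y ∈ Ideal.span (shiftedElements χ₂ 𝔪₂) := by
  obtain ⟨Y, hY, hXY⟩ := H.first.exists_projection X
  refine ⟨Y, hY, mem_span_shiftedElements.2 fun ξ hξ => ?_⟩
  have hξ₁ := H.zeroFibre_subset hξ
  obtain ⟨g, hg, hgξ⟩ := H.first.exists_unipotent_smul_mem_sliceSet hξ₁
  rw [map_sub, ← evalAt_smul_of_mem_normalizer H.first.character hY hg hξ₁,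
    ← evalAt_smul_of_mem_normalizer H.total.character hX (unipotentGroup_mono H.first_le hg) hξ,
    evalAt_eq_of_sub_mem_span_ι hgξ.2 hXY, sub_self]

theorem cls_mem_normalizer_iff {X : SymmetricAlgebra ℂ 𝔤}
    (hX : X ∈ (kirillovKostant 𝔤).normalizer (shiftedElements χ₁ 𝔪₁)) :
    H.cls X hX ∈ (classicalWPoisson χ₁ 𝔪₁).normalizer (stageElements χ₁ χ₂ 𝔪₁ 𝔪₀) ↔
      X ∈ (kirillovKostant 𝔤).normalizer (shiftedElements χ₂ 𝔪₂) := by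
  constructor
  · intro h
    rw [mem_normalizer_shiftedElements]
    intro a ha
    obtain ⟨b, hb, c, hc, rfl⟩ := H.exists_add ha
    rw [hamVec_add, Derivation.add_apply]
    refine Ideal.add_mem _ (H.span_le (mem_normalizer_shiftedElements.1 hX b hb)) ?_
    have hc₀ := h (H.cls _ (H.generator_mem hc (χ₂ c))) ⟨c, hc, rfl⟩
    rw [H.bracket_cls] at hc₀
    rw [← bracket_ι_sub c (χ₂ c) X]
    exact Ideal.Quotient.eq_zero_iff_mem.1 (H.toTotal_eq_zero hc₀)
  · rintro h ⟨w, hw⟩ ⟨c, hc, rfl⟩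
    change (classicalWPoisson χ₁ 𝔪₁).bracket (H.cls _ (H.generator_mem hc (χ₂ c))) _ ∈ _
    rw [H.bracket_cls]
    refine H.cls_mem_span _ ?_
    rw [bracket_ι_sub]
    exact mem_normalizer_shiftedElements.1 h c (H.second_le hc)

theorem exists_rep_stageW {a : classicalW χ₁ 𝔪₁ ⧸ Ideal.span (stageElements χ₁ χ₂ 𝔪₁ 𝔪₀)}
    (ha : a ∈ stageW χ₁ χ₂ 𝔪₁ 𝔪₀) :
    ∃ (X : SymmetricAlgebra ℂ 𝔤)
      (hX : X ∈ (kirillovKostant 𝔤).normalizer (shiftedElements χ₁ 𝔪₁)),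
      X ∈ (kirillovKostant 𝔤).normalizer (shiftedElements χ₂ 𝔪₂) ∧
      modI₀ χ₁ χ₂ 𝔪₁ 𝔪₀ (H.cls X hX) = a := by
  obtain ⟨⟨w, hw⟩, hwn, rfl⟩ := ha
  obtain ⟨X, rfl⟩ := Ideal.Quotient.mk_surjective w
  have hX := (modI_mem_classicalW H.first.character).1 hw
  exact ⟨X, hX, (H.cls_mem_normalizer_iff hX).1 hwn, rfl⟩

theorem stageToTotal_mem (a : stageW χ₁ χ₂ 𝔪₁ 𝔪₀) :
    (H.stageToTotal.comp (stageW χ₁ χ₂ 𝔪₁ 𝔪₀).val) a ∈ classicalW χ₂ 𝔪₂ := by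
  obtain ⟨a, ha⟩ := a
  obtain ⟨X, hX, hX₂, rfl⟩ := H.exists_rep_stageW ha
  exact (H.stageToTotal_cls hX).symm ▸ (modI_mem_classicalW H.total.character).2 hX₂

/-- The comparison map from the two-stage reduction to the one-stage reduction. -/
def comparison : stageW χ₁ χ₂ 𝔪₁ 𝔪₀ →ₐ[ℂ] classicalW χ₂ 𝔪₂ :=
  (H.stageToTotal.comp (stageW χ₁ χ₂ 𝔪₁ 𝔪₀).val).codRestrict _ H.stageToTotal_mem

theorem coe_comparison (a : stageW χ₁ χ₂ 𝔪₁ 𝔪₀) :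
    (H.comparison a : _ ⧸ Ideal.span (shiftedElements χ₂ 𝔪₂)) = H.stageToTotal a :=
  rfl

theorem comparison_injective : Function.Injective H.comparison := by
  rw [injective_iff_map_eq_zero]
  rintro ⟨a, ha⟩ h
  obtain ⟨X, hX, -, rfl⟩ := H.exists_rep_stageW ha
  have hX₂ : modI χ₂ 𝔪₂ X = 0 := (H.stageToTotal_cls hX).symm.trans (congrArg Subtype.val h)
  exact Subtype.ext (Ideal.Quotient.eq_zero_iff_mem.2
    (H.cls_mem_span hX (Ideal.Quotient.eq_zero_iff_mem.1 hX₂)))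

theorem comparison_surjective : Function.Surjective H.comparison := by
  rintro ⟨b, hb⟩
  obtain ⟨X, rfl⟩ := Ideal.Quotient.mk_surjective b
  have hX := (modI_mem_classicalW H.total.character).1 hb
  obtain ⟨Y, hY, hXY⟩ := H.exists_lift hX
  have hY₂ : Y ∈ (kirillovKostant 𝔤).normalizer (shiftedElements χ₂ 𝔪₂) :=
    sub_sub_cancel X Y ▸ sub_mem hX (span_le_normalizer H.total.character hXY)
  refine ⟨⟨modI₀ χ₁ χ₂ 𝔪₁ 𝔪₀ (H.cls Y hY), ⟨_, (H.cls_mem_normalizer_iff hY).2 hY₂, rfl⟩⟩,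
    Subtype.ext ?_⟩
  rw [coe_comparison, stageToTotal_cls]
  exact (Ideal.Quotient.eq.2 hXY).symm

theorem comparison_bracket_of_rep {a b : stageW χ₁ χ₂ 𝔪₁ 𝔪₀} {X Y : SymmetricAlgebra ℂ 𝔤}
    (hX : X ∈ (kirillovKostant 𝔤).normalizer (shiftedElements χ₁ 𝔪₁))
    (hY : Y ∈ (kirillovKostant 𝔤).normalizer (shiftedElements χ₁ 𝔪₁))
    (hX₂ : X ∈ (kirillovKostant 𝔤).normalizer (shiftedElements χ₂ 𝔪₂))
    (ha : modI₀ χ₁ χ₂ 𝔪₁ 𝔪₀ (H.cls X hX) = a) (hb : modI₀ χ₁ χ₂ 𝔪₁ 𝔪₀ (H.cls Y hY) = b) :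
    H.comparison ((stageWPoisson χ₁ χ₂ 𝔪₁ 𝔪₀).bracket a b) =
      (classicalWPoisson χ₂ 𝔪₂).bracket (H.comparison a) (H.comparison b) := by
  have hXa : modI χ₂ 𝔪₂ X = H.comparison a := by rw [coe_comparison, ← ha, stageToTotal_cls]
  have hYb : modI χ₂ 𝔪₂ Y = H.comparison b := by rw [coe_comparison, ← hb, stageToTotal_cls]
  have hstage : ((stageWPoisson χ₁ χ₂ 𝔪₁ 𝔪₀).bracket a b :
        _ ⧸ Ideal.span (stageElements χ₁ χ₂ 𝔪₁ 𝔪₀)) =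
      modI₀ χ₁ χ₂ 𝔪₁ 𝔪₀ ((classicalWPoisson χ₁ 𝔪₁).bracket (H.cls X hX) (H.cls Y hY)) :=
    (classicalWPoisson χ₁ 𝔪₁).reduced_bracket_mk (stageElements χ₁ χ₂ 𝔪₁ 𝔪₀)
      ((H.cls_mem_normalizer_iff hX).2 hX₂) ha hb
  have htotal : ((classicalWPoisson χ₂ 𝔪₂).bracket (H.comparison a) (H.comparison b) :
        _ ⧸ Ideal.span (shiftedElements χ₂ 𝔪₂)) =
      modI χ₂ 𝔪₂ ((kirillovKostant 𝔤).bracket X Y) :=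
    (kirillovKostant 𝔤).reduced_bracket_mk (shiftedElements χ₂ 𝔪₂) hX₂ hXa hYb
  apply Subtype.ext
  rw [coe_comparison, hstage, htotal, H.bracket_cls, stageToTotal_cls]

theorem comparison_bracket (a b : stageW χ₁ χ₂ 𝔪₁ 𝔪₀) :
    H.comparison ((stageWPoisson χ₁ χ₂ 𝔪₁ 𝔪₀).bracket a b) =
      (classicalWPoisson χ₂ 𝔪₂).bracket (H.comparison a) (H.comparison b) := by
  choose X hX hX₂ hcX using fun c : stageW χ₁ χ₂ 𝔪₁ 𝔪₀ => H.exists_rep_stageW c.2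
  exact H.comparison_bracket_of_rep (hX a) (hX b) (hX₂ a) (hcX a) (hcX b)

/-- The isomorphism `X ↦ X mod I₂` from the two-stage reduction to the one-stage reduction. -/
def stageAlgEquiv : stageW χ₁ χ₂ 𝔪₁ 𝔪₀ ≃ₐ[ℂ] classicalW χ₂ 𝔪₂ :=
  AlgEquiv.ofBijective H.comparison ⟨H.comparison_injective, H.comparison_surjective⟩

theorem stageAlgEquiv_bracket (a b : stageW χ₁ χ₂ 𝔪₁ 𝔪₀) :
    H.stageAlgEquiv ((stageWPoisson χ₁ χ₂ 𝔪₁ 𝔪₀).bracket a b) =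
      (classicalWPoisson χ₂ 𝔪₂).bracket (H.stageAlgEquiv a) (H.stageAlgEquiv b) :=
  H.comparison_bracket a b

theorem coe_stageAlgEquiv (X : SymmetricAlgebra ℂ 𝔤) (hX₁ : modI χ₁ 𝔪₁ X ∈ classicalW χ₁ 𝔪₁)
    (hX₀ : modI₀ χ₁ χ₂ 𝔪₁ 𝔪₀ ⟨modI χ₁ 𝔪₁ X, hX₁⟩ ∈ stageW χ₁ χ₂ 𝔪₁ 𝔪₀) :
    (H.stageAlgEquiv ⟨modI₀ χ₁ χ₂ 𝔪₁ 𝔪₀ ⟨modI χ₁ 𝔪₁ X, hX₁⟩, hX₀⟩ :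
      _ ⧸ Ideal.span (shiftedElements χ₂ 𝔪₂)) = modI χ₂ 𝔪₂ X :=
  H.stageToTotal_mk X hX₁

end TwoStage

end

/-! ### Reduction in two stages: geometry -/

/-- The map on the orbit space induced by a map that is constant on orbits. -/
def OrbitSpace.lift {G : Type*} [Group G] {X : Type*} [MulAction G X] {Z : Set X} {β : Type*}
    (f : Z → β) (h : ∀ z z' : Z, OrbitSpace.mk G z = OrbitSpace.mk G z' → f z = f z') :
    OrbitSpace G Z → β :=
  Quotient.lift f fun z z' hz => h z z' (Quotient.sound hz)

noncomputable section

variable {𝔤 : Type*} [LieRing 𝔤] [LieAlgebra ℂ 𝔤]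

namespace TwoStage

variable {χ₁ χ₂ : Dual ℂ 𝔤} {𝔪₁ 𝔪₂ 𝔪₀ : LieSubalgebra ℂ 𝔤} {d₁ d₂ : ℕ}
  {y₁ x₁ : Fin d₁ → 𝔤} {y₂ x₂ : Fin d₂ → 𝔤} (H : TwoStage χ₁ χ₂ 𝔪₁ 𝔪₂ 𝔪₀ y₁ x₁ y₂ x₂)

include H

theorem second_smul_mem {g : 𝔤 ≃ₗ[ℂ] 𝔤} (hg : g ∈ unipotentGroup 𝔪₀) {ξ : Dual ℂ 𝔤}
    (hξ : ξ ∈ zeroFibre χ₁ 𝔪₁) : g • ξ ∈ zeroFibre χ₁ 𝔪₁ :=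
  smul_mem_zeroFibre (fun a ha b hb => H.ideal a (H.second_le ha) b hb)
    (fun _ ha _ hb => H.apply_lie (H.second_le ha) hb) hg hξ

theorem mk_second_smul_eq {g : 𝔤 ≃ₗ[ℂ] 𝔤} (hg : g ∈ unipotentGroup 𝔪₀)
    {ξ ξ' : zeroFibre χ₁ 𝔪₁}
    (h : OrbitSpace.mk (unipotentGroup 𝔪₁) ξ = OrbitSpace.mk (unipotentGroup 𝔪₁) ξ') :
    OrbitSpace.mk (unipotentGroup 𝔪₁) ⟨g • (ξ : Dual ℂ 𝔤), H.second_smul_mem hg ξ.2⟩ =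
      OrbitSpace.mk (unipotentGroup 𝔪₁) ⟨g • (ξ' : Dual ℂ 𝔤), H.second_smul_mem hg ξ'.2⟩ := by
  obtain ⟨u, hu⟩ := OrbitSpace.mk_eq_mk.1 h
  refine OrbitSpace.mk_eq_mk.2 ⟨⟨g * u * g⁻¹,
    unipotentGroup_conj_mem (fun a ha b hb => H.ideal a (H.second_le ha) b hb) hg u.2⟩, ?_⟩
  change (g * u * g⁻¹) • g • (ξ' : Dual ℂ 𝔤) = g • (ξ : Dual ℂ 𝔤)
  rw [← hu, smul_smul, inv_mul_cancel_right, mul_smul]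
  rfl

/-- The action of the second group on the first reduction. -/
@[reducible]
def secondAction : MulAction (unipotentGroup 𝔪₀) (HamRed χ₁ 𝔪₁) where
  smul g := OrbitSpace.lift
    (fun ξ => OrbitSpace.mk (unipotentGroup 𝔪₁)
      ⟨(g : 𝔤 ≃ₗ[ℂ] 𝔤) • (ξ : Dual ℂ 𝔤), H.second_smul_mem g.2 ξ.2⟩)
    fun _ _ => H.mk_second_smul_eq g.2
  one_smul p := by
    obtain ⟨ξ, rfl⟩ := OrbitSpace.mk_surjective p
    exact congrArg (OrbitSpace.mk _) (Subtype.ext (one_smul _ (ξ : Dual ℂ 𝔤)))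
  mul_smul g g' p := by
    obtain ⟨ξ, rfl⟩ := OrbitSpace.mk_surjective p
    exact congrArg (OrbitSpace.mk _) (Subtype.ext
      (mul_smul (g : 𝔤 ≃ₗ[ℂ] 𝔤) (g' : 𝔤 ≃ₗ[ℂ] 𝔤) (ξ : Dual ℂ 𝔤)))

theorem momentMap_eq_of_mk_eq {ξ ξ' : zeroFibre χ₁ 𝔪₁}
    (h : OrbitSpace.mk (unipotentGroup 𝔪₁) ξ = OrbitSpace.mk (unipotentGroup 𝔪₁) ξ') :
    momentMap χ₂ 𝔪₀ ξ = momentMap χ₂ 𝔪₀ ξ' := by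
  obtain ⟨u, hu⟩ := OrbitSpace.mk_eq_mk.1 h
  have hlie : ∀ a ∈ 𝔪₁, ∀ b ∈ 𝔪₂.toSubmodule, ⁅a, b⁆ ∈ 𝔪₁ := fun a ha b hb => by
    rw [← lie_skew]
    exact 𝔪₁.neg_mem (H.ideal b hb a ha)
  ext a
  have hξ' : ((u⁻¹ : unipotentGroup 𝔪₁) : 𝔤 ≃ₗ[ℂ] 𝔤) (a : 𝔤) - a ∈
      LinearMap.ker (ξ' : Dual ℂ 𝔤) := by
    refine unipotentGroup_sub_apply_mem (W := 𝔪₂.toSubmodule)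
      (fun a ha b hb => H.first_le (hlie a ha b hb)) (fun a ha b hb => ?_) (u⁻¹).2
      (H.second_le a.2)
    rw [LinearMap.mem_ker, mem_zeroFibre.1 ξ'.2 _ (hlie a ha b hb), ← lie_skew, map_neg,
      H.apply_lie hb ha, neg_zero]
  rw [LinearMap.mem_ker, map_sub, sub_eq_zero] at hξ'
  change (ξ : Dual ℂ 𝔤) a - χ₂ a = (ξ' : Dual ℂ 𝔤) a - χ₂ a
  rw [← hξ', ← hu]
  rfl

/-- The moment map of the second stage. -/
def secondMoment : HamRed χ₁ 𝔪₁ → Dual ℂ 𝔪₀ :=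
  OrbitSpace.lift (fun ξ => momentMap χ₂ 𝔪₀ ξ) fun _ _ => H.momentMap_eq_of_mk_eq

theorem mk_mem_secondFibre (ξ : zeroFibre χ₁ 𝔪₁) :
    OrbitSpace.mk (unipotentGroup 𝔪₁) ξ ∈ H.secondMoment ⁻¹' {0} ↔
      (ξ : Dual ℂ 𝔤) ∈ zeroFibre χ₂ 𝔪₂ := by
  rw [H.mem_zeroFibre_iff]
  change (ξ : Dual ℂ 𝔤) ∈ zeroFibre χ₂ 𝔪₀ ↔ _
  rw [mem_zeroFibre]
  exact ⟨fun h => ⟨ξ.2, h⟩, fun h => h.2⟩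

/-- The class in the fibre of the second moment map of a point of the total zero fibre. -/
def fibrePoint (ξ : zeroFibre χ₂ 𝔪₂) : (H.secondMoment ⁻¹' {0} : Set (HamRed χ₁ 𝔪₁)) :=
  ⟨OrbitSpace.mk (unipotentGroup 𝔪₁) ⟨ξ, H.zeroFibre_subset ξ.2⟩,
    (H.mk_mem_secondFibre _).2 ξ.2⟩

theorem fibrePoint_surjective : Function.Surjective H.fibrePoint := by
  rintro ⟨p, hp⟩
  obtain ⟨ξ, rfl⟩ := OrbitSpace.mk_surjective p
  exact ⟨⟨ξ, (H.mk_mem_secondFibre ξ).1 hp⟩, rfl⟩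

theorem second_smul_mem_secondFibre (g : unipotentGroup 𝔪₀) {p : HamRed χ₁ 𝔪₁}
    (hp : p ∈ H.secondMoment ⁻¹' {0}) :
    letI := H.secondAction
    g • p ∈ H.secondMoment ⁻¹' {0} := by
  obtain ⟨ξ, rfl⟩ := OrbitSpace.mk_surjective p
  exact (H.mk_mem_secondFibre ⟨(g : 𝔤 ≃ₗ[ℂ] 𝔤) • (ξ : Dual ℂ 𝔤), H.second_smul_mem g.2 ξ.2⟩).2
    (H.total.smul_mem (unipotentGroup_mono H.second_le g.2) ((H.mk_mem_secondFibre ξ).1 hp))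

/-- The orbit space of the second stage, the reduction of the first reduction by `𝔪₀`. -/
abbrev SecondRed : Type _ :=
  letI := H.secondAction
  OrbitSpace (unipotentGroup 𝔪₀) (H.secondMoment ⁻¹' {0})

/-- The class in the second reduction of a point of the total zero fibre. -/
def secondMk (ξ : zeroFibre χ₂ 𝔪₂) : H.SecondRed :=
  letI := H.secondAction
  OrbitSpace.mk (unipotentGroup 𝔪₀) (H.fibrePoint ξ)

theorem secondMk_surjective : Function.Surjective H.secondMk :=
  letI := H.secondAction
  OrbitSpace.mk_surjective.comp H.fibrePoint_surjective

theorem exists_smul_of_secondMk_eq {ξ ξ' : zeroFibre χ₂ 𝔪₂} (h : H.secondMk ξ = H.secondMk ξ') :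
    ∃ g ∈ unipotentGroup 𝔪₂, g • (ξ' : Dual ℂ 𝔤) = ξ := by
  let _ := H.secondAction
  obtain ⟨g, hg⟩ := OrbitSpace.mk_eq_mk.1 h
  obtain ⟨u, hu⟩ := OrbitSpace.mk_eq_mk.1 hg
  refine ⟨(u : 𝔤 ≃ₗ[ℂ] 𝔤)⁻¹ * g, mul_mem (inv_mem (unipotentGroup_mono H.first_le u.2))
    (unipotentGroup_mono H.second_le g.2), ?_⟩
  rw [mul_smul, inv_smul_eq_iff]
  exact hu.symm

theorem secondMk_smul_first {ξ ξ' : zeroFibre χ₂ 𝔪₂} {g : 𝔤 ≃ₗ[ℂ] 𝔤}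
    (hg : g ∈ unipotentGroup 𝔪₁) (h : g • (ξ' : Dual ℂ 𝔤) = ξ) : H.secondMk ξ = H.secondMk ξ' :=
  letI := H.secondAction
  congrArg (OrbitSpace.mk (unipotentGroup 𝔪₀))
    (Subtype.ext (OrbitSpace.mk_eq_mk.2 ⟨⟨g, hg⟩, h⟩))

theorem secondMk_smul_second {ξ ξ' : zeroFibre χ₂ 𝔪₂} {g : 𝔤 ≃ₗ[ℂ] 𝔤}
    (hg : g ∈ unipotentGroup 𝔪₀) (h : g • (ξ' : Dual ℂ 𝔤) = ξ) : H.secondMk ξ = H.secondMk ξ' :=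
  letI := H.secondAction
  OrbitSpace.mk_eq_mk.2 ⟨⟨g, hg⟩, congrArg (OrbitSpace.mk (unipotentGroup 𝔪₁)) (Subtype.ext h)⟩

theorem sup_unipotentGroup_le :
    unipotentGroup 𝔪₁ ⊔ unipotentGroup 𝔪₀ ≤ unipotentGroup 𝔪₂ :=
  sup_le (unipotentGroup_mono H.first_le) (unipotentGroup_mono H.second_le)

theorem secondMk_smul_sup {g : 𝔤 ≃ₗ[ℂ] 𝔤} (hg : g ∈ unipotentGroup 𝔪₁ ⊔ unipotentGroup 𝔪₀)
    (ξ ξ' : zeroFibre χ₂ 𝔪₂) (h : g • (ξ' : Dual ℂ 𝔤) = ξ) : H.secondMk ξ = H.secondMk ξ' := by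
  have hle := H.sup_unipotentGroup_le
  rw [Subgroup.sup_eq_closure] at hg hle
  induction hg using Subgroup.closure_induction generalizing ξ ξ' with
  | mem g hg =>
    rcases hg with hg | hg
    · exact H.secondMk_smul_first hg h
    · exact H.secondMk_smul_second hg h
  | one => rw [Subtype.ext ((one_smul _ (ξ' : Dual ℂ 𝔤)).symm.trans h)]
  | mul g g' _ hg' ih ih' =>
    have hξ' : g' • (ξ' : Dual ℂ 𝔤) ∈ zeroFibre χ₂ 𝔪₂ := H.total.smul_mem (hle hg') ξ'.2
    rw [mul_smul] at h
    exact (ih ξ ⟨_, hξ'⟩ h).trans (ih' ⟨_, hξ'⟩ ξ' rfl)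
  | inv g _ ih => exact (ih ξ' ξ (by rw [← h, smul_inv_smul])).symm

theorem exists_mem_sup_smul_mem_sliceSet {ξ : Dual ℂ 𝔤} (hξ : ξ ∈ zeroFibre χ₂ 𝔪₂) :
    ∃ g ∈ unipotentGroup 𝔪₁ ⊔ unipotentGroup 𝔪₀, g • ξ ∈ sliceSet χ₂ 𝔪₂ x₂ :=
  H.total.exists_smul_mem_sliceSet H.sup_unipotentGroup_le (fun i => (H.adapted i).elim
    (fun h => ⟨𝔪₁, h, le_sup_left⟩) (fun h => ⟨𝔪₀, h, le_sup_right⟩)) hξ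

theorem secondMk_eq_iff {ξ ξ' : zeroFibre χ₂ 𝔪₂} : H.secondMk ξ = H.secondMk ξ' ↔
    OrbitSpace.mk (unipotentGroup 𝔪₂) ξ = OrbitSpace.mk (unipotentGroup 𝔪₂) ξ' := by
  constructor
  · intro h
    obtain ⟨g, hg, h⟩ := H.exists_smul_of_secondMk_eq h
    exact OrbitSpace.mk_eq_mk.2 ⟨⟨g, hg⟩, h⟩
  · intro h
    obtain ⟨g, hg⟩ := OrbitSpace.mk_eq_mk.1 h
    obtain ⟨u, hu, huξ⟩ := H.exists_mem_sup_smul_mem_sliceSet ξ.2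
    obtain ⟨u', hu', huξ'⟩ := H.exists_mem_sup_smul_mem_sliceSet ξ'.2
    have hslice : u' • (ξ' : Dual ℂ 𝔤) = u • (ξ : Dual ℂ 𝔤) := by
      refine H.total.eq_of_smul_eq huξ' huξ (g := u * g * u'⁻¹) (mul_mem (mul_mem
        (H.sup_unipotentGroup_le hu) g.2) (inv_mem (H.sup_unipotentGroup_le hu'))) ?_
      rw [smul_smul, inv_mul_cancel_right, mul_smul, ← hg]
      rfl
    rw [← H.secondMk_smul_sup hu ⟨_, huξ.1⟩ ξ rfl, H.secondMk_smul_sup hu' ⟨_, huξ.1⟩ ξ' hslice]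

/-- The identification of the one-stage reduction with the two-stage reduction. -/
def redEquiv : HamRed χ₂ 𝔪₂ ≃ H.SecondRed :=
  Equiv.ofBijective
    (OrbitSpace.lift H.secondMk fun _ _ => H.secondMk_eq_iff.2) <| by
    constructor
    · intro p q h
      obtain ⟨ξ, rfl⟩ := OrbitSpace.mk_surjective p
      obtain ⟨ξ', rfl⟩ := OrbitSpace.mk_surjective q
      exact H.secondMk_eq_iff.1 h
    · intro p
      obtain ⟨ξ, rfl⟩ := H.secondMk_surjective p
      exact ⟨OrbitSpace.mk _ ξ, rfl⟩

/-- The identification of the slice with the two-stage reduction. -/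
def sliceEquiv : sliceSet χ₂ 𝔪₂ x₂ ≃ H.SecondRed :=
  H.total.sliceEquiv.trans H.redEquiv

/-- The regular functions on the two-stage reduction. -/
abbrev secondFunctions : Subalgebra ℂ (H.SecondRed → ℂ) :=
  letI := H.secondAction
  quotientFunctions (unipotentGroup 𝔪₀)
    (restrictFunctions (hamRedFunctions χ₁ 𝔪₁) (H.secondMoment ⁻¹' {0}))

theorem mem_secondFunctions {φ : H.SecondRed → ℂ} :
    φ ∈ H.secondFunctions ↔ ∃ ψ ∈ hamRedFunctions χ₁ 𝔪₁,
      ∀ ξ : zeroFibre χ₂ 𝔪₂, φ (H.secondMk ξ) = ψ (H.fibrePoint ξ : HamRed χ₁ 𝔪₁) := by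
  constructor
  · rintro ⟨ψ, hψ, h⟩
    exact ⟨ψ, hψ, fun ξ => (congrFun h (H.fibrePoint ξ)).symm⟩
  · rintro ⟨ψ, hψ, h⟩
    refine ⟨ψ, hψ, funext fun p => ?_⟩
    obtain ⟨ξ, rfl⟩ := H.fibrePoint_surjective p
    exact (h ξ).symm

theorem comp_redEquiv_mem {φ : H.SecondRed → ℂ} (hφ : φ ∈ H.secondFunctions) :
    φ ∘ H.redEquiv ∈ hamRedFunctions χ₂ 𝔪₂ := by
  obtain ⟨ψ, hψ, h⟩ := H.mem_secondFunctions.1 hφ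
  obtain ⟨X, hX⟩ := mem_polyFunctions.1 hψ
  exact mem_polyFunctions.2 ⟨X, fun ξ => (h ξ).trans (hX ⟨ξ, H.zeroFibre_subset ξ.2⟩)⟩

variable [FiniteDimensional ℂ 𝔤]

/-- The function extends invariantly to `μ₁⁻¹(0)` because each element of the W-algebra of `𝔪₂` has
a representative in the normalizer of both ideals. -/
theorem mem_secondFunctions_of_comp {φ : H.SecondRed → ℂ}
    (hφ : φ ∘ H.redEquiv ∈ hamRedFunctions χ₂ 𝔪₂) : φ ∈ H.secondFunctions := by
  obtain ⟨⟨w, hw⟩, hwφ⟩ := H.total.hamRedAlgEquiv.surjective ⟨_, hφ⟩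
  obtain ⟨X, rfl⟩ := Ideal.Quotient.mk_surjective w
  obtain ⟨Y, hY, hXY⟩ := H.exists_lift ((modI_mem_classicalW H.total.character).1 hw)
  have hYW : modI χ₁ 𝔪₁ Y ∈ classicalW χ₁ 𝔪₁ := (modI_mem_classicalW H.first.character).2 hY
  refine H.mem_secondFunctions.2 ⟨_, (H.first.hamRedAlgEquiv ⟨_, hYW⟩).2, fun ξ => ?_⟩
  have hXYξ := evalAt_eq_zero_of_mem_span ξ.2 hXY
  rw [map_sub, sub_eq_zero] at hXYξ
  calc φ (H.secondMk ξ) =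
        (H.total.hamRedAlgEquiv ⟨modI χ₂ 𝔪₂ X, hw⟩ : HamRed χ₂ 𝔪₂ → ℂ) (OrbitSpace.mk _ ξ) :=
      (congrFun (congrArg Subtype.val hwφ) (OrbitSpace.mk _ ξ)).symm
    _ = evalAt (ξ : Dual ℂ 𝔤) Y := by rw [H.total.hamRedAlgEquiv_apply, hXYξ]
    _ = (H.first.hamRedAlgEquiv ⟨_, hYW⟩ : HamRed χ₁ 𝔪₁ → ℂ) (H.fibrePoint ξ : HamRed χ₁ 𝔪₁) :=
      (H.first.hamRedAlgEquiv_apply Y hYW ⟨ξ, H.zeroFibre_subset ξ.2⟩).symm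

theorem mem_secondFunctions_iff (φ : H.SecondRed → ℂ) :
    φ ∈ H.secondFunctions ↔ φ ∘ H.redEquiv ∈ hamRedFunctions χ₂ 𝔪₂ :=
  ⟨H.comp_redEquiv_mem, H.mem_secondFunctions_of_comp⟩

theorem isAffineVariety_secondFunctions : IsAffineVariety H.secondFunctions :=
  H.total.hasGeometricQuotient.affine.of_equiv H.redEquiv H.mem_secondFunctions_iff

theorem second_hasGeometricQuotient :
    letI := H.secondAction
    HasGeometricQuotient (unipotentGroup 𝔪₀) (H.secondMoment ⁻¹' {0})
      (restrictFunctions (hamRedFunctions χ₁ 𝔪₁) (H.secondMoment ⁻¹' {0})) := by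
  let _ := H.secondAction
  let point (ξ : sliceSet χ₂ 𝔪₂ x₂) : (H.secondMoment ⁻¹' {0} : Set (HamRed χ₁ 𝔪₁)) :=
    H.fibrePoint ⟨ξ, ξ.2.1⟩
  refine hasGeometricQuotient_of_section (fun g p hp => H.second_smul_mem_secondFibre g hp)
    H.isAffineVariety_secondFunctions (fun p => point (H.sliceEquiv.symm p))
    (fun p => H.sliceEquiv.apply_symm_apply p) ?_
  rintro _ ⟨ψ, hψ, rfl⟩
  obtain ⟨X, hX⟩ := mem_polyFunctions.1 hψ
  refine (H.mem_secondFunctions_iff _).2 (H.total.mem_hamRedFunctions_iff.2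
    (mem_polyFunctions.2 ⟨X, fun ξ => ?_⟩))
  calc ψ (point (H.sliceEquiv.symm (H.sliceEquiv ξ))) = ψ (point ξ) := by
        rw [Equiv.symm_apply_apply]
    _ = evalAt (ξ : Dual ℂ 𝔤) X := hX ⟨ξ, H.zeroFibre_subset ξ.2.1⟩

/-- The identification of the two-stage reduction of the symmetric algebra with the coordinate ring
of the two-stage reduction. -/
def secondAlgEquiv : stageW χ₁ χ₂ 𝔪₁ 𝔪₀ ≃ₐ[ℂ] H.secondFunctions :=
  (H.stageAlgEquiv.trans H.total.hamRedAlgEquiv).trans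
    (regularFunctionsEquiv H.redEquiv H.mem_secondFunctions_iff)

theorem secondAlgEquiv_redEquiv (a : stageW χ₁ χ₂ 𝔪₁ 𝔪₀) (p : HamRed χ₂ 𝔪₂) :
    (H.secondAlgEquiv a : _ → ℂ) (H.redEquiv p) =
      (H.total.hamRedAlgEquiv (H.stageAlgEquiv a) : _ → ℂ) p :=
  regularFunctionsEquiv_apply H.redEquiv H.mem_secondFunctions_iff _ p

theorem secondAlgEquiv_sliceEquiv (a : stageW χ₁ χ₂ 𝔪₁ 𝔪₀) (ξ : sliceSet χ₂ 𝔪₂ x₂) :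
    (H.secondAlgEquiv a : _ → ℂ) (H.sliceEquiv ξ) =
      (H.total.sliceAlgEquiv (H.stageAlgEquiv a) : _ → ℂ) ξ := by
  rw [sliceEquiv, Equiv.trans_apply, secondAlgEquiv_redEquiv,
    SliceFamily.hamRedAlgEquiv_sliceEquiv]

theorem secondAlgEquiv_apply (w : classicalW χ₁ 𝔪₁)
    (hw : modI₀ χ₁ χ₂ 𝔪₁ 𝔪₀ w ∈ stageW χ₁ χ₂ 𝔪₁ 𝔪₀)
    (p : (H.secondMoment ⁻¹' {0} : Set (HamRed χ₁ 𝔪₁))) :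
    letI := H.secondAction
    (H.secondAlgEquiv ⟨modI₀ χ₁ χ₂ 𝔪₁ 𝔪₀ w, hw⟩ : _ → ℂ)
        (OrbitSpace.mk (unipotentGroup 𝔪₀) p) =
      (H.first.hamRedAlgEquiv w : HamRed χ₁ 𝔪₁ → ℂ) (p : HamRed χ₁ 𝔪₁) := by
  obtain ⟨w, hw₁⟩ := w
  obtain ⟨X, rfl⟩ := Ideal.Quotient.mk_surjective w
  obtain ⟨ξ, rfl⟩ := H.fibrePoint_surjective p
  have hX₂ : modI χ₂ 𝔪₂ X ∈ classicalW χ₂ 𝔪₂ :=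
    H.coe_stageAlgEquiv X hw₁ hw ▸ (H.stageAlgEquiv _).2
  have hX : H.stageAlgEquiv ⟨modI₀ χ₁ χ₂ 𝔪₁ 𝔪₀ ⟨modI χ₁ 𝔪₁ X, hw₁⟩, hw⟩ =
      ⟨modI χ₂ 𝔪₂ X, hX₂⟩ := Subtype.ext (H.coe_stageAlgEquiv X hw₁ hw)
  refine (H.secondAlgEquiv_redEquiv _ (OrbitSpace.mk _ ξ)).trans ?_
  rw [hX, H.total.hamRedAlgEquiv_apply]
  exact (H.first.hamRedAlgEquiv_apply X hw₁ ⟨ξ, H.zeroFibre_subset ξ.2⟩).symm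

theorem isPoissonIso_redEquiv :
    IsPoissonIso ((classicalWPoisson χ₂ 𝔪₂).transport H.total.hamRedAlgEquiv)
      ((stageWPoisson χ₁ χ₂ 𝔪₁ 𝔪₀).transport H.secondAlgEquiv) H.redEquiv :=
  isPoissonIso_transport H.stageAlgEquiv_bracket H.secondAlgEquiv_redEquiv

theorem isPoissonIso_sliceEquiv :
    IsPoissonIso ((classicalWPoisson χ₂ 𝔪₂).transport H.total.sliceAlgEquiv)
      ((stageWPoisson χ₁ χ₂ 𝔪₁ 𝔪₀).transport H.secondAlgEquiv) H.sliceEquiv :=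
  isPoissonIso_transport H.stageAlgEquiv_bracket H.secondAlgEquiv_sliceEquiv

end TwoStage

end

/-! ### Gradings -/

noncomputable section Gradings

section Projection

variable {ι R M : Type*} [DecidableEq ι] [Semiring R] [AddCommMonoid M] [Module R M]
  {Γ : ι → Submodule R M} (h : DirectSum.IsInternal Γ)

/-- The projection of a graded module to its component of degree `k`. -/
def gradeProj (k : ι) : M →ₗ[R] M :=
  letI := h.chooseDecomposition
  (Γ k).subtype ∘ₗ DirectSum.component R ι (fun i => Γ i) k ∘ₗ
    (DirectSum.decomposeLinearEquiv Γ).toLinearMap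

theorem gradeProj_mem (k : ι) (x : M) : gradeProj h k x ∈ Γ k :=
  Subtype.property _

theorem gradeProj_same {k : ι} {x : M} (hx : x ∈ Γ k) : gradeProj h k x = x :=
  letI := h.chooseDecomposition
  DirectSum.decompose_of_mem_same Γ hx

theorem gradeProj_ne {j k : ι} (hjk : j ≠ k) {x : M} (hx : x ∈ Γ j) : gradeProj h k x = 0 :=
  letI := h.chooseDecomposition
  DirectSum.decompose_of_mem_ne Γ hx hjk

theorem mem_of_gradeProj_mem {V : Submodule R M} {v : M} (hv : ∀ k, gradeProj h k v ∈ V) :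
    v ∈ V := by
  classical
  let := h.chooseDecomposition
  rw [← DirectSum.sum_support_decompose Γ v]
  exact V.sum_mem fun k _ => hv k

theorem eq_zero_of_gradeProj {v : M} (hv : ∀ k, gradeProj h k v = 0) : v = 0 :=
  (Submodule.mem_bot R).1 (mem_of_gradeProj_mem h fun k => (Submodule.mem_bot R).2 (hv k))

include h in
theorem linearMap_ext_of_grading {N : Type*} [AddCommMonoid N] [Module R N] {S T : M →ₗ[R] N}
    (hST : ∀ k, ∀ x ∈ Γ k, S x = T x) : S = T :=
  LinearMap.ext fun v => mem_of_gradeProj_mem h (V := LinearMap.eqLocus S T) fun k =>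
    hST k _ (gradeProj_mem h k v)

theorem span_homogeneous_eq {V : Submodule R M} (hV : ∀ k, ∀ v ∈ V, gradeProj h k v ∈ V) :
    Submodule.span R {v | v ∈ V ∧ ∃ k, v ∈ Γ k} = V :=
  le_antisymm (Submodule.span_le.2 fun _ hv => hv.1) fun v hv =>
    mem_of_gradeProj_mem h fun k => Submodule.subset_span ⟨hV k v hv, k, gradeProj_mem h k v⟩

theorem gradeProj_map {ι : Type*} [DecidableEq ι] [Add ι] [IsLeftCancelAdd ι]
    {Γ : ι → Submodule R M} (h : DirectSum.IsInternal Γ) {T : M →ₗ[R] M} {d : ι}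
    (hT : ∀ k, ∀ x ∈ Γ k, T x ∈ Γ (d + k)) (k : ι) (v : M) :
    gradeProj h (d + k) (T v) = T (gradeProj h k v) := by
  suffices gradeProj h (d + k) ∘ₗ T = T ∘ₗ gradeProj h k from LinearMap.congr_fun this v
  refine linearMap_ext_of_grading h fun j x hx => ?_
  rw [LinearMap.comp_apply, LinearMap.comp_apply]
  obtain rfl | hjk := eq_or_ne j k
  · rw [gradeProj_same h hx, gradeProj_same h (hT j x hx)]
  · rw [gradeProj_ne h hjk hx, gradeProj_ne h (fun e => hjk (add_left_cancel e)) (hT j x hx),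
      map_zero]

end Projection

section Homogeneous

variable {ι R M N : Type*} [DecidableEq ι] [CommSemiring R] [AddCommMonoid M] [Module R M]
  [AddCommMonoid N] [Module R N] {Γ : ι → Submodule R M} (h : DirectSum.IsInternal Γ)

theorem apply_eq_zero_of_homogeneous {V : Submodule R M}
    (hV : ∀ k, ∀ v ∈ V, gradeProj h k v ∈ V) {T : M →ₗ[R] M →ₗ[R] N}
    (hT : ∀ k l, ∀ a ∈ V, a ∈ Γ k → ∀ b ∈ V, b ∈ Γ l → T a b = 0) {a b : M} (ha : a ∈ V)
    (hb : b ∈ V) : T a b = 0 :=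
  mem_of_gradeProj_mem h (V := LinearMap.ker (T.flip b)) fun k =>
    mem_of_gradeProj_mem h (V := LinearMap.ker (T (gradeProj h k a))) fun l =>
      hT k l _ (hV k a ha) (gradeProj_mem h k a) _ (hV l b hb) (gradeProj_mem h l b)

include h in
theorem mem_span_image_Ioi_of_lt [Preorder ι] {κ : Type*} [LinearOrder κ] {y : κ → M} {k : κ → ι}
    (hk : Monotone k) (hy : ∀ i, y i ∈ Γ (k i)) {v : M}
    (hv : v ∈ Submodule.span R (Set.range y)) {i : κ} {l : ι} (hil : k i < l) (hvl : v ∈ Γ l) :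
    v ∈ Submodule.span R (y '' Set.Ioi i) := by
  suffices Submodule.span R (Set.range y) ≤
      (Submodule.span R (y '' Set.Ioi i)).comap (gradeProj h l) by
    have hmem := this hv
    rwa [Submodule.mem_comap, gradeProj_same h hvl] at hmem
  rw [Submodule.span_le]
  rintro _ ⟨j, rfl⟩
  rw [SetLike.mem_coe, Submodule.mem_comap]
  obtain hj | hj := eq_or_ne (k j) l
  · rw [gradeProj_same h (hj ▸ hy j)]
    have hij : i < j := lt_of_not_ge fun hji => (hj ▸ hil).not_ge (hk hji)
    exact Submodule.subset_span ⟨j, hij, rfl⟩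
  · rw [gradeProj_ne h hj (hy j)]
    exact zero_mem _

theorem apply_gradeProj_neg {ι : Type*} [DecidableEq ι] [AddGroup ι] {Γ : ι → Submodule R M}
    (h : DirectSum.IsInternal Γ) {B : LinearMap.BilinForm R M}
    (horth : ∀ i j, i + j ≠ 0 → ∀ x ∈ Γ i, ∀ y ∈ Γ j, B x y = 0) {k : ι} {u : M}
    (hu : u ∈ Γ k) (v : M) : B u (gradeProj h (-k) v) = B u v := by
  suffices B u ∘ₗ gradeProj h (-k) = B u from LinearMap.congr_fun this v
  refine linearMap_ext_of_grading h fun l x hx => ?_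
  rw [LinearMap.comp_apply]
  obtain rfl | hl := eq_or_ne l (-k)
  · rw [gradeProj_same h hx]
  · rw [gradeProj_ne h hl hx, map_zero,
      horth k l (fun e => hl (eq_neg_of_add_eq_zero_right e)) u hu x hx]

theorem gradeProj_apply_eq {ι : Type*} [DecidableEq ι] [AddGroup ι] {Γ : ι → Submodule R M}
    (h : DirectSum.IsInternal Γ) {B : LinearMap.BilinForm R M}
    (horth : ∀ i j, i + j ≠ 0 → ∀ x ∈ Γ i, ∀ y ∈ Γ j, B x y = 0) (k : ι) (u v : M) :
    B (gradeProj h k u) v = B u (gradeProj h (-k) v) := by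
  suffices LinearMap.flip B v ∘ₗ gradeProj h k = LinearMap.flip B (gradeProj h (-k) v) from
    LinearMap.congr_fun this u
  refine linearMap_ext_of_grading h fun l x hx => ?_
  rw [LinearMap.comp_apply, LinearMap.flip_apply, LinearMap.flip_apply]
  obtain rfl | hl := eq_or_ne l k
  · rw [gradeProj_same h hx, apply_gradeProj_neg h horth hx]
  · rw [gradeProj_ne h hl hx, map_zero, LinearMap.zero_apply,
      horth l (-k) (fun e => hl (add_neg_eq_zero.1 e)) x hx _ (gradeProj_mem h (-k) v)]

end Homogeneous

section IntGrading

variable {R M : Type*} [Ring R] [AddCommGroup M] [Module R M] [IsNoetherian R M]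
  {Γ : ℤ → Submodule R M} (h : DirectSum.IsInternal Γ)

include h

theorem exists_grade_bound : ∃ K : ℕ, ∀ k : ℤ, (K : ℤ) < |k| → Γ k = ⊥ := by
  have hfin : {k | Γ k ≠ ⊥}.Finite :=
    WellFoundedGT.finite_ne_bot_of_iSupIndep h.submodule_iSupIndep
  refine ⟨hfin.toFinset.sup Int.natAbs, fun k hk => ?_⟩
  by_contra hne
  have hle := Finset.le_sup (f := Int.natAbs) (hfin.mem_toFinset.2 hne)
  rw [Int.abs_eq_natAbs] at hk
  omega

theorem isNilpotent_of_degree_pos {T : Module.End R M} {d : ℤ} (hd : 0 < d)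
    (hT : ∀ k, ∀ x ∈ Γ k, T x ∈ Γ (d + k)) : IsNilpotent T := by
  obtain ⟨K, hK⟩ := exists_grade_bound h
  have hpow : ∀ (n : ℕ) (k : ℤ), ∀ x ∈ Γ k, (T ^ n) x ∈ Γ (n * d + k) := by
    intro n
    induction n with
    | zero => intro k x hx; simpa using hx
    | succ n ih =>
      intro k x hx
      rw [pow_succ', Module.End.mul_apply,
        show ((n + 1 : ℕ) : ℤ) * d + k = d + (n * d + k) by push_cast; ring]
      exact hT _ _ (ih k x hx)
  refine ⟨2 * K + 1, linearMap_ext_of_grading h fun k x hx => ?_⟩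
  rw [LinearMap.zero_apply]
  by_cases hk : (K : ℤ) < |k|
  · rw [hK k hk, Submodule.mem_bot] at hx
    rw [hx, map_zero]
  · have hlarge : (K : ℤ) < |((2 * K + 1 : ℕ) : ℤ) * d + k| := by
      rw [not_lt, abs_le] at hk
      refine lt_of_lt_of_le ?_ (le_abs_self _)
      push_cast
      nlinarith
    have hmem := hpow (2 * K + 1) k x hx
    rwa [hK _ hlarge, Submodule.mem_bot] at hmem

end IntGrading

section Families

variable {ι K V : Type*} [Field K] [AddCommGroup V] [Module K V]
  {Γ : ι → Submodule K V}

/-- The vectors `y i`, homogeneous of degrees `k i`, form a basis of the subspace `W` ordered by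
degree. -/
structure IsHomogeneousBasis [Preorder ι] (Γ : ι → Submodule K V) (W : Submodule K V) {d : ℕ}
    (y : Fin d → V) (k : Fin d → ι) : Prop where
  monotone : Monotone k
  mem : ∀ i, y i ∈ Γ (k i)
  linearIndependent : LinearIndependent K y
  span_eq : Submodule.span K (Set.range y) = W

theorem IsHomogeneousBasis.mem_subspace [Preorder ι] {W : Submodule K V} {d : ℕ} {y : Fin d → V}
    {k : Fin d → ι} (hy : IsHomogeneousBasis Γ W y k) (i : Fin d) : y i ∈ W :=
  hy.span_eq ▸ Submodule.subset_span ⟨i, rfl⟩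

theorem IsHomogeneousBasis.linearIndependent_map [Preorder ι] {W : Submodule K V} {d : ℕ}
    {y : Fin d → V} {k : Fin d → ι} (hy : IsHomogeneousBasis Γ W y k) {N : Type*}
    [AddCommGroup N] [Module K N] {T : V →ₗ[K] N} (hT : ∀ v ∈ W, T v = 0 → v = 0) :
    LinearIndependent K fun i => T (y i) :=
  hy.linearIndependent.map (by rwa [hy.span_eq, Submodule.disjoint_def])

theorem exists_isHomogeneousBasis [FiniteDimensional K V] [LinearOrder ι] {S : Set V}
    (hS : ∀ v ∈ S, ∃ k, v ∈ Γ k) :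
    ∃ (d : ℕ) (y : Fin d → V) (k : Fin d → ι),
      IsHomogeneousBasis Γ (Submodule.span K S) y k ∧ ∀ i, y i ∈ S := by
  obtain ⟨b, hbS, hspan, hli⟩ := exists_linearIndependent K S
  have : Finite b := hli.finite
  have : Fintype b := Fintype.ofFinite b
  choose deg hdeg using hS
  let ε := (Fintype.equivFin b).symm
  let k₀ : Fin (Fintype.card b) → ι := fun i => deg (ε i) (hbS (ε i).2)
  let σ := Tuple.sort k₀
  have hrange : Set.range (fun i => (ε (σ i) : V)) = b := by
    rw [show (fun i => (ε (σ i) : V)) = Subtype.val ∘ σ.trans ε from rfl,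
      (σ.trans ε).surjective.range_comp, Subtype.range_coe]
  exact ⟨_, fun i => ε (σ i), k₀ ∘ σ,
    ⟨Tuple.monotone_sort k₀, fun i => hdeg _ _,
      hli.comp (fun i => ε (σ i)) (ε.injective.comp σ.injective), by rw [hrange, hspan]⟩,
    fun i => hbS (ε (σ i)).2⟩

theorem exists_dual_family [FiniteDimensional K V] {κ : Type*} [DecidableEq κ]
    {B : LinearMap.BilinForm K V} (hB : B.Nondegenerate) {u : κ → V} (hu : LinearIndependent K u) :
    ∃ w : κ → V, ∀ i j, B (w j) (u i) = if i = j then 1 else 0 := by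
  have hcoord : ∀ j, ∃ w : V, ∀ i, B w (u i) = if i = j then 1 else 0 := by
    intro j
    obtain ⟨g, hg⟩ := LinearMap.exists_extend ((Basis.span hu).coord j)
    refine ⟨(B.toDual hB).symm g, fun i => ?_⟩
    have hgu : g (u i) = (Basis.span hu).coord j (Basis.span hu i) := by
      rw [← hg, LinearMap.comp_apply, Submodule.subtype_apply, Basis.span_apply]
    rw [LinearMap.BilinForm.apply_toDual_symm_apply, hgu, Basis.coord_apply, Basis.repr_self,
      Finsupp.single_apply]
  choose w hw using hcoord
  exact ⟨w, fun i j => hw j i⟩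

theorem exists_homogeneous_dual_family [FiniteDimensional K V] [DecidableEq ι] [AddGroup ι]
    (h : DirectSum.IsInternal Γ)
    {B : LinearMap.BilinForm K V} (hB : B.Nondegenerate) (hsymm : ∀ x y, B x y = B y x)
    (horth : ∀ i j, i + j ≠ 0 → ∀ x ∈ Γ i, ∀ y ∈ Γ j, B x y = 0)
    {κ : Type*} [DecidableEq κ] {u : κ → V} {k : κ → ι} (hu : ∀ i, u i ∈ Γ (k i))
    (hli : LinearIndependent K u) :
    ∃ w : κ → V, (∀ j, w j ∈ Γ (-k j)) ∧ ∀ i j, B (u i) (w j) = if i = j then 1 else 0 := by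
  obtain ⟨w, hw⟩ := exists_dual_family hB hli
  refine ⟨fun j => gradeProj h (-k j) (w j), fun j => gradeProj_mem _ _ _, fun i j => ?_⟩
  obtain hij | hij := eq_or_ne (k i) (k j)
  · beta_reduce
    rw [← hij, apply_gradeProj_neg h horth (hu i), hsymm, hw]
  · rw [if_neg fun e => hij (congrArg k e)]
    exact horth _ _ (fun e => hij (add_neg_eq_zero.1 e)) _ (hu i) _ (gradeProj_mem _ _ _)

end Families

end Gradings

/-! ### Good gradings and good algebras -/

section GoodGradings

variable {𝔤 : Type*} [LieRing 𝔤] [LieAlgebra ℂ 𝔤] {Γ : ℤ → Submodule ℂ 𝔤}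
  {B : LinearMap.BilinForm ℂ 𝔤} {f q : 𝔤} {𝔪 : LieSubalgebra ℂ 𝔤}

namespace IsGradingElement

theorem orthogonal (hq : IsGradingElement Γ q) (hinv : ∀ x y z, B ⁅x, y⁆ z = B x ⁅y, z⁆)
    (i j : ℤ) (hij : i + j ≠ 0) (x : 𝔤) (hx : x ∈ Γ i) (y : 𝔤) (hy : y ∈ Γ j) : B x y = 0 := by
  have hxqy := hinv x q y
  rw [← lie_skew, (hq i x).1 hx, (hq j y).1 hy] at hxqy
  simp only [map_neg, map_smul, LinearMap.neg_apply, LinearMap.smul_apply, smul_eq_mul] at hxqy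
  have hmul : ((i + j : ℤ) : ℂ) * B x y = 0 := by
    push_cast
    linear_combination -hxqy
  exact (mul_eq_zero.1 hmul).resolve_left (by exact_mod_cast hij)

theorem eq_zero_of_lie_eq_smul (hq : IsGradingElement Γ q) (h : DirectSum.IsInternal Γ) {μ : ℂ}
    (hμ : ∀ k : ℤ, μ ≠ k) {w : 𝔤} (hw : ⁅q, w⁆ = μ • w) : w = 0 := by
  refine eq_zero_of_gradeProj h fun k => ?_
  have hcomm : gradeProj h k ⁅q, w⁆ = ⁅q, gradeProj h k w⁆ := by
    have hmap := gradeProj_map h (T := LieAlgebra.ad ℂ 𝔤 q) (d := 0) (fun j x hx => ?_) k w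
    · rwa [zero_add] at hmap
    · rw [LieAlgebra.ad_apply, (hq j x).1 hx, zero_add]
      exact Submodule.smul_mem _ _ hx
  rw [hw, map_smul, (hq k _).1 (gradeProj_mem h k w), ← sub_eq_zero, ← sub_smul] at hcomm
  exact (smul_eq_zero.1 hcomm).resolve_left (sub_ne_zero.2 (hμ k))

theorem le_span_homogeneous [FiniteDimensional ℂ 𝔤] (hq : IsGradingElement Γ q)
    (h : DirectSum.IsInternal Γ) {V : Submodule ℂ 𝔤} (hV : ∀ v ∈ V, ⁅q, v⁆ ∈ V) :
    V ≤ Submodule.span ℂ {v | v ∈ V ∧ ∃ k, v ∈ Γ k} := by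
  intro v hv
  have hsup : v ∈ ⨆ μ, (LieAlgebra.ad ℂ 𝔤 q : Module.End ℂ 𝔤).genEigenspace μ 1 :=
    mem_of_gradeProj_mem h fun k => Submodule.mem_iSup_of_mem (k : ℂ) <|
      Module.End.mem_genEigenspace_one.2 ((hq k _).1 (gradeProj_mem h k v))
  have hinf := (Submodule.inf_iSup_genEigenspace (f := LieAlgebra.ad ℂ 𝔤 q) hV 1).le ⟨hv, hsup⟩
  refine (iSup_le fun μ w hw => ?_ : _ ≤ Submodule.span ℂ {v | v ∈ V ∧ ∃ k, v ∈ Γ k}) hinf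
  have hqw : ⁅q, w⁆ = μ • w := Module.End.mem_genEigenspace_one.1 hw.2
  by_cases hμ : ∃ k : ℤ, μ = k
  · obtain ⟨k, rfl⟩ := hμ
    exact Submodule.subset_span ⟨hw.1, k, (hq k w).2 hqw⟩
  · rw [hq.eq_zero_of_lie_eq_smul h (not_exists.1 hμ) hqw]
    exact zero_mem _

theorem mem_zero_of_isNilpotent [FiniteDimensional ℂ 𝔤] (hq : IsGradingElement Γ q)
    (h : DirectSum.IsInternal Γ) {𝔥 : LieSubalgebra ℂ 𝔤} [LieRing.IsNilpotent 𝔥] (hq𝔥 : q ∈ 𝔥)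
    {x : 𝔤} (hx : x ∈ 𝔥) : x ∈ Γ 0 := by
  refine (Submodule.span_le (p := Γ 0)).2 ?_
    (hq.le_span_homogeneous h (V := 𝔥.toSubmodule) (fun v hv => 𝔥.lie_mem hq𝔥 hv) hx)
  rintro v ⟨hv, k, hvk⟩
  have hnil := LieModule.isNilpotent_toEnd_of_isNilpotent ℂ 𝔥 𝔥 ⟨q, hq𝔥⟩
  obtain rfl | hne := eq_or_ne v 0
  · exact zero_mem _
  have hvec : (LieModule.toEnd ℂ 𝔥 𝔥 ⟨q, hq𝔥⟩).HasEigenvector k ⟨v, hv⟩ :=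
    ⟨Module.End.mem_eigenspace_iff.2 (Subtype.ext ((hq k v).1 hvk)),
      fun h0 => hne (congrArg Subtype.val h0)⟩
  have hval := Module.End.hasEigenvalue_of_hasEigenvector hvec
  have hk : (k : ℂ) = 0 := (hval.isNilpotent_of_isNilpotent hnil).eq_zero
  rwa [Int.cast_eq_zero.1 hk] at hvk

end IsGradingElement

namespace IsGoodGrading

theorem gradeProj_lie (hΓ : IsGoodGrading Γ f) {i : ℤ} {x : 𝔤} (hx : x ∈ Γ i) (k : ℤ) (v : 𝔤) :
    gradeProj hΓ.isInternal (i + k) ⁅x, v⁆ = ⁅x, gradeProj hΓ.isInternal k v⁆ :=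
  gradeProj_map hΓ.isInternal (T := LieAlgebra.ad ℂ 𝔤 x)
    (fun k y hy => hΓ.lie_mem i k x hx y hy) k v

theorem isNilpotent_ad [FiniteDimensional ℂ 𝔤] (hΓ : IsGoodGrading Γ f) {i : ℤ} (hi : 0 < i)
    {x : 𝔤} (hx : x ∈ Γ i) : IsNilpotent (LieAlgebra.ad ℂ 𝔤 x) :=
  isNilpotent_of_degree_pos hΓ.isInternal hi fun k y hy => hΓ.lie_mem i k x hx y hy

end IsGoodGrading

namespace IsGoodAlgebra

section Components

variable {χ : Dual ℂ 𝔤}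

theorem le (h𝔪 : IsGoodAlgebra χ Γ 𝔪) {k : ℤ} (hk : 2 ≤ k) : Γ k ≤ 𝔪.toSubmodule := by
  obtain ⟨𝔩, -, -, h𝔪𝔩⟩ := h𝔪
  exact h𝔪𝔩 ▸ le_sup_of_le_right (le_iSup₂_of_le k hk le_rfl)

theorem gradeProj_eq_zero (h𝔪 : IsGoodAlgebra χ Γ 𝔪) (h : DirectSum.IsInternal Γ) {k : ℤ}
    (hk : k ≤ 0) {v : 𝔤} (hv : v ∈ 𝔪) : gradeProj h k v = 0 := by
  obtain ⟨𝔩, h𝔩, -, h𝔪𝔩⟩ := h𝔪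
  suffices 𝔪.toSubmodule ≤ LinearMap.ker (gradeProj h k) from this hv
  rw [h𝔪𝔩]
  exact sup_le (fun x hx => gradeProj_ne h (by omega) (h𝔩 hx))
    (iSup₂_le fun i hi x hx => gradeProj_ne h (by omega) hx)

theorem exists_lagrangian (h𝔪 : IsGoodAlgebra χ Γ 𝔪) (h : DirectSum.IsInternal Γ) :
    ∃ 𝔩 ≤ Γ 1, (∀ x ∈ Γ 1, x ∈ 𝔩 ↔ ∀ y ∈ 𝔩, χ ⁅x, y⁆ = 0) ∧ 𝔩 ≤ 𝔪.toSubmodule ∧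
      ∀ v ∈ 𝔪, gradeProj h 1 v ∈ 𝔩 := by
  obtain ⟨𝔩, h𝔩, hlag, h𝔪𝔩⟩ := h𝔪
  refine ⟨𝔩, h𝔩, hlag, h𝔪𝔩 ▸ le_sup_left, ?_⟩
  change 𝔪.toSubmodule ≤ 𝔩.comap (gradeProj h 1)
  rw [h𝔪𝔩]
  refine sup_le (fun x hx => ?_) (iSup₂_le fun i hi x hx => ?_)
  · rwa [Submodule.mem_comap, gradeProj_same h (h𝔩 hx)]
  · rw [Submodule.mem_comap, gradeProj_ne h (by omega) hx]
    exact zero_mem _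

theorem mem_iff_lagrangian (h𝔪 : IsGoodAlgebra χ Γ 𝔪) (h : DirectSum.IsInternal Γ) {x : 𝔤}
    (hx : x ∈ Γ 1) : x ∈ 𝔪 ↔ ∀ y ∈ 𝔪, y ∈ Γ 1 → χ ⁅x, y⁆ = 0 := by
  obtain ⟨𝔩, h𝔩, hlag, h𝔩𝔪, hproj⟩ := h𝔪.exists_lagrangian h
  have hmem : ∀ y ∈ Γ 1, y ∈ 𝔪 ↔ y ∈ 𝔩 := fun y hy =>
    ⟨fun hy𝔪 => gradeProj_same h hy ▸ hproj y hy𝔪, fun hy𝔩 => h𝔩𝔪 hy𝔩⟩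
  rw [hmem x hx, hlag x hx]
  exact ⟨fun hxy y hy𝔪 hy => hxy y ((hmem y hy).1 hy𝔪),
    fun hxy y hy𝔩 => hxy y (h𝔩𝔪 hy𝔩) (h𝔩 hy𝔩)⟩

theorem gradeProj_mem (h𝔪 : IsGoodAlgebra χ Γ 𝔪) (h : DirectSum.IsInternal Γ) (k : ℤ) (v : 𝔤)
    (hv : v ∈ 𝔪.toSubmodule) : gradeProj h k v ∈ 𝔪.toSubmodule := by
  rcases lt_trichotomy k 1 with hk | rfl | hk
  · rw [h𝔪.gradeProj_eq_zero h (by omega) hv]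
    exact zero_mem _
  · obtain ⟨𝔩, -, -, h𝔩𝔪, hproj⟩ := h𝔪.exists_lagrangian h
    exact h𝔩𝔪 (hproj v hv)
  · exact h𝔪.le (k := k) (by omega) (_root_.gradeProj_mem h k v)

theorem degree_pos (h𝔪 : IsGoodAlgebra χ Γ 𝔪) (h : DirectSum.IsInternal Γ) {k : ℤ} {v : 𝔤}
    (hv : v ∈ 𝔪) (hvk : v ∈ Γ k) (hne : v ≠ 0) : 0 < k := by
  by_contra hk
  exact hne (gradeProj_same h hvk ▸ h𝔪.gradeProj_eq_zero h (not_lt.1 hk) hv)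

theorem eq_zero_of_homogeneous (h𝔪 : IsGoodAlgebra χ Γ 𝔪) (hΓ : IsGoodGrading Γ f) {T : 𝔤 →ₗ[ℂ] 𝔤}
    {d : ℤ} (hT : ∀ k, ∀ x ∈ Γ k, T x ∈ Γ (d + k))
    (hinj : ∀ k, 1 ≤ k → ∀ x ∈ Γ k, T x = 0 → x = 0) {v : 𝔤} (hv : v ∈ 𝔪) (hTv : T v = 0) :
    v = 0 := by
  refine eq_zero_of_gradeProj hΓ.isInternal fun k => ?_
  by_cases hk : k ≤ 0
  · exact h𝔪.gradeProj_eq_zero _ hk hv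
  · refine hinj k (by omega) _ (_root_.gradeProj_mem _ _ _) ?_
    rw [← gradeProj_map hΓ.isInternal hT, hTv, map_zero]

end Components

variable (h𝔪 : IsGoodAlgebra (B f) Γ 𝔪) (hΓ : IsGoodGrading Γ f) (hq : IsGradingElement Γ q)
  (hinv : ∀ x y z, B ⁅x, y⁆ z = B x ⁅y, z⁆)

include h𝔪 hΓ hq hinv

theorem character (a : 𝔤) (ha : a ∈ 𝔪) (b : 𝔤) (hb : b ∈ 𝔪) : B f ⁅a, b⁆ = 0 := by
  have h := hΓ.isInternal
  refine apply_eq_zero_of_homogeneous h (h𝔪.gradeProj_mem h)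
    (T := (LieModule.toEnd ℂ 𝔤 𝔤 : 𝔤 →ₗ[ℂ] Module.End ℂ 𝔤).compr₂ (B f))
    (fun k l a ha hak b hb hbl => ?_) ha hb
  change B f ⁅a, b⁆ = 0
  obtain rfl | ha₀ := eq_or_ne a 0
  · rw [zero_lie, map_zero]
  obtain rfl | hb₀ := eq_or_ne b 0
  · rw [lie_zero, map_zero]
  have hk := h𝔪.degree_pos h ha hak ha₀
  have hl := h𝔪.degree_pos h hb hbl hb₀
  by_cases hkl : k + l = 2
  · obtain ⟨rfl, rfl⟩ : k = 1 ∧ l = 1 := by omega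
    exact (h𝔪.mem_iff_lagrangian h hak).1 ha b hb hbl
  · exact hq.orthogonal hinv (-2) (k + l) (by omega) f hΓ.mem _ (hΓ.lie_mem k l a hak b hbl)

variable [FiniteDimensional ℂ 𝔤]

theorem sliceFamily {d : ℕ} {y x : Fin d → 𝔤} {k : Fin d → ℤ}
    (hy : IsHomogeneousBasis Γ 𝔪.toSubmodule y k) (hx : ∀ j, x j ∈ Γ (2 - k j))
    (hdual : ∀ i j, B ⁅f, y i⁆ (x j) = if i = j then 1 else 0) : SliceFamily (B f) 𝔪 y x := by
  have hpos : ∀ i, 0 < k i := fun i =>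
    h𝔪.degree_pos hΓ.isInternal (hy.mem_subspace i) (hy.mem i) (hy.linearIndependent.ne_zero i)
  have hpair : ∀ i j, B f ⁅y i, x j⁆ = if i = j then 1 else 0 := fun i j => by
    rw [← hinv, hdual]
  refine ⟨hy.span_eq, fun i => hΓ.isNilpotent_ad (hpos i) (hy.mem i), fun i j hji => ?_,
    fun i => by rw [hpair, if_pos rfl], fun i j hij => by rw [hpair, if_neg hij.ne'],
    fun i j _ => ?_, h𝔪.character hΓ hq hinv⟩
  · have hkji := hy.monotone hji
    exact h𝔪.le (k := k i + (2 - k j)) (by omega) (hΓ.lie_mem _ _ _ (hy.mem i) _ (hx j))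
  · refine mem_span_image_Ioi_of_lt hΓ.isInternal hy.monotone hy.mem ?_
      (lt_add_of_pos_left (k i) (hpos j)) (hΓ.lie_mem _ _ _ (hy.mem j) _ (hy.mem i))
    rw [hy.span_eq]
    exact 𝔪.lie_mem (hy.mem_subspace j) (hy.mem_subspace i)

theorem exists_sliceFamily (hsymm : ∀ x y, B x y = B y x) (hB : B.Nondegenerate) :
    ∃ (d : ℕ) (y x : Fin d → 𝔤), SliceFamily (B f) 𝔪 y x := by
  have h := hΓ.isInternal
  obtain ⟨d, y, k, hy, -⟩ := exists_isHomogeneousBasis (Γ := Γ)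
    (S := {v | v ∈ 𝔪.toSubmodule ∧ ∃ k, v ∈ Γ k}) fun v hv => hv.2
  rw [span_homogeneous_eq h (h𝔪.gradeProj_mem h)] at hy
  have hli : LinearIndependent ℂ fun i => ⁅f, y i⁆ :=
    hy.linearIndependent_map (T := LieAlgebra.ad ℂ 𝔤 f) fun v hv =>
      h𝔪.eq_zero_of_homogeneous hΓ (fun k x hx => hΓ.lie_mem _ _ _ hΓ.mem _ hx) hΓ.injective hv
  obtain ⟨x, hx, hdual⟩ := exists_homogeneous_dual_family h hB hsymm (hq.orthogonal hinv)
    (fun i => hΓ.lie_mem _ _ _ hΓ.mem _ (hy.mem i)) hli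
  refine ⟨d, y, x, h𝔪.sliceFamily hΓ hq hinv hy (fun j => ?_) hdual⟩
  rw [show 2 - k j = -(-2 + k j) by ring]
  exact hx j

end IsGoodAlgebra

end GoodGradings

/-! ### The Slodowy slice as a slice of a good algebra -/

section Sl2Modules

variable {R L M : Type*} [CommRing R] [LieRing L] [LieAlgebra R L] [AddCommGroup M] [Module R M]
  [LieRingModule L M] [LieModule R L M] {h e f : L}

theorem sl2_lie_h_pow_e (t : IsSl2Triple h e f) {x : M} {μ : R} (hx : ⁅h, x⁆ = μ • x) (i : ℕ) :
    ⁅h, (LieModule.toEnd R L M e ^ i) x⁆ = (μ + 2 * i) • (LieModule.toEnd R L M e ^ i) x := by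
  induction i with
  | zero => simpa using hx
  | succ i ih =>
    rw [pow_succ', Module.End.mul_apply, LieModule.toEnd_apply_apply, leibniz_lie, ih,
      t.lie_h_e_smul R, smul_lie, lie_smul, ← add_smul]
    congr 1
    push_cast
    ring

theorem sl2_lie_f_pow_e (t : IsSl2Triple h e f) {x : M} {μ : R} (hx : ⁅h, x⁆ = μ • x)
    (hefx : ⁅e, ⁅f, x⁆⁆ = 0) (i : ℕ) :
    ⁅f, (LieModule.toEnd R L M e ^ (i + 1)) x⁆ =
      (-((i + 1) * (μ + i))) • (LieModule.toEnd R L M e ^ i) x := by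
  have hfe : ⁅f, e⁆ = -h := by rw [← lie_skew, t.lie_e_f]
  induction i with
  | zero => simp [leibniz_lie f e x, hfe, hefx, hx]
  | succ i ih =>
    rw [pow_succ', Module.End.mul_apply, LieModule.toEnd_apply_apply, leibniz_lie, hfe, ih,
      neg_lie, sl2_lie_h_pow_e t hx, lie_smul, ← LieModule.toEnd_apply_apply R,
      ← Module.End.mul_apply, ← pow_succ', ← neg_smul, ← add_smul]
    congr 1
    push_cast
    ring

include R in
variable (R) in
theorem sl2_lie_e_lie_f_lie_h (t : IsSl2Triple h e f) (x : M) :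
    ⁅e, ⁅f, ⁅h, x⁆⁆⁆ = ⁅h, ⁅e, ⁅f, x⁆⁆⁆ := by
  rw [leibniz_lie h e, leibniz_lie h f, t.lie_h_e_smul R, t.lie_lie_smul_f R]
  simp only [neg_lie, smul_lie, lie_add, lie_neg, lie_smul]
  abel

end Sl2Modules

section Sl2FiniteDimensional

variable {K L M : Type*} [Field K] [CharZero K] [LieRing L] [LieAlgebra K L] [AddCommGroup M]
  [Module K M] [LieRingModule L M] [LieModule K L M] [FiniteDimensional K M] {h e f : L}

theorem sl2_exists_pow_e_eq_zero (t : IsSl2Triple h e f) {x : M} {μ : K} (hx : ⁅h, x⁆ = μ • x) :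
    ∃ i, (LieModule.toEnd K L M e ^ i) x = 0 := by
  by_contra! hne
  have heigen : ∀ i : ℕ, (LieModule.toEnd K L M h).HasEigenvalue (μ + 2 * i) := fun i =>
    Module.End.hasEigenvalue_of_hasEigenvector
      ⟨Module.End.mem_eigenspace_iff.2 (sl2_lie_h_pow_e t hx i), hne i⟩
  have hinj : Function.Injective fun i : ℕ => μ + 2 * (i : K) := fun i j hij => by
    simpa using hij
  exact Set.infinite_of_injective_forall_mem hinj heigen (Module.End.finite_hasEigenvalue _)

theorem sl2_lie_f_eq_zero_of_eigenvector (t : IsSl2Triple h e f) {x : M} {μ : K}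
    (hx : ⁅h, x⁆ = μ • x) (hefx : ⁅e, ⁅f, x⁆⁆ = 0) : ⁅f, x⁆ = 0 := by
  by_contra hfx
  have hprim : t.HasPrimitiveVectorWith ⁅f, x⁆ (μ - 2) :=
    ⟨hfx, by rw [leibniz_lie, t.lie_lie_smul_f K, hx, neg_lie, smul_lie, lie_smul, sub_smul]; abel,
      hefx⟩
  obtain ⟨n, hn⟩ := hprim.exists_nat
  have hx₀ : (LieModule.toEnd K L M e ^ 0) x ≠ 0 := fun h0 => hfx (by
    rw [pow_zero, Module.End.one_apply] at h0
    rw [h0, lie_zero])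
  obtain ⟨i, hi, hsucc⟩ :=
    Nat.exists_not_and_succ_of_not_zero_of_exists hx₀ (sl2_exists_pow_e_eq_zero t hx)
  have hcoef := sl2_lie_f_pow_e t hx hefx i
  rw [hsucc, lie_zero, eq_comm, smul_eq_zero_iff_left hi, neg_eq_zero] at hcoef
  have hpos : ((i + 1) * (n + 2 + i) : ℕ) = (0 : K) := by
    rw [← hcoef, show μ = n + 2 by linear_combination hn]
    push_cast
    ring
  exact absurd (Nat.cast_eq_zero.1 hpos) (by positivity)

theorem sl2_eq_zero_of_lie_e_lie_f [IsAlgClosed K] (t : IsSl2Triple h e f) {V : Submodule K M}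
    (hV : ∀ x ∈ V, ⁅h, x⁆ ∈ V) (hinj : ∀ x ∈ V, ⁅f, x⁆ = 0 → x = 0) {x : M} (hx : x ∈ V)
    (hefx : ⁅e, ⁅f, x⁆⁆ = 0) : x = 0 := by
  let W : Submodule K M := V ⊓ LinearMap.ker (LieModule.toEnd K L M e ∘ₗ LieModule.toEnd K L M f)
  have hW : ∀ z ∈ W, LieModule.toEnd K L M h z ∈ W := fun z ⟨hzV, hefz⟩ =>
    ⟨hV z hzV, show ⁅e, ⁅f, ⁅h, z⁆⁆⁆ = 0 by
      rw [sl2_lie_e_lie_f_lie_h K t, show ⁅e, ⁅f, z⁆⁆ = 0 from hefz, lie_zero]⟩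
  by_contra hne
  have : Nontrivial W := ⟨⟨⟨x, hx, hefx⟩, 0, fun h0 => hne (congrArg Subtype.val h0)⟩⟩
  obtain ⟨μ, hμ⟩ := Module.End.exists_eigenvalue ((LieModule.toEnd K L M h).restrict hW)
  obtain ⟨⟨z, hzV, hefz⟩, hz⟩ := hμ.exists_hasEigenvector
  have hhz : ⁅h, z⁆ = μ • z := congrArg Subtype.val hz.apply_eq_smul
  exact hz.2 (Subtype.ext (hinj z hzV (sl2_lie_f_eq_zero_of_eigenvector t hhz hefz)))

end Sl2FiniteDimensional

section SlodowySlices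

variable {𝔤 : Type*} [LieRing 𝔤] [LieAlgebra ℂ 𝔤] {Γ : ℤ → Submodule ℂ 𝔤}
  {B : LinearMap.BilinForm ℂ 𝔤} {e h f q : 𝔤} {𝔪 : LieSubalgebra ℂ 𝔤}

namespace IsGradedTriple

theorem lie_lie_mem (ht : IsGradedTriple Γ e h f) (hΓ : IsGoodGrading Γ f) {k : ℤ} {x : 𝔤}
    (hx : x ∈ Γ k) : ⁅e, ⁅f, x⁆⁆ ∈ Γ k := by
  have hmem := hΓ.lie_mem _ _ _ ht.e_mem _ (hΓ.lie_mem _ _ _ hΓ.mem _ hx)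
  rwa [add_neg_cancel_left] at hmem

variable [FiniteDimensional ℂ 𝔤]

theorem eq_zero_of_lie_lie_eq_zero (ht : IsGradedTriple Γ e h f) (hΓ : IsGoodGrading Γ f) {k : ℤ}
    (hk : 1 ≤ k) {x : 𝔤} (hx : x ∈ Γ k) (hefx : ⁅e, ⁅f, x⁆⁆ = 0) : x = 0 := by
  obtain rfl | hh := eq_or_ne h 0
  · have hf : (2 : ℂ) • f = 0 := by rw [← neg_eq_zero, ← ht.lie_h_f, zero_lie]
    refine hΓ.injective k hk x hx ?_
    rw [(smul_eq_zero.1 hf).resolve_left two_ne_zero, zero_lie]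
  · have t : IsSl2Triple h e f := ⟨hh, ht.lie_e_f, by rw [ht.lie_h_e, two_smul, two_nsmul],
      by rw [ht.lie_h_f, two_smul, two_nsmul]⟩
    refine sl2_eq_zero_of_lie_e_lie_f t (V := Γ k) (fun z hz => ?_) (hΓ.injective k hk) hx hefx
    rw [← zero_add k]
    exact hΓ.lie_mem 0 k h ht.h_mem z hz

theorem exists_lie_lie_eq (ht : IsGradedTriple Γ e h f) (hΓ : IsGoodGrading Γ f) {k : ℤ}
    (hk : 1 ≤ k) {y : 𝔤} (hy : y ∈ Γ k) : ∃ x ∈ Γ k, ⁅e, ⁅f, x⁆⁆ = y := by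
  let T : Module.End ℂ 𝔤 := LieAlgebra.ad ℂ 𝔤 e ∘ₗ LieAlgebra.ad ℂ 𝔤 f
  have hT : ∀ x ∈ Γ k, T x ∈ Γ k := fun x hx => ht.lie_lie_mem hΓ hx
  have hinj : Function.Injective (T.restrict hT) := by
    rw [← LinearMap.ker_eq_bot, LinearMap.ker_eq_bot']
    rintro ⟨x, hx⟩ h0
    exact Subtype.ext (ht.eq_zero_of_lie_lie_eq_zero hΓ hk hx (congrArg Subtype.val h0))
  obtain ⟨⟨x, hx⟩, hxy⟩ := LinearMap.injective_iff_surjective.1 hinj ⟨y, hy⟩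
  exact ⟨x, hx, congrArg Subtype.val hxy⟩

end IsGradedTriple

namespace IsGoodAlgebra

variable [FiniteDimensional ℂ 𝔤]

section Triple

variable {χ : Dual ℂ 𝔤} (h𝔪 : IsGoodAlgebra χ Γ 𝔪) (hΓ : IsGoodGrading Γ f)
  (ht : IsGradedTriple Γ e h f)

include h𝔪 hΓ ht

theorem eq_zero_of_lie_lie_eq_zero {v : 𝔤} (hv : v ∈ 𝔪) (hefv : ⁅e, ⁅f, v⁆⁆ = 0) : v = 0 :=
  h𝔪.eq_zero_of_homogeneous hΓ (T := LieAlgebra.ad ℂ 𝔤 e ∘ₗ LieAlgebra.ad ℂ 𝔤 f) (d := 0)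
    (fun k _ hx => (zero_add k).symm ▸ ht.lie_lie_mem hΓ hx)
    (fun _ hk _ hx => ht.eq_zero_of_lie_lie_eq_zero hΓ hk hx) hv hefv

theorem exists_lie_eq {v : 𝔤} (hv : v ∈ 𝔪) : ∃ z, ⁅e, z⁆ = v := by
  suffices v ∈ LinearMap.range (LieAlgebra.ad ℂ 𝔤 e : Module.End ℂ 𝔤) from this
  refine mem_of_gradeProj_mem hΓ.isInternal fun k => ?_
  by_cases hk : k ≤ 0
  · rw [h𝔪.gradeProj_eq_zero _ hk hv]
    exact zero_mem _
  · obtain ⟨x, -, hx⟩ := ht.exists_lie_lie_eq hΓ (k := k) (by omega)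
      (_root_.gradeProj_mem hΓ.isInternal k v)
    exact ⟨_, hx⟩

end Triple

section Orthogonal

variable (h𝔪 : IsGoodAlgebra (B f) Γ 𝔪) (hΓ : IsGoodGrading Γ f) (ht : IsGradedTriple Γ e h f)
  (hq : IsGradingElement Γ q) (hinv : ∀ x y z, B ⁅x, y⁆ z = B x ⁅y, z⁆) (hB : B.Nondegenerate)

include h𝔪 hΓ ht hq hinv hB

theorem mem_of_orthogonal_of_homogeneous {k : ℤ} {v : 𝔤} (hvk : v ∈ Γ k)
    (hv : ∀ y ∈ 𝔪, B v y = 0) :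
    v ∈ 𝔪.toSubmodule.map (LieAlgebra.ad ℂ 𝔤 f : Module.End ℂ 𝔤) ⊔
      LinearMap.ker (LieAlgebra.ad ℂ 𝔤 e : Module.End ℂ 𝔤) := by
  rcases lt_trichotomy k (-1) with hk | rfl | hk
  · have hBv : ∀ y, B v y = 0 := fun y => by
      rw [← apply_gradeProj_neg hΓ.isInternal (hq.orthogonal hinv) hvk]
      exact hv _ (h𝔪.le (k := -k) (by omega) (_root_.gradeProj_mem _ _ _))
    rw [hB.1 v hBv]
    exact zero_mem _
  · obtain ⟨u, hu, rfl⟩ := hΓ.surjective 1 le_rfl v hvk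
    refine Submodule.mem_sup_left ⟨u, ?_, rfl⟩
    refine (h𝔪.mem_iff_lagrangian hΓ.isInternal hu).2 fun y hy _ => ?_
    rw [← hinv, hv y hy]
  · obtain ⟨w, hw, hwv⟩ := ht.exists_lie_lie_eq hΓ (k := 2 + k) (by omega)
      (hΓ.lie_mem _ _ _ ht.e_mem _ hvk)
    refine Submodule.mem_sup.2 ⟨⁅f, w⁆, ⟨w, h𝔪.le (by omega) hw, rfl⟩, v - ⁅f, w⁆, ?_,
      add_sub_cancel _ _⟩
    rw [LinearMap.mem_ker, LieAlgebra.ad_apply, lie_sub, hwv, sub_self]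

theorem exists_lie_add_eq_of_orthogonal {v : 𝔤} (hv : ∀ y ∈ 𝔪, B v y = 0) :
    ∃ y ∈ 𝔪, ∃ s, ⁅e, s⁆ = 0 ∧ ⁅f, y⁆ + s = v := by
  have hI := hΓ.isInternal
  suffices v ∈ 𝔪.toSubmodule.map (LieAlgebra.ad ℂ 𝔤 f : Module.End ℂ 𝔤) ⊔
      LinearMap.ker (LieAlgebra.ad ℂ 𝔤 e : Module.End ℂ 𝔤) by
    obtain ⟨_, ⟨y, hy, rfl⟩, s, hs, hsum⟩ := Submodule.mem_sup.1 this
    exact ⟨y, hy, s, hs, hsum⟩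
  refine mem_of_gradeProj_mem hI fun k => h𝔪.mem_of_orthogonal_of_homogeneous hΓ ht hq hinv hB
    (_root_.gradeProj_mem hI k v) fun y hy => ?_
  rw [gradeProj_apply_eq hI (hq.orthogonal hinv)]
  exact hv _ (h𝔪.gradeProj_mem hI (-k) y hy)

end Orthogonal

section Slodowy

variable (h𝔪 : IsGoodAlgebra (B f) Γ 𝔪) (hΓ : IsGoodGrading Γ f) (ht : IsGradedTriple Γ e h f)
  (hq : IsGradingElement Γ q) (hinv : ∀ x y z, B ⁅x, y⁆ z = B x ⁅y, z⁆) (hB : B.Nondegenerate)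

include h𝔪 hΓ ht hq hinv hB

theorem slodowySlice_eq_sliceSet {d : ℕ} {y w : Fin d → 𝔤}
    (hy : Submodule.span ℂ (Set.range y) = 𝔪.toSubmodule) (hfw : ∀ j, B f ⁅e, w j⁆ = 0)
    (hdual : ∀ i j, B ⁅f, y i⁆ ⁅e, w j⁆ = if i = j then 1 else 0) :
    slodowySlice B e f = sliceSet (B f) 𝔪 fun j => ⁅e, w j⁆ := by
  have hker : ∀ s, ⁅e, s⁆ = 0 → ∀ z, B s ⁅e, z⁆ = 0 := fun s hs z => by
    rw [← hinv, ← lie_skew, hs, neg_zero, map_zero, LinearMap.zero_apply]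
  refine Set.Subset.antisymm ?_ fun ξ ⟨hfibre, hξw⟩ => ?_
  · rintro _ ⟨s, hs, rfl⟩
    rw [map_add]
    refine ⟨mem_zeroFibre.2 fun v hv => ?_, fun j => ?_⟩
    · obtain ⟨z, rfl⟩ := h𝔪.exists_lie_eq hΓ ht hv
      rw [LinearMap.add_apply, hker s hs, add_zero]
    · rw [LinearMap.add_apply, hfw, hker s hs, add_zero]
  · obtain ⟨v, rfl⟩ := (B.toDual hB).surjective ξ
    rw [mem_zeroFibre] at hfibre
    obtain ⟨z, hz, s, hs, hsum⟩ := h𝔪.exists_lie_add_eq_of_orthogonal hΓ ht hq hinv hB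
      (v := v - f) fun u hu => by
        rw [map_sub, LinearMap.sub_apply, ← hfibre u hu]
        exact sub_self _
    obtain rfl : v = f + (⁅f, z⁆ + s) := by rw [hsum, add_sub_cancel]
    suffices hz₀ : z = 0 by
      refine ⟨s, hs, ?_⟩
      rw [hz₀, lie_zero, zero_add]
      rfl
    obtain ⟨c, rfl⟩ := (Submodule.mem_span_range_iff_exists_fun ℂ).1 (hy.ge hz)
    refine Finset.sum_eq_zero fun j _ => ?_
    have hcoord : B (f + (⁅f, ∑ i, c i • y i⁆ + s)) ⁅e, w j⁆ = c j := by
      simp [hfw, hker s hs, lie_sum, hdual]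
    rw [← hcoord]
    exact (congrArg (· • y j) (hξw j)).trans (zero_smul ℂ _)

theorem exists_slodowy_sliceFamily (hsymm : ∀ x y, B x y = B y x) {S : Set 𝔤}
    (hS : ∀ v ∈ S, ∃ k, v ∈ Γ k) (hspan : Submodule.span ℂ S = 𝔪.toSubmodule) :
    ∃ (d : ℕ) (y x : Fin d → 𝔤), SliceFamily (B f) 𝔪 y x ∧ (∀ i, y i ∈ S) ∧
      slodowySlice B e f = sliceSet (B f) 𝔪 x := by
  have hI := hΓ.isInternal
  obtain ⟨d, y, k, hy, hyS⟩ := exists_isHomogeneousBasis hS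
  rw [hspan] at hy
  have hli : LinearIndependent ℂ fun i => ⁅e, ⁅f, y i⁆⁆ :=
    hy.linearIndependent_map (T := LieAlgebra.ad ℂ 𝔤 e ∘ₗ LieAlgebra.ad ℂ 𝔤 f) fun v hv =>
      h𝔪.eq_zero_of_lie_lie_eq_zero hΓ ht hv
  obtain ⟨w, hw, hdual⟩ := exists_homogeneous_dual_family hI hB hsymm (hq.orthogonal hinv)
    (fun i => ht.lie_lie_mem hΓ (hy.mem i)) hli
  have hx : ∀ j, ⁅e, -w j⁆ ∈ Γ (2 - k j) := fun j =>
    hΓ.lie_mem _ _ _ ht.e_mem _ (neg_mem (hw j))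
  have hdual' : ∀ i j, B ⁅f, y i⁆ ⁅e, -w j⁆ = if i = j then 1 else 0 := fun i j => by
    rw [← hinv, ← lie_skew, map_neg, map_neg, LinearMap.neg_apply, neg_neg, hdual]
  have hfx : ∀ j, B f ⁅e, -w j⁆ = 0 := fun j => by
    have hpos := h𝔪.degree_pos hI (hy.mem_subspace j) (hy.mem j) (hy.linearIndependent.ne_zero j)
    exact hq.orthogonal hinv (-2) _ (by omega) f hΓ.mem _ (hx j)
  exact ⟨d, y, _, h𝔪.sliceFamily hΓ hq hinv hy hx hdual', hyS,
    h𝔪.slodowySlice_eq_sliceSet hΓ ht hq hinv hB hy.span_eq hfx hdual'⟩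

end Slodowy

end IsGoodAlgebra

end SlodowySlices

/-! ### Reduction by stages for good algebras -/

section Stages

variable {𝔤 : Type*} [LieRing 𝔤] [LieAlgebra ℂ 𝔤] {Γ : ℤ → Submodule ℂ 𝔤} {q : 𝔤}

theorem IsGradingElement.lie_mem_of_gradeProj_mem (hq : IsGradingElement Γ q)
    (h : DirectSum.IsInternal Γ) {V : Submodule ℂ 𝔤} (hV : ∀ k, ∀ v ∈ V, gradeProj h k v ∈ V)
    {v : 𝔤} (hv : v ∈ V) : ⁅q, v⁆ ∈ V := by
  suffices Submodule.span ℂ {v | v ∈ V ∧ ∃ k, v ∈ Γ k} ≤ V.comap (LieAlgebra.ad ℂ 𝔤 q) from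
    this ((span_homogeneous_eq h hV).ge hv)
  rw [Submodule.span_le]
  rintro v ⟨hv, k, hvk⟩
  change ⁅q, v⁆ ∈ V
  rw [(hq k v).1 hvk]
  exact V.smul_mem _ hv

variable {B : LinearMap.BilinForm ℂ 𝔤} {χ : Dual ℂ 𝔤} {𝔪₁ 𝔪₂ 𝔪₀ : LieSubalgebra ℂ 𝔤}

theorem IsGoodAlgebra.mem_of_mem_sup (h𝔪 : IsGoodAlgebra χ Γ 𝔪₁) (h : DirectSum.IsInternal Γ)
    (h𝔪₀ : 𝔪₀.toSubmodule ≤ Γ 0) {v : 𝔤} (hv : v ∈ 𝔪₁.toSubmodule ⊔ 𝔪₀.toSubmodule)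
    (hv₀ : gradeProj h 0 v = 0) : v ∈ 𝔪₁ := by
  obtain ⟨a, ha, b, hb, rfl⟩ := Submodule.mem_sup.1 hv
  rw [map_add, h𝔪.gradeProj_eq_zero h le_rfl ha, zero_add, gradeProj_same h (h𝔪₀ hb)] at hv₀
  rwa [hv₀, add_zero]

theorem IsGoodAlgebra.apply_eq_zero_of_mem_zero (h𝔪 : IsGoodAlgebra χ Γ 𝔪₁)
    (h : DirectSum.IsInternal Γ) (hq : IsGradingElement Γ q)
    (hinv : ∀ x y z, B ⁅x, y⁆ z = B x ⁅y, z⁆) {x v : 𝔤} (hx : x ∈ Γ 0) (hv : v ∈ 𝔪₁) :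
    B x v = 0 := by
  rw [← apply_gradeProj_neg h (hq.orthogonal hinv) hx, h𝔪.gradeProj_eq_zero h neg_zero.le hv,
    map_zero]

theorem span_homogeneous_union_eq [FiniteDimensional ℂ 𝔤] (hq : IsGradingElement Γ q)
    (h : DirectSum.IsInternal Γ) {V W : Submodule ℂ 𝔤} (hV : ∀ v ∈ V, ⁅q, v⁆ ∈ V)
    (hW : ∀ w ∈ W, ⁅q, w⁆ ∈ W) :
    Submodule.span ℂ {v | (v ∈ V ∨ v ∈ W) ∧ ∃ k, v ∈ Γ k} = V ⊔ W := by
  refine le_antisymm (Submodule.span_le.2 ?_) (sup_le ?_ ?_)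
  · rintro v ⟨hv | hv, -⟩
    · exact Submodule.mem_sup_left hv
    · exact Submodule.mem_sup_right hv
  · exact (hq.le_span_homogeneous h hV).trans
      (Submodule.span_mono fun v hv => ⟨Or.inl hv.1, hv.2⟩)
  · exact (hq.le_span_homogeneous h hW).trans
      (Submodule.span_mono fun v hv => ⟨Or.inr hv.1, hv.2⟩)

theorem exists_twoStage [FiniteDimensional ℂ 𝔤] (hsymm : ∀ x y, B x y = B y x)
    (hinv : ∀ x y z, B ⁅x, y⁆ z = B x ⁅y, z⁆) (hB : B.Nondegenerate) {f₁ f₂ : 𝔤}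
    {Γ₁ Γ₂ : ℤ → Submodule ℂ 𝔤} (hΓ₁ : IsGoodGrading Γ₁ f₁) (hΓ₂ : IsGoodGrading Γ₂ f₂)
    {q₁ q₂ : 𝔤} (hq₁ : IsGradingElement Γ₁ q₁) (hq₂ : IsGradingElement Γ₂ q₂) (hq : q₂ ∈ Γ₁ 0)
    (h𝔪₁ : IsGoodAlgebra (B f₁) Γ₁ 𝔪₁) (h𝔪₂ : IsGoodAlgebra (B f₂) Γ₂ 𝔪₂) {e₂ h₂ : 𝔤}
    (ht : IsGradedTriple Γ₂ e₂ h₂ f₂)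
    (hsup : 𝔪₁.toSubmodule ⊔ 𝔪₀.toSubmodule = 𝔪₂.toSubmodule)
    (hstable : ∀ y ∈ 𝔪₀, ⁅q₂, y⁆ ∈ 𝔪₀) (hideal : ∀ x ∈ 𝔪₂, ∀ y ∈ 𝔪₁, ⁅x, y⁆ ∈ 𝔪₁)
    (hf₀ : f₂ - f₁ ∈ Γ₁ 0) (h𝔪₀ : 𝔪₀.toSubmodule ≤ Γ₁ 0) :
    ∃ (d₁ d₂ : ℕ) (y₁ x₁ : Fin d₁ → 𝔤) (y₂ x₂ : Fin d₂ → 𝔤),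
      TwoStage (B f₁) (B f₂) 𝔪₁ 𝔪₂ 𝔪₀ y₁ x₁ y₂ x₂ ∧
        slodowySlice B e₂ f₂ = sliceSet (B f₂) 𝔪₂ x₂ := by
  have hI₁ := hΓ₁.isInternal
  have hI₂ := hΓ₂.isInternal
  have hstable₂ : ∀ v ∈ 𝔪₂, ⁅q₂, v⁆ ∈ 𝔪₂ := fun v hv =>
    hq₂.lie_mem_of_gradeProj_mem hI₂ (h𝔪₂.gradeProj_mem hI₂) hv
  have hstable₁ : ∀ v ∈ 𝔪₁, ⁅q₂, v⁆ ∈ 𝔪₁ := fun v hv => by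
    have hv₂ : v ∈ 𝔪₂ := hsup.le (Submodule.mem_sup_left hv)
    refine h𝔪₁.mem_of_mem_sup hI₁ h𝔪₀ (hsup.ge (hstable₂ v hv₂)) ?_
    rw [← zero_add 0, hΓ₁.gradeProj_lie hq, h𝔪₁.gradeProj_eq_zero hI₁ le_rfl hv, lie_zero]
  obtain ⟨d₁, y₁, x₁, H₁⟩ := h𝔪₁.exists_sliceFamily hΓ₁ hq₁ hinv hsymm hB
  obtain ⟨d₂, y₂, x₂, H₂, hy₂, hS⟩ := h𝔪₂.exists_slodowy_sliceFamily hΓ₂ ht hq₂ hinv hB hsymm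
    (fun v hv => hv.2) ((span_homogeneous_union_eq hq₂ hI₂ hstable₁ hstable).trans hsup)
  refine ⟨d₁, d₂, y₁, x₁, y₂, x₂, ⟨H₁, H₂, hsup, hideal, fun a ha => ?_, fun i => (hy₂ i).1⟩, hS⟩
  have hzero := h𝔪₁.apply_eq_zero_of_mem_zero hI₁ hq₁ hinv hf₀ ha
  rw [map_sub, LinearMap.sub_apply, sub_eq_zero] at hzero
  exact hzero.symm

end Stages

set_option maxHeartbeats 800000 in
-- `obtain` and `rw` abstract over the nested dependent existentials of the goal, which is slow
theorem theorem2p3_general {𝔤 : Type*} [LieRing 𝔤] [LieAlgebra ℂ 𝔤] [FiniteDimensional ℂ 𝔤]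
    (B : LinearMap.BilinForm ℂ 𝔤) (hB_symm : ∀ x y, B x y = B y x)
    (hB_inv : ∀ x y z, B ⁅x, y⁆ z = B x ⁅y, z⁆) (hB_nondeg : B.Nondegenerate)
    (f₁ f₂ : 𝔤) (Γ₁ Γ₂ : ℤ → Submodule ℂ 𝔤) (hΓ₁ : IsGoodGrading Γ₁ f₁)
    (hΓ₂ : IsGoodGrading Γ₂ f₂) (q₁ q₂ : 𝔤) (hq₁ : IsGradingElement Γ₁ q₁)
    (hq₂ : IsGradingElement Γ₂ q₂) (hq : ⁅q₁, q₂⁆ = 0) (𝔪₁ 𝔪₂ : LieSubalgebra ℂ 𝔤)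
    (h𝔪₁ : IsGoodAlgebra (B f₁) Γ₁ 𝔪₁) (h𝔪₂ : IsGoodAlgebra (B f₂) Γ₂ 𝔪₂)
    (e₂ h₂ : 𝔤) (htriple : IsGradedTriple Γ₂ e₂ h₂ f₂) (𝔪₀ : LieSubalgebra ℂ 𝔤)
    (hsup : 𝔪₁.toSubmodule ⊔ 𝔪₀.toSubmodule = 𝔪₂.toSubmodule)
    (hstable : ∀ y ∈ 𝔪₀, ⁅q₂, y⁆ ∈ 𝔪₀) (hideal : ∀ x ∈ 𝔪₂, ∀ y ∈ 𝔪₁, ⁅x, y⁆ ∈ 𝔪₁)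
    (hf₀ : f₂ - f₁ ∈ Γ₁ 0) (h𝔪₀ : 𝔪₀.toSubmodule ≤ Γ₁ 0) :
    HasGeometricQuotient (unipotentGroup 𝔪₁) (zeroFibre (B f₁) 𝔪₁)
      (polyFunctions (zeroFibre (B f₁) 𝔪₁)) ∧
    HasGeometricQuotient (unipotentGroup 𝔪₂) (zeroFibre (B f₂) 𝔪₂)
      (polyFunctions (zeroFibre (B f₂) 𝔪₂)) ∧
    zeroFibre (B f₂) 𝔪₂ ⊆ zeroFibre (B f₁) 𝔪₁ ∧
    slodowySlice B e₂ f₂ ⊆ zeroFibre (B f₂) 𝔪₂ ∧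
    IsAffineVariety (polyFunctions (slodowySlice B e₂ f₂)) ∧
    (∀ y ∈ 𝔪₀, modI (B f₁) 𝔪₁ (SymmetricAlgebra.ι ℂ 𝔤 y - algebraMap ℂ _ (B f₂ y)) ∈
      classicalW (B f₁) 𝔪₁) ∧
    ∃ Ψ : stageW (B f₁) (B f₂) 𝔪₁ 𝔪₀ ≃ₐ[ℂ] classicalW (B f₂) 𝔪₂,
      (∀ a b, Ψ ((stageWPoisson (B f₁) (B f₂) 𝔪₁ 𝔪₀).bracket a b) =
        (classicalWPoisson (B f₂) 𝔪₂).bracket (Ψ a) (Ψ b)) ∧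
      (∀ (X : SymmetricAlgebra ℂ 𝔤) (hX₁ : modI (B f₁) 𝔪₁ X ∈ classicalW (B f₁) 𝔪₁)
        (hX₀ : modI₀ (B f₁) (B f₂) 𝔪₁ 𝔪₀ ⟨modI (B f₁) 𝔪₁ X, hX₁⟩ ∈
          stageW (B f₁) (B f₂) 𝔪₁ 𝔪₀),
        (Ψ ⟨modI₀ (B f₁) (B f₂) 𝔪₁ 𝔪₀ ⟨modI (B f₁) 𝔪₁ X, hX₁⟩, hX₀⟩ :
          _ ⧸ Ideal.span (shiftedElements (B f₂) 𝔪₂)) = modI (B f₂) 𝔪₂ X) ∧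
      ∃ (_ : MulAction (unipotentGroup 𝔪₀) (HamRed (B f₁) 𝔪₁))
        (μ₀ : HamRed (B f₁) 𝔪₁ → Dual ℂ 𝔪₀),
        (∀ (g : unipotentGroup 𝔪₀) (ξ : zeroFibre (B f₁) 𝔪₁),
          ∃ h : g • (ξ : Dual ℂ 𝔤) ∈ zeroFibre (B f₁) 𝔪₁,
            g • OrbitSpace.mk (unipotentGroup 𝔪₁) ξ =
              OrbitSpace.mk (unipotentGroup 𝔪₁) ⟨g • (ξ : Dual ℂ 𝔤), h⟩) ∧
        (∀ ξ : zeroFibre (B f₁) 𝔪₁,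
          μ₀ (OrbitSpace.mk (unipotentGroup 𝔪₁) ξ) = momentMap (B f₂) 𝔪₀ ξ) ∧
        HasGeometricQuotient (unipotentGroup 𝔪₀) (μ₀ ⁻¹' {0})
          (restrictFunctions (hamRedFunctions (B f₁) 𝔪₁) (μ₀ ⁻¹' {0})) ∧
        ∃ (Θ₁ : classicalW (B f₁) 𝔪₁ ≃ₐ[ℂ] hamRedFunctions (B f₁) 𝔪₁)
          (Θ₂ : classicalW (B f₂) 𝔪₂ ≃ₐ[ℂ] hamRedFunctions (B f₂) 𝔪₂)
          (ΘS : classicalW (B f₂) 𝔪₂ ≃ₐ[ℂ] polyFunctions (slodowySlice B e₂ f₂))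
          (Θ₀ : stageW (B f₁) (B f₂) 𝔪₁ 𝔪₀ ≃ₐ[ℂ]
            quotientFunctions (unipotentGroup 𝔪₀)
              (restrictFunctions (hamRedFunctions (B f₁) 𝔪₁) (μ₀ ⁻¹' {0}))),
          (∀ X (hX : modI (B f₁) 𝔪₁ X ∈ classicalW (B f₁) 𝔪₁) (ξ : zeroFibre (B f₁) 𝔪₁),
            (Θ₁ ⟨modI (B f₁) 𝔪₁ X, hX⟩ : _ → ℂ) (OrbitSpace.mk (unipotentGroup 𝔪₁) ξ) =
              evalAt (ξ : Dual ℂ 𝔤) X) ∧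
          (∀ X (hX : modI (B f₂) 𝔪₂ X ∈ classicalW (B f₂) 𝔪₂) (ξ : zeroFibre (B f₂) 𝔪₂),
            (Θ₂ ⟨modI (B f₂) 𝔪₂ X, hX⟩ : _ → ℂ) (OrbitSpace.mk (unipotentGroup 𝔪₂) ξ) =
              evalAt (ξ : Dual ℂ 𝔤) X) ∧
          (∀ X (hX : modI (B f₂) 𝔪₂ X ∈ classicalW (B f₂) 𝔪₂) (ξ : slodowySlice B e₂ f₂),
            (ΘS ⟨modI (B f₂) 𝔪₂ X, hX⟩ : _ → ℂ) ξ = evalAt (ξ : Dual ℂ 𝔤) X) ∧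
          (∀ w (hw : modI₀ (B f₁) (B f₂) 𝔪₁ 𝔪₀ w ∈ stageW (B f₁) (B f₂) 𝔪₁ 𝔪₀)
            (p : μ₀ ⁻¹' {0}),
            (Θ₀ ⟨modI₀ (B f₁) (B f₂) 𝔪₁ 𝔪₀ w, hw⟩ : _ → ℂ)
              (OrbitSpace.mk (unipotentGroup 𝔪₀) p) =
                (Θ₁ w : HamRed (B f₁) 𝔪₁ → ℂ) (p : HamRed (B f₁) 𝔪₁)) ∧
          (∃ σ : HamRed (B f₂) 𝔪₂ ≃ OrbitSpace (unipotentGroup 𝔪₀) (μ₀ ⁻¹' {0}),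
            (∀ (ξ : zeroFibre (B f₂) 𝔪₂),
              ∃ (h₁ : (ξ : Dual ℂ 𝔤) ∈ zeroFibre (B f₁) 𝔪₁)
                (h₀ : OrbitSpace.mk (unipotentGroup 𝔪₁) ⟨(ξ : Dual ℂ 𝔤), h₁⟩ ∈ μ₀ ⁻¹' {0}),
                σ (OrbitSpace.mk (unipotentGroup 𝔪₂) ξ) =
                  OrbitSpace.mk (unipotentGroup 𝔪₀) ⟨_, h₀⟩) ∧
            IsPoissonIso ((classicalWPoisson (B f₂) 𝔪₂).transport Θ₂)
              ((stageWPoisson (B f₁) (B f₂) 𝔪₁ 𝔪₀).transport Θ₀) σ ∧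
            (∀ a p, (Θ₀ a : _ → ℂ) (σ p) = (Θ₂ (Ψ a) : _ → ℂ) p)) ∧
          (∃ τ : slodowySlice B e₂ f₂ ≃ OrbitSpace (unipotentGroup 𝔪₀) (μ₀ ⁻¹' {0}),
            IsPoissonIso ((classicalWPoisson (B f₂) 𝔪₂).transport ΘS)
              ((stageWPoisson (B f₁) (B f₂) 𝔪₁ 𝔪₀).transport Θ₀) τ) := by
  have hq₂₀ : q₂ ∈ Γ₁ 0 := (hq₁ 0 q₂).2 (by rw [hq, Int.cast_zero, zero_smul])
  obtain ⟨d₁, d₂, y₁, x₁, y₂, x₂, H, hS⟩ := exists_twoStage hB_symm hB_inv hB_nondeg hΓ₁ hΓ₂ hq₁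
    hq₂ hq₂₀ h𝔪₁ h𝔪₂ htriple hsup hstable hideal hf₀ h𝔪₀
  rw [hS]
  exact ⟨H.first.hasGeometricQuotient, H.total.hasGeometricQuotient, H.zeroFibre_subset,
    fun ξ hξ => hξ.1, H.total.isAffineVariety,
    fun y hy => (modI_mem_classicalW H.first.character).2 (H.generator_mem hy _),
    H.stageAlgEquiv, H.stageAlgEquiv_bracket, H.coe_stageAlgEquiv, H.secondAction, H.secondMoment,
    fun g ξ => ⟨H.second_smul_mem g.2 ξ.2, rfl⟩, fun ξ => rfl, H.second_hasGeometricQuotient,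
    H.first.hamRedAlgEquiv, H.total.hamRedAlgEquiv, H.total.sliceAlgEquiv, H.secondAlgEquiv,
    H.first.hamRedAlgEquiv_apply, H.total.hamRedAlgEquiv_apply, H.total.sliceAlgEquiv_apply,
    H.secondAlgEquiv_apply,
    ⟨H.redEquiv, fun ξ => ⟨H.zeroFibre_subset ξ.2, (H.fibrePoint ξ).2, rfl⟩,
      H.isPoissonIso_redEquiv, H.secondAlgEquiv_redEquiv⟩,
    H.sliceEquiv, H.isPoissonIso_sliceEquiv⟩

theorem theorem2p3 {𝔤 : Type*} [LieRing 𝔤] [LieAlgebra ℂ 𝔤] [FiniteDimensional ℂ 𝔤]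
    [LieAlgebra.IsSimple ℂ 𝔤]
    -- a nondegenerate symmetric invariant bilinear form
    (B : LinearMap.BilinForm ℂ 𝔤) (hB_symm : ∀ x y, B x y = B y x)
    (hB_inv : ∀ x y z, B ⁅x, y⁆ z = B x ⁅y, z⁆) (hB_nondeg : B.Nondegenerate)
    -- two nilpotent elements with good gradings, good algebras
    (f₁ f₂ : 𝔤) (hf₁ : IsNilpotent (LieAlgebra.ad ℂ 𝔤 f₁))
    (hf₂ : IsNilpotent (LieAlgebra.ad ℂ 𝔤 f₂))
    (Γ₁ Γ₂ : ℤ → Submodule ℂ 𝔤) (hΓ₁ : IsGoodGrading Γ₁ f₁) (hΓ₂ : IsGoodGrading Γ₂ f₂)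
    (q₁ q₂ : 𝔤) (hq₁ : IsGradingElement Γ₁ q₁) (hq₂ : IsGradingElement Γ₂ q₂)
    (𝔥 : LieSubalgebra ℂ 𝔤) (h𝔥 : 𝔥.IsCartanSubalgebra) (hq₁𝔥 : q₁ ∈ 𝔥) (hq₂𝔥 : q₂ ∈ 𝔥)
    (𝔪₁ 𝔪₂ : LieSubalgebra ℂ 𝔤)
    (h𝔪₁ : IsGoodAlgebra (B f₁) Γ₁ 𝔪₁) (h𝔪₂ : IsGoodAlgebra (B f₂) Γ₂ 𝔪₂)
    (e₂ h₂ : 𝔤) (htriple : IsGradedTriple Γ₂ e₂ h₂ f₂)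
    -- `𝔪₂ = 𝔪₁ ⊕ 𝔪₀`, where `𝔪₀` is an `𝔥`-stable subalgebra and `𝔪₁` is an ideal of `𝔪₂`
    (𝔪₀ : LieSubalgebra ℂ 𝔤)
    (hsup : 𝔪₁.toSubmodule ⊔ 𝔪₀.toSubmodule = 𝔪₂.toSubmodule)
    (hdisj : Disjoint 𝔪₁.toSubmodule 𝔪₀.toSubmodule)
    (hstable : ∀ x ∈ 𝔥, ∀ y ∈ 𝔪₀, ⁅x, y⁆ ∈ 𝔪₀)
    (hideal : ∀ x ∈ 𝔪₂, ∀ y ∈ 𝔪₁, ⁅x, y⁆ ∈ 𝔪₁)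
    -- `f₀ = f₂ - f₁` and `𝔪₀` lie in degree `0` of the first grading
    (hf₀ : f₂ - f₁ ∈ Γ₁ 0) (h𝔪₀ : 𝔪₀.toSubmodule ≤ Γ₁ 0)
    -- `q₀ = q₂ - q₁` commutes with `f₁`
    (hq₀ : ⁅q₂ - q₁, f₁⁆ = 0) :
    -- the one-stage reductions `μ₁⁻¹(0) / M₁` and `μ₂⁻¹(0) / M₂` are well-defined varieties
    HasGeometricQuotient (unipotentGroup 𝔪₁) (zeroFibre (B f₁) 𝔪₁)
      (polyFunctions (zeroFibre (B f₁) 𝔪₁)) ∧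
    HasGeometricQuotient (unipotentGroup 𝔪₂) (zeroFibre (B f₂) 𝔪₂)
      (polyFunctions (zeroFibre (B f₂) 𝔪₂)) ∧
    zeroFibre (B f₂) 𝔪₂ ⊆ zeroFibre (B f₁) 𝔪₁ ∧
    slodowySlice B e₂ f₂ ⊆ zeroFibre (B f₂) 𝔪₂ ∧
    IsAffineVariety (polyFunctions (slodowySlice B e₂ f₂)) ∧
    -- the generators of the ideal `I₀` are in the first W-algebra
    (∀ y ∈ 𝔪₀, modI (B f₁) 𝔪₁ (SymmetricAlgebra.ι ℂ 𝔤 y - algebraMap ℂ _ (B f₂ y)) ∈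
      classicalW (B f₁) 𝔪₁) ∧
    -- the algebraic isomorphism `Ψ`
    ∃ Ψ : stageW (B f₁) (B f₂) 𝔪₁ 𝔪₀ ≃ₐ[ℂ] classicalW (B f₂) 𝔪₂,
      (∀ a b, Ψ ((stageWPoisson (B f₁) (B f₂) 𝔪₁ 𝔪₀).bracket a b) =
        (classicalWPoisson (B f₂) 𝔪₂).bracket (Ψ a) (Ψ b)) ∧
      (∀ (X : SymmetricAlgebra ℂ 𝔤) (hX₁ : modI (B f₁) 𝔪₁ X ∈ classicalW (B f₁) 𝔪₁)
        (hX₀ : modI₀ (B f₁) (B f₂) 𝔪₁ 𝔪₀ ⟨modI (B f₁) 𝔪₁ X, hX₁⟩ ∈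
          stageW (B f₁) (B f₂) 𝔪₁ 𝔪₀),
        (Ψ ⟨modI₀ (B f₁) (B f₂) 𝔪₁ 𝔪₀ ⟨modI (B f₁) 𝔪₁ X, hX₁⟩, hX₀⟩ :
          _ ⧸ Ideal.span (shiftedElements (B f₂) 𝔪₂)) = modI (B f₂) 𝔪₂ X) ∧
      -- the natural action of `M₀` on `μ₁⁻¹(0) / M₁` and its moment map `μ₀`
      ∃ (_ : MulAction (unipotentGroup 𝔪₀) (HamRed (B f₁) 𝔪₁))
        (μ₀ : HamRed (B f₁) 𝔪₁ → Dual ℂ 𝔪₀),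
        (∀ (g : unipotentGroup 𝔪₀) (ξ : zeroFibre (B f₁) 𝔪₁),
          ∃ h : g • (ξ : Dual ℂ 𝔤) ∈ zeroFibre (B f₁) 𝔪₁,
            g • OrbitSpace.mk (unipotentGroup 𝔪₁) ξ =
              OrbitSpace.mk (unipotentGroup 𝔪₁) ⟨g • (ξ : Dual ℂ 𝔤), h⟩) ∧
        (∀ ξ : zeroFibre (B f₁) 𝔪₁,
          μ₀ (OrbitSpace.mk (unipotentGroup 𝔪₁) ξ) = momentMap (B f₂) 𝔪₀ ξ) ∧
        -- `μ₀⁻¹(0) / M₀` is a well-defined variety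
        HasGeometricQuotient (unipotentGroup 𝔪₀) (μ₀ ⁻¹' {0})
          (restrictFunctions (hamRedFunctions (B f₁) 𝔪₁) (μ₀ ⁻¹' {0})) ∧
        -- the identifications of coordinate rings that define the Poisson structures
        ∃ (Θ₁ : classicalW (B f₁) 𝔪₁ ≃ₐ[ℂ] hamRedFunctions (B f₁) 𝔪₁)
          (Θ₂ : classicalW (B f₂) 𝔪₂ ≃ₐ[ℂ] hamRedFunctions (B f₂) 𝔪₂)
          (ΘS : classicalW (B f₂) 𝔪₂ ≃ₐ[ℂ] polyFunctions (slodowySlice B e₂ f₂))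
          (Θ₀ : stageW (B f₁) (B f₂) 𝔪₁ 𝔪₀ ≃ₐ[ℂ]
            quotientFunctions (unipotentGroup 𝔪₀)
              (restrictFunctions (hamRedFunctions (B f₁) 𝔪₁) (μ₀ ⁻¹' {0}))),
          (∀ X (hX : modI (B f₁) 𝔪₁ X ∈ classicalW (B f₁) 𝔪₁) (ξ : zeroFibre (B f₁) 𝔪₁),
            (Θ₁ ⟨modI (B f₁) 𝔪₁ X, hX⟩ : _ → ℂ) (OrbitSpace.mk (unipotentGroup 𝔪₁) ξ) =
              evalAt (ξ : Dual ℂ 𝔤) X) ∧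
          (∀ X (hX : modI (B f₂) 𝔪₂ X ∈ classicalW (B f₂) 𝔪₂) (ξ : zeroFibre (B f₂) 𝔪₂),
            (Θ₂ ⟨modI (B f₂) 𝔪₂ X, hX⟩ : _ → ℂ) (OrbitSpace.mk (unipotentGroup 𝔪₂) ξ) =
              evalAt (ξ : Dual ℂ 𝔤) X) ∧
          (∀ X (hX : modI (B f₂) 𝔪₂ X ∈ classicalW (B f₂) 𝔪₂) (ξ : slodowySlice B e₂ f₂),
            (ΘS ⟨modI (B f₂) 𝔪₂ X, hX⟩ : _ → ℂ) ξ = evalAt (ξ : Dual ℂ 𝔤) X) ∧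
          (∀ w (hw : modI₀ (B f₁) (B f₂) 𝔪₁ 𝔪₀ w ∈ stageW (B f₁) (B f₂) 𝔪₁ 𝔪₀)
            (p : μ₀ ⁻¹' {0}),
            (Θ₀ ⟨modI₀ (B f₁) (B f₂) 𝔪₁ 𝔪₀ w, hw⟩ : _ → ℂ)
              (OrbitSpace.mk (unipotentGroup 𝔪₀) p) = (Θ₁ w : HamRed (B f₁) 𝔪₁ → ℂ) (p : HamRed (B f₁) 𝔪₁)) ∧
          -- the inclusion `μ₂⁻¹(0) ⊆ μ₁⁻¹(0)` induces a Poisson isomorphism with comorphism `Ψ`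
          (∃ σ : HamRed (B f₂) 𝔪₂ ≃ OrbitSpace (unipotentGroup 𝔪₀) (μ₀ ⁻¹' {0}),
            (∀ (ξ : zeroFibre (B f₂) 𝔪₂),
              ∃ (h₁ : (ξ : Dual ℂ 𝔤) ∈ zeroFibre (B f₁) 𝔪₁)
                (h₀ : OrbitSpace.mk (unipotentGroup 𝔪₁) ⟨(ξ : Dual ℂ 𝔤), h₁⟩ ∈ μ₀ ⁻¹' {0}),
                σ (OrbitSpace.mk (unipotentGroup 𝔪₂) ξ) =
                  OrbitSpace.mk (unipotentGroup 𝔪₀) ⟨_, h₀⟩) ∧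
            IsPoissonIso ((classicalWPoisson (B f₂) 𝔪₂).transport Θ₂)
              ((stageWPoisson (B f₁) (B f₂) 𝔪₁ 𝔪₀).transport Θ₀) σ ∧
            (∀ a p, (Θ₀ a : _ → ℂ) (σ p) = (Θ₂ (Ψ a) : _ → ℂ) p)) ∧
          -- `μ₀⁻¹(0) / M₀` is isomorphic to the Slodowy slice as a Poisson variety
          (∃ τ : slodowySlice B e₂ f₂ ≃ OrbitSpace (unipotentGroup 𝔪₀) (μ₀ ⁻¹' {0}),
            IsPoissonIso ((classicalWPoisson (B f₂) 𝔪₂).transport ΘS)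
              ((stageWPoisson (B f₁) (B f₂) 𝔪₁ 𝔪₀).transport Θ₀) τ) := by
  have : LieRing.IsNilpotent 𝔥 := h𝔥.nilpotent
  have hq₂₀ : q₂ ∈ Γ₁ 0 := hq₁.mem_zero_of_isNilpotent hΓ₁.isInternal hq₁𝔥 hq₂𝔥
  exact theorem2p3_general B hB_symm hB_inv hB_nondeg f₁ f₂ Γ₁ Γ₂ hΓ₁ hΓ₂ q₁ q₂ hq₁ hq₂
    (by rw [(hq₁ 0 q₂).1 hq₂₀, Int.cast_zero, zero_smul]) 𝔪₁ 𝔪₂ h𝔪₁ h𝔪₂ e₂ h₂ htriple 𝔪₀ hsup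
    (hstable q₂ hq₂𝔥) hideal hf₀ h𝔪₀
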